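/- Let $q\in\mathbb C$, $0<|q|<1$, and fix a square root $(-1)^{1/2}$ of $-1$. Let $\phi^{NS}_m$ ($m\in\mathbb Z+\frac12$) and $\phi^R_m$ ($m\in\mathbb Z$) be fermions with $$\phi_m\phi_n+\phi_n\phi_m=\delta_{m+n,0}\,\eta_m,\qquad \eta_m=q^{2m}+q^{-2m},$$ in each sector, acting on the Fock spaces $\mathcal F^{NS}$, $\mathcal F^{R}$ generated by the vacuum vectors $|NS\rangle$, $|R\rangle$ with $\phi_m|NS\rangle=0$, $\phi_m|R\rangle=0$ for $m>0$ and $\phi^R_0|R\rangle=|R\rangle$. The dual vacua satisfy $\langle NS|NS\rangle=\langle R|R\rangle=1$, $\langle NS|\phi_{-m}=\langle R|\phi_{-m}=0$ for $m>0$, $\langle R|\phi^R_0=\langle R|$; bras are the linear combinations of $\langle NS|\cdots\phi_b\phi_a$, resp. $\langle R|\cdots\phi_b\phi_a$. On $\mathcal F^R\otimes\mathcal F^{NS}$ the modes of different sectors are taken to anticommute: $\phi^R_m$ acts as $\phi^R_m\otimes(-1)^F$ and $\phi^{NS}_m$ as $1\otimes\phi^{NS}_m$, where $F$ is the fermion number.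 Put $\phi^{NS}(w)=\sum_{n\in\mathbb Z+1/2}\phi^{NS}_nw^{-n}$, $\phi^R(w)=\sum_{n\in\mathbb Z}\phi^R_nw^{-n}$, $(x;q^4)_\infty=\prod_{j\ge0}(1-xq^{4j})$, and $$X_{k,l}=\frac{q^{4k}-q^{4l}}{1-q^{4(k+l)}},\qquad \gamma_n=\frac{(q^2;q^4)_n}{(q^4;q^4)_n},\qquad \varphi^R_0=\phi^R_0,$$ $$\varphi^R_{-m}=\tfrac{\gamma_mq^{5m}}{\eta_m}\phi^R_{-m},\quad \varphi^R_{m}=\tfrac{\gamma_mq^{-3m}}{\eta_m}\phi^R_{m}\quad(m>0),$$ $$\varphi^{NS}_{k+1/2}=-(-1)^{1/2}\tfrac{\gamma_kq^{-3k-2}}{\eta_{k+1/2}}\phi^{NS}_{k+1/2},\quad \varphi^{NS}_{-k-1/2}=(-1)^{1/2}\tfrac{\gamma_kq^{5k+2}}{\eta_{k+1/2}}\phi^{NS}_{-k-1/2}\quad(k\ge0).$$ For $z\neq0$ with a chosen square root $z^{1/2}$ let $$Y=-\sum_{m>n\ge0}X_{m,n}\varphi^R_{-m}\varphi^R_{-n}z^{m+n}-\sum_{k>l\ge0}X_{k+\frac12,l+\frac12}\varphi^{NS}_{k+\frac12}\varphi^{NS}_{l+\frac12}z^{-k-l-1}+\sum_{m,k\ge0}X_{m,-k-\frac12}\varphi^R_{-m}\varphi^{NS}_{k+\frac12}z^{m-k-\frac12},$$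 $$Y'=\sum_{k>l\ge0}X_{k+\frac12,l+\frac12}\varphi^{NS}_{-k-\frac12}\varphi^{NS}_{-l-\frac12}z^{k+l+1}+\sum_{m>n\ge0}X_{m,n}\varphi^R_{m}\varphi^R_{n}z^{-m-n}-\sum_{k,m\ge0}X_{-k-\frac12,m}\varphi^{NS}_{-k-\frac12}\varphi^R_{m}z^{k-m+\frac12}.$$ **(1)** Cut off at modes of index at most $N$ (Ramond) and at most $N+\frac12$ (Neveu–Schwarz), $Y$ and $Y'$ are nilpotent. For each choice of the outer states, the matrix elements $$\langle out|\Omega^R_{NS}(z)|in\rangle=\langle out|\otimes\langle NS|\,e^{Y}\,|R\rangle\otimes|in\rangle,\qquad \langle out|\Omega_R^{NS}(z)|in\rangle=\langle out|\otimes\langle R|\,e^{Y'}\,|NS\rangle\otimes|in\rangle$$ of the cut-off exponentials do not depend on $N$ for $N$ large. These values define $\Omega^R_{NS}(z)$ and $\Omega^{NS}_R(z)$, as maps from one Fock space to the completion of the other (equivalently, as bilinear forms in $\langle out|$, $|in\rangle$). **(2)** Both satisfy the exchange relation $$\phi^{NS}(w)\,\Omega^{NS}_R(z)=\Bigl(\frac{-q^4z}{w}\Bigr)^{1/2}\frac{(\frac{w}{q^3z};q^4)_\infty(\frac{q^7z}{w};q^4)_\infty}{(\frac{w}{qz};q^4)_\infty(\frac{q^5z}{w};q^4)_\infty}\,\Omega^{NS}_R(z)\,\phi^{R}(w),$$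 and the same with $NS$ and $R$ exchanged, where $(-q^4z/w)^{1/2}=(-1)^{1/2}q^2z^{1/2}/w^{1/2}$: for all $\langle out|$, $|in\rangle$ and all $w$ with $|q^5z|<|w|<|q^3z|$ and every square root $w^{1/2}$, the series of matrix elements on both sides converge absolutely and the relation holds. Moreover, for fixed $z$, $\Omega^{NS}_R(z)$ is the only such map that satisfies its exchange relation and $\langle NS|\Omega^{NS}_R|R\rangle=1$, and $\Omega^R_{NS}(z)$ is the only one that satisfies its own and $\langle R|\Omega^R_{NS}|NS\rangle=1$. **(3)** For $0<|w|<|q^3z|$, $$\langle NS|\Omega^{NS}_R(z)\phi^{R}(w)|R\rangle=\frac{(\frac{w}{qz};q^4)_\infty}{(\frac{w}{q^3z};q^4)_\infty},\qquad \langle R|\Omega_{NS}^R(z)\phi^{NS}(w)|NS\rangle=\Bigl(\frac{w}{-q^4z}\Bigr)^{1/2}\frac{(\frac{w}{qz};q^4)_\infty}{(\frac{w}{q^3z};q^4)_\infty}.$$ **(4)** At $z=q^{-4}$, $z^{1/2}=q^{-2}$, for all integers $n,m,k,l\ge0$, with $(n,m)\ne(0,0)$ in the formulas containing $X_{m,n}$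 or $X_{n,m}$: $$\langle NS|\Omega^{NS}_R\phi^R_{-n}\phi^R_{-m}|R\rangle=X_{m,n}\gamma_n\gamma_mq^{n+m},\qquad \langle R|\phi^R_n\phi^R_m\Omega^R_{NS}|NS\rangle=X_{n,m}\gamma_n\gamma_mq^{n+m},$$ $$\langle NS|\phi^{NS}_{k+\frac12}\Omega^{NS}_R\phi^R_{-n}|R\rangle=-(-1)^{1/2}X_{-k-\frac12,n}\gamma_n\gamma_kq^{n+k},\qquad \langle R|\phi^R_n\Omega^R_{NS}\phi^{NS}_{-k-\frac12}|NS\rangle=(-1)^{1/2}X_{-k-\frac12,n}\gamma_n\gamma_kq^{n+k},$$ $$\langle NS|\phi^{NS}_{k+\frac12}\phi^{NS}_{l+\frac12}\Omega^{NS}_R|R\rangle=-X_{l+\frac12,k+\frac12}\gamma_l\gamma_kq^{l+k},\qquad \langle R|\Omega^R_{NS}\phi^{NS}_{-k-\frac12}\phi^{NS}_{-l-\frac12}|NS\rangle=X_{l+\frac12,k+\frac12}\gamma_l\gamma_kq^{l+k}.$$ -/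

import Mathlib

open scoped TensorProduct
open Filter

namespace FermionEmission

noncomputable section

/-- The Fock space of fermions with creation operators labelled by `ℕ`. The basis vector
`Finsupp.single S 1`, with `S = {k₁ < k₂ < ⋯ < kᵣ}`, is the vector obtained from the vacuum by
applying the creation operators labelled `kᵣ, …, k₂, k₁` in this order. -/
abbrev Fock : Type := Finset ℕ →₀ ℂ

/-- The Neveu-Schwarz Fock space: the label `k` stands for the mode `k + 1/2`. -/
abbrev FockNS : Type := Fock

/-- The Ramond Fock space: the label `k` stands for the mode `k + 1`. -/
abbrev FockR : Type := Fock

/-- The vacuum vector. -/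
def vac : Fock := Finsupp.single ∅ 1

/-- `(-1)` to the number of occupied labels below `k`. -/
def jwSign (k : ℕ) (S : Finset ℕ) : ℂ := (-1) ^ (S.filter (· < k)).card

/-- The creation operator labelled `k`. -/
def create (k : ℕ) : Fock →ₗ[ℂ] Fock :=
  Finsupp.linearCombination ℂ fun S =>
    if k ∈ S then 0 else Finsupp.single (insert k S) (jwSign k S)

/-- The annihilation operator labelled `k`. -/
def annihilate (k : ℕ) : Fock →ₗ[ℂ] Fock :=
  Finsupp.linearCombination ℂ fun S =>
    if k ∈ S then Finsupp.single (S.erase k) (jwSign k S) else 0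

/-- The fermion parity `(-1)^F`. -/
def parity : Fock →ₗ[ℂ] Fock :=
  Finsupp.linearCombination ℂ fun S => Finsupp.single S ((-1) ^ S.card)

/-- `eta q a` is `η_m = q^{2m} + q^{-2m}` for `m = a / 2`. All the functions of an integer or
half-integer `m` are given as functions of the integer `a = 2m`. -/
def eta (q : ℂ) (a : ℤ) : ℂ := q ^ a + q ^ (-a)

/-- `phiNS q n` is the mode `φ^{NS}_{n+1/2}`; so `phiNS q (-k - 1)` is `φ^{NS}_{-k-1/2}`. -/
def phiNS (q : ℂ) : ℤ → (FockNS →ₗ[ℂ] FockNS)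
  | Int.ofNat k => eta q (2 * k + 1) • annihilate k
  | Int.negSucc k => create k

/-- `phiR q n` is the mode `φ^R_n`. The relations `φ^R_0 |R⟩ = |R⟩` and
`{φ^R_0, φ^R_n} = 2 δ_{n,0}` say that `φ^R_0` is the fermion parity. -/
def phiR (q : ℂ) : ℤ → (FockR →ₗ[ℂ] FockR)
  | Int.ofNat 0 => parity
  | Int.ofNat (k + 1) => eta q (2 * (k + 1)) • annihilate k
  | Int.negSucc k => create k

/-- The bilinear pairing with `(vac, vac) = 1` for which creation by `k` is adjoint to
`c k` times annihilation by `k`. -/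
def pairing (c : ℕ → ℂ) : Fock →ₗ[ℂ] Fock →ₗ[ℂ] ℂ :=
  Finsupp.linearCombination ℂ fun S => (∏ k ∈ S, c k) • Finsupp.lapply S

/-- `pairNS q v w = ⟨v|w⟩` in the Neveu-Schwarz sector. The bra `⟨v|` of
`|v⟩ = φ_{-a} φ_{-b} ⋯ |NS⟩` is `⟨NS| ⋯ φ_b φ_a`. -/
def pairNS (q : ℂ) : FockNS →ₗ[ℂ] FockNS →ₗ[ℂ] ℂ :=
  pairing fun k => eta q (2 * (k : ℤ) + 1)

/-- `pairR q v w = ⟨v|w⟩` in the Ramond sector. -/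
def pairR (q : ℂ) : FockR →ₗ[ℂ] FockR →ₗ[ℂ] ℂ :=
  pairing fun k => eta q (2 * ((k : ℤ) + 1))

/-! ### The two sectors together -/

/-- The tensor product of the Ramond and the Neveu-Schwarz Fock spaces. -/
abbrev FockRNS : Type := FockR ⊗[ℂ] FockNS

instance : AddCommGroup FockRNS := TensorProduct.addCommGroup

/-- `φ^R_n` on the tensor product. The factor `(-1)^F` of the Neveu-Schwarz sector makes it
anticommute with the modes `φ^{NS}`. -/
def liftR (q : ℂ) (n : ℤ) : Module.End ℂ FockRNS := TensorProduct.map (phiR q n) parity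

/-- `φ^{NS}_{n+1/2}` on the tensor product. -/
def liftNS (q : ℂ) (n : ℤ) : Module.End ℂ FockRNS :=
  TensorProduct.map LinearMap.id (phiNS q n)

/-- `⟨r| ⊗ ⟨v|` applied to a vector of the tensor product. -/
def braRNS (q : ℂ) (r : FockR) (v : FockNS) : FockRNS →ₗ[ℂ] ℂ :=
  LinearMap.mul' ℂ ℂ ∘ₗ TensorProduct.map (pairR q r) (pairNS q v)

/-! ### Coefficients -/

/-- `coeffX q a b` is `X_{k,l} = (q^{4k} - q^{4l}) / (1 - q^{4(k+l)})` for `k = a/2`, `l = b/2`. -/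
def coeffX (q : ℂ) (a b : ℤ) : ℂ :=
  (q ^ (2 * a) - q ^ (2 * b)) / (1 - q ^ (2 * (a + b)))

/-- `γ_n = (q²;q⁴)_n / (q⁴;q⁴)_n`. -/
def gam (q : ℂ) (n : ℕ) : ℂ :=
  (∏ j ∈ Finset.range n, (1 - q ^ 2 * (q ^ 4) ^ j)) /
    ∏ j ∈ Finset.range n, (1 - q ^ 4 * (q ^ 4) ^ j)

/-- `(x;q⁴)_∞`. -/
def qPoch (q x : ℂ) : ℂ := ∏' j : ℕ, (1 - x * (q ^ 4) ^ j)

/-- The rescaled mode `ϕ^R_{-m}`, for `m ≥ 0`. -/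
def varphiRneg (q : ℂ) (m : ℕ) : Module.End ℂ FockRNS :=
  if m = 0 then liftR q 0
  else (gam q m * q ^ (5 * m) / eta q (2 * m)) • liftR q (-m)

/-- The rescaled mode `ϕ^R_m`, for `m ≥ 0`. -/
def varphiRpos (q : ℂ) (m : ℕ) : Module.End ℂ FockRNS :=
  if m = 0 then liftR q 0
  else (gam q m * q ^ (-3 * (m : ℤ)) / eta q (2 * m)) • liftR q m

/-- The rescaled mode `ϕ^{NS}_{k+1/2}`, for `k ≥ 0`; `ι` is the square root of `-1`. -/
def varphiNSpos (q ι : ℂ) (k : ℕ) : Module.End ℂ FockRNS :=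
  (gam q k * q ^ (-3 * (k : ℤ) - 2) / eta q (2 * k + 1) * (-ι)) • liftNS q k

/-- The rescaled mode `ϕ^{NS}_{-k-1/2}`, for `k ≥ 0`. -/
def varphiNSneg (q ι : ℂ) (k : ℕ) : Module.End ℂ FockRNS :=
  (gam q k * q ^ (5 * k + 2) / eta q (2 * k + 1) * ι) • liftNS q (-k - 1)

/-! ### The emission operators

`s` is a square root of `z`, so that `z^{a/2} = s ^ a`. -/

/-- The exponent `Y`, with the sums cut off at modes `≤ N` (Ramond) and `≤ N + 1/2`
(Neveu-Schwarz). -/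
def expY (q ι s : ℂ) (N : ℕ) : Module.End ℂ FockRNS :=
  - (∑ m ∈ Finset.range (N + 1), ∑ n ∈ Finset.range m,
      (coeffX q (2 * m) (2 * n) * s ^ (2 * ((m : ℤ) + n))) • (varphiRneg q m * varphiRneg q n))
  - (∑ k ∈ Finset.range (N + 1), ∑ l ∈ Finset.range k,
      (coeffX q (2 * k + 1) (2 * l + 1) * s ^ (2 * (-(k : ℤ) - l - 1))) •
        (varphiNSpos q ι k * varphiNSpos q ι l))
  + ∑ m ∈ Finset.range (N + 1), ∑ k ∈ Finset.range (N + 1),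
      (coeffX q (2 * m) (-(2 * k) - 1) * s ^ (2 * (m : ℤ) - 2 * k - 1)) •
        (varphiRneg q m * varphiNSpos q ι k)

/-- The exponent `Y'`, with the sums cut off in the same way. -/
def expY' (q ι s : ℂ) (N : ℕ) : Module.End ℂ FockRNS :=
  (∑ k ∈ Finset.range (N + 1), ∑ l ∈ Finset.range k,
      (coeffX q (2 * k + 1) (2 * l + 1) * s ^ (2 * ((k : ℤ) + l + 1))) •
        (varphiNSneg q ι k * varphiNSneg q ι l))
  + (∑ m ∈ Finset.range (N + 1), ∑ n ∈ Finset.range m,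
      (coeffX q (2 * m) (2 * n) * s ^ (2 * (-(m : ℤ) - n))) • (varphiRpos q m * varphiRpos q n))
  - ∑ k ∈ Finset.range (N + 1), ∑ m ∈ Finset.range (N + 1),
      (coeffX q (-(2 * k) - 1) (2 * m) * s ^ (2 * (k : ℤ) - 2 * m + 1)) •
        (varphiNSneg q ι k * varphiRpos q m)

/-- `⟨out| ⊗ ⟨NS| e^Y |R⟩ ⊗ |inc⟩` for the cut-off exponent, which is nilpotent. -/
def cutNSR (q ι s : ℂ) (N : ℕ) (out : FockR) (inc : FockNS) : ℂ :=
  braRNS q out vac (IsNilpotent.exp (expY q ι s N) (vac ⊗ₜ inc))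

/-- `⟨out| ⊗ ⟨R| e^{Y'} |NS⟩ ⊗ |inc⟩` for the cut-off exponent, which is nilpotent. -/
def cutRNS (q ι s : ℂ) (N : ℕ) (out : FockNS) (inc : FockR) : ℂ :=
  braRNS q vac out (IsNilpotent.exp (expY' q ι s N) (inc ⊗ₜ vac))

/-- The bilinear form `(out, inc) ↦ ⟨out| Ω^R_{NS}(z) |inc⟩` of the matrix elements of
`Ω^R_{NS}(z) = ⟨NS| e^Y |R⟩`: the values for the full sum `Y` are those to which the cut-off
values converge. -/
def OmegaNSR (q ι s : ℂ) : FockR →ₗ[ℂ] FockNS →ₗ[ℂ] ℂ :=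
  Finsupp.linearCombination ℂ fun S => Finsupp.linearCombination ℂ fun T =>
    limUnder atTop fun N => cutNSR q ι s N (Finsupp.single S 1) (Finsupp.single T 1)

/-- The bilinear form of the matrix elements of `Ω^{NS}_R(z) = ⟨R| e^{Y'} |NS⟩`. -/
def OmegaRNS (q ι s : ℂ) : FockNS →ₗ[ℂ] FockR →ₗ[ℂ] ℂ :=
  Finsupp.linearCombination ℂ fun S => Finsupp.linearCombination ℂ fun T =>
    limUnder atTop fun N => cutRNS q ι s N (Finsupp.single S 1) (Finsupp.single T 1)

/-! ### The exchange relation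

`u` is a square root of `w`, so that `φ^R(w) = ∑ φ^R_n u^{-2n}` and
`φ^{NS}(w) = ∑ φ^{NS}_{n+1/2} u^{-(2n+1)}`, the sums being over `n ∈ ℤ`. -/

/-- `(-q⁴z/w)^{1/2}`, with the square root `ι q² z^{1/2} / w^{1/2}`. -/
def rootFactor (q ι s u : ℂ) : ℂ := ι * q ^ 2 * s / u

/-- The factor of the exchange relation at `z = s²`, `w = u²`. -/
def exchangeFactor (q ι s u : ℂ) : ℂ :=
  rootFactor q ι s u *
    (qPoch q (u ^ 2 / (q ^ 3 * s ^ 2)) * qPoch q (q ^ 7 * s ^ 2 / u ^ 2)) /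
    (qPoch q (u ^ 2 / (q * s ^ 2)) * qPoch q (q ^ 5 * s ^ 2 / u ^ 2))

/-- The matrix elements of the exchange relation `φ^R(w) Ω = (factor) Ω φ^{NS}(w)`, all series
being convergent in the annulus `|q⁵z| < |w| < |q³z|`. The bra `⟨out| φ^R_n` is the bra of
`φ^R_{-n} |out⟩`. -/
def ExchangeNSR (q ι s : ℂ) (Om : FockR →ₗ[ℂ] FockNS →ₗ[ℂ] ℂ) : Prop :=
  ∀ (out : FockR) (inc : FockNS) (u : ℂ),
    ‖q ^ 5 * s ^ 2‖ < ‖u ^ 2‖ → ‖u ^ 2‖ < ‖q ^ 3 * s ^ 2‖ →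
      Summable (fun n : ℤ => Om (phiR q (-n) out) inc * u ^ (-(2 * n))) ∧
      Summable (fun n : ℤ => Om out (phiNS q n inc) * u ^ (-(2 * n + 1))) ∧
      ∑' n : ℤ, Om (phiR q (-n) out) inc * u ^ (-(2 * n)) =
        exchangeFactor q ι s u * ∑' n : ℤ, Om out (phiNS q n inc) * u ^ (-(2 * n + 1))

/-- The matrix elements of the exchange relation `φ^{NS}(w) Ω = (factor) Ω φ^R(w)`. The bra
`⟨out| φ^{NS}_{n+1/2}` is the bra of `φ^{NS}_{-n-1/2} |out⟩`. -/
def ExchangeRNS (q ι s : ℂ) (Om : FockNS →ₗ[ℂ] FockR →ₗ[ℂ] ℂ) : Prop :=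
  ∀ (out : FockNS) (inc : FockR) (u : ℂ),
    ‖q ^ 5 * s ^ 2‖ < ‖u ^ 2‖ → ‖u ^ 2‖ < ‖q ^ 3 * s ^ 2‖ →
      Summable (fun n : ℤ => Om (phiNS q (-n - 1) out) inc * u ^ (-(2 * n + 1))) ∧
      Summable (fun n : ℤ => Om out (phiR q n inc) * u ^ (-(2 * n))) ∧
      ∑' n : ℤ, Om (phiNS q (-n - 1) out) inc * u ^ (-(2 * n + 1)) =
        exchangeFactor q ι s u * ∑' n : ℤ, Om out (phiR q n inc) * u ^ (-(2 * n))

end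

end FermionEmission

namespace FermionEmission
noncomputable section

/-! ### The `q`-series -/

section QSeries

variable {q : ℂ}

/-! Write γ(t) = ∑ γ_n tⁿ, x = q⁵z, y = 1/(q³z), κ = (-1)^{1/2} q² z^{1/2}; note xy = q². By the
q-binomial theorem (`gamSeries_eq`) the factor of the exchange relation is κ w^{-1/2} γ(x/w)/γ(yw)
(`exchangeFactor_eq`). The relation thus says that one generating function divided by γ(x/w) equals,
up to a monomial, the other divided by γ(yw): a factorization problem on an annulus.

Existence. Y' is quadratic in pairwise anticommuting operators (Neveu-Schwarz creation, Ramond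
annihilation), plus terms linear in them times φ^R_0, which acts as the parity. Hence conjugating a
dual operator by e^{Y'} adds only a linear combination of these operators and the parity
(`GrassmannSystem.dual_mul_exp`). Between the inner vacua this becomes a Wick rule: φ^{NS}_{k+1/2}
to the left of Ω, or φ^R_{-i-1} to its right, is replaced by a finite sum of matrix elements with
fewer fermions (`cutForm_create_left`, `cutForm_create_right`). Induction on the fermion number
shows that the cut-off values stabilize, and the limit obeys the same rules. The contraction
coefficients `kerF` and `kerH` are convolutions of the coefficients of γ and 1/γ
(`sum_gamInv_mul_gam_add`, `sum_gamInv_mul_gam_sub`). Therefore one generating function is γ(x/w)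
times a Laurent polynomial d, and the other is γ(yw) times d/w (`exists_hasSum_of_recursion`), which
is the exchange relation.

Uniqueness. Let a solution have zero vacuum element. By induction on the fermion number, the
elements with an annihilation mode or φ^R_0 vanish. After division by γ(x/w) and γ(yw), a series in
nonpositive powers of w equals one in positive powers on a circle, so all Fourier coefficients are
zero (`eq_zero_of_exchange`).

Duality. Y at z^{1/2} is adjoint to Y' at -1/(q⁴z^{1/2}), so Ω^R_{NS} is a transpose of Ω^{NS}_R at
another point (`OmegaNSR_eq`). Its exchange relation is the same one under w ↦ 1/w, which swaps x
and y and inverts κ. The one-point and two-point functions are one or two applications of the Wick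
rules. -/

theorem pow_sub_pow_ne_zero (hq0 : q ≠ 0) (hq1 : ‖q‖ < 1) {a b : ℕ} (hab : a ≠ b) :
    q ^ a - q ^ b ≠ 0 := by
  intro h
  apply hab
  have h1 : ‖q‖ ^ a = ‖q‖ ^ b := by rw [← norm_pow, ← norm_pow, sub_eq_zero.1 h]
  exact (pow_right_strictAnti₀ (norm_pos_iff.2 hq0) hq1).injective h1

theorem one_sub_pow_ne_zero (hq0 : q ≠ 0) (hq1 : ‖q‖ < 1) {a : ℕ} (ha : a ≠ 0) :
    1 - q ^ a ≠ 0 := by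
  simpa using pow_sub_pow_ne_zero hq0 hq1 ha.symm

theorem eta_natCast (hq0 : q ≠ 0) (a : ℕ) : q ^ a * eta q a = 1 + q ^ (2 * a) := by
  have := pow_ne_zero a hq0
  rw [eta, zpow_neg, zpow_natCast]
  field_simp
  ring

theorem eta_ne_zero (hq0 : q ≠ 0) (hq1 : ‖q‖ < 1) {a : ℕ} (ha : a ≠ 0) : eta q a ≠ 0 := by
  intro h
  have h1 := eta_natCast hq0 a
  -- The numerator 1 + q^{2a} of η divides 1 - q^{4a}, which is nonzero because |q| < 1.
  have h2 := one_sub_pow_ne_zero hq0 hq1 (a := 4 * a) (by omega)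
  apply h2
  rw [h, mul_zero] at h1
  linear_combination (1 - q ^ (2 * a)) * (-h1)

theorem gam_zero : gam q 0 = 1 := by simp [gam]

theorem gam_succ (n : ℕ) :
    gam q (n + 1) = gam q n * (1 - q ^ (4 * n + 2)) / (1 - q ^ (4 * n + 4)) := by
  have h : 1 - q ^ (4 * n + 4) = 1 - q ^ 4 * (q ^ 4) ^ n := by ring
  have h' : 1 - q ^ (4 * n + 2) = 1 - q ^ 2 * (q ^ 4) ^ n := by ring
  rw [gam, gam, Finset.prod_range_succ, Finset.prod_range_succ, h, h', div_mul_eq_mul_div, div_div]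

theorem gam_ne_zero (hq0 : q ≠ 0) (hq1 : ‖q‖ < 1) (n : ℕ) : gam q n ≠ 0 := by
  induction n with
  | zero => simp [gam_zero]
  | succ n ih =>
    rw [gam_succ]
    exact div_ne_zero (mul_ne_zero ih (one_sub_pow_ne_zero hq0 hq1 (by omega)))
      (one_sub_pow_ne_zero hq0 hq1 (by omega))

/-- The coefficients of the power series inverse to `∑ γ_n xⁿ`. -/
def gamInv (q : ℂ) (n : ℕ) : ℂ := q ^ (2 * n) * gam q n * (1 - q ^ 2) / (q ^ (4 * n) - q ^ 2)

/-- The kernel through which a contraction connects two modes of the same sector. -/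
def kerF (q : ℂ) (i l : ℕ) : ℂ :=
  q ^ (2 * l) * gam q i * gam q l * (1 - q ^ (4 * i + 2)) / (1 - q ^ (4 * (i + l + 1)))

/-- The kernel through which a contraction connects modes of different sectors. -/
def kerH (q : ℂ) (i m : ℕ) : ℂ :=
  q ^ (2 * m) * gam q i * gam q m * (1 - q ^ (4 * i + 2)) / (q ^ (4 * m) - q ^ (4 * i + 2))

/-- `γ_n` for `n ≥ 0`, and `0` for `n < 0`. -/
def gamZ (q : ℂ) : ℤ → ℂ
  | Int.ofNat n => gam q n
  | Int.negSucc _ => 0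

theorem gamZ_natCast (n : ℕ) : gamZ q n = gam q n := rfl

theorem gamZ_of_neg {n : ℤ} (hn : n < 0) : gamZ q n = 0 := by
  obtain ⟨k, rfl⟩ := Int.eq_negSucc_of_lt_zero hn
  rfl

theorem gamInv_zero (hq0 : q ≠ 0) (hq1 : ‖q‖ < 1) : gamInv q 0 = 1 := by
  have := one_sub_pow_ne_zero hq0 hq1 two_ne_zero
  simp [gamInv, gam_zero, this]

theorem kerF_zero_right (n : ℕ) :
    kerF q n 0 = gam q (n + 1) := by
  rw [kerF, gam_succ, gam_zero]
  ring

theorem kerF_succ_right (hq0 : q ≠ 0) (hq1 : ‖q‖ < 1) (n l : ℕ) :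
    kerF q n (l + 1) = kerF q (n + 1) l + gamInv q (l + 1) * gam q (n + 1) := by
  rw [kerF, kerF, gamInv, gam_succ, gam_succ]
  have h1 := one_sub_pow_ne_zero hq0 hq1 (a := 4 * n + 4) (by omega)
  have h2 := one_sub_pow_ne_zero hq0 hq1 (a := 4 * l + 4) (by omega)
  have h3 := one_sub_pow_ne_zero hq0 hq1 (a := 4 * (n + (l + 1) + 1)) (by omega)
  have h4 := pow_sub_pow_ne_zero hq0 hq1 (a := 4 * (l + 1)) (b := 2) (by omega)
  have h5 : n + 1 + l + 1 = n + (l + 1) + 1 := by ring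
  rw [h5]
  field_simp
  ring

/-- Passing from l to l + 1 adds one term and shifts n in the rest; `kerF_succ_right` is the same
recursion for the closed form. The sum is a coefficient of γ times a truncation of 1/γ. -/
theorem sum_gamInv_mul_gam_add (hq0 : q ≠ 0) (hq1 : ‖q‖ < 1) (n l : ℕ) :
    ∑ j ∈ Finset.range (l + 1), gamInv q (l - j) * gam q (n + 1 + j) = kerF q n l := by
  induction l generalizing n with
  | zero => simp [gamInv_zero hq0 hq1, kerF_zero_right]
  | succ l ih =>
    rw [Finset.sum_range_succ', kerF_succ_right hq0 hq1, ← ih]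
    congr 1
    refine Finset.sum_congr rfl fun j _ => ?_
    rw [Nat.add_sub_add_right, add_right_comm (n + 1) 1 j, add_assoc (n + 1) j 1]

/-- For l > 0 the terms with j ≥ 1 are the previous convolution at n = 0, whose closed form cancels
the term j = 0. This is what makes `gamInv` the coefficients of 1/γ. -/
theorem sum_gamInv_mul_gam (hq0 : q ≠ 0) (hq1 : ‖q‖ < 1) (l : ℕ) :
    ∑ j ∈ Finset.range (l + 1), gamInv q (l - j) * gam q j = if l = 0 then 1 else 0 := by
  cases l with
  | zero => simp [gamInv_zero hq0 hq1, gam_zero]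
  | succ l =>
    have h := sum_gamInv_mul_gam_add hq0 hq1 0 l
    rw [Finset.sum_range_succ', if_neg (by omega)]
    simp only [Nat.add_sub_add_right, zero_add, gam_zero, add_comm 1] at h ⊢
    rw [h, kerF, gamInv, gam_zero]
    have h3 := one_sub_pow_ne_zero hq0 hq1 (a := 4 * (l + 1)) (by omega)
    have h4 := pow_sub_pow_ne_zero hq0 hq1 (a := 4 * (l + 1)) (b := 2) (by omega)
    rw [Nat.sub_zero, gam_succ]
    have h5 : q ^ (4 * l + 4) = q ^ (4 * (l + 1)) := by ring
    rw [zero_add, h5]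
    field_simp
    ring

theorem kerH_zero_right (hq0 : q ≠ 0) (hq1 : ‖q‖ < 1) (n : ℕ) : kerH q n 0 = gam q n := by
  have := one_sub_pow_ne_zero hq0 hq1 (a := 4 * n + 2) (by omega)
  simp [kerH, gam_zero, this]

theorem kerH_zero_left (m : ℕ) : kerH q 0 m = gamInv q m := by
  simp [kerH, gamInv, gam_zero]

theorem kerH_succ_succ (hq0 : q ≠ 0) (hq1 : ‖q‖ < 1) (n m : ℕ) :
    kerH q (n + 1) (m + 1) = kerH q n m / q ^ 2 + gamInv q (m + 1) * gam q (n + 1) := by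
  rw [kerH, kerH, gamInv, gam_succ, gam_succ]
  have h1 := one_sub_pow_ne_zero hq0 hq1 (a := 4 * n + 4) (by omega)
  have h2 := one_sub_pow_ne_zero hq0 hq1 (a := 4 * m + 4) (by omega)
  have h3 := pow_sub_pow_ne_zero hq0 hq1 (a := 4 * m) (b := 4 * n + 2) (by omega)
  have h3' := pow_sub_pow_ne_zero hq0 hq1 (a := 4 * (m + 1)) (b := 4 * (n + 1) + 2) (by omega)
  have h4 := pow_sub_pow_ne_zero hq0 hq1 (a := 4 * (m + 1)) (b := 2) (by omega)
  field_simp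
  ring

/-- Here both indices decrease together, as in a product of a series in x/w and one in yw; the
weight q^{-2N} is (xy)^{-N}. Removing the term N = 0 lowers n and m simultaneously, which is the
recursion `kerH_succ_succ`. -/
theorem sum_gamInv_mul_gam_sub (hq0 : q ≠ 0) (hq1 : ‖q‖ < 1) (n m : ℕ) :
    ∑ N ∈ Finset.range (m + 1), gamInv q (m - N) * gamZ q ((n : ℤ) - N) / (q ^ 2) ^ N =
      kerH q n m := by
  induction m generalizing n with
  | zero => simp [gamInv_zero hq0 hq1, kerH_zero_right hq0 hq1, gamZ_natCast]
  | succ m ih =>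
    rw [Finset.sum_range_succ']
    cases n with
    | zero =>
      rw [Finset.sum_eq_zero, kerH_zero_left]
      · simpa [gam_zero] using congrArg (gamInv q (m + 1) * ·) (gamZ_natCast (q := q) 0)
      · intro N _
        rw [gamZ_of_neg (by push_cast; omega)]
        simp
    | succ n =>
      rw [kerH_succ_succ hq0 hq1, ← ih, Finset.sum_div]
      congr 1
      · refine Finset.sum_congr rfl fun j _ => ?_
        rw [Nat.add_sub_add_right, pow_succ, div_div]
        push_cast
        rw [add_sub_add_right_eq_sub]
      · have : ((n + 1 : ℕ) : ℤ) - (0 : ℕ) = ((n + 1 : ℕ) : ℤ) := by simp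
        rw [this, gamZ_natCast]
        simp

theorem tendsto_pow_linear (hq1 : ‖q‖ < 1) (b : ℕ) :
    Tendsto (fun n : ℕ => q ^ (4 * n + b)) atTop (nhds 0) := by
  refine (tendsto_pow_atTop_nhds_zero_of_norm_lt_one hq1).comp ?_
  exact tendsto_atTop_mono (fun n => by simp only [id]; omega) tendsto_id

theorem summable_norm_gam (hq0 : q ≠ 0) (hq1 : ‖q‖ < 1) {x : ℂ} (hx : ‖x‖ < 1) :
    Summable fun n => ‖gam q n * x ^ n‖ := by
  rcases eq_or_ne x 0 with rfl | hx0
  · exact summable_of_ne_finset_zero (s := {0}) fun n hn => by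
      simp [zero_pow (show n ≠ 0 by simpa using hn)]
  refine summable_of_ratio_test_tendsto_lt_one hx (.of_forall fun n => ?_) ?_
  · simp [gam_ne_zero hq0 hq1, hx0]
  · have h : Tendsto (fun n : ℕ => ‖(1 - q ^ (4 * n + 2)) / (1 - q ^ (4 * n + 4)) * x‖) atTop
        (nhds ‖(1 - 0) / (1 - 0) * x‖) :=
      ((((tendsto_pow_linear hq1 2).const_sub 1).div ((tendsto_pow_linear hq1 4).const_sub 1)
        (by simp)).mul_const x).norm
    simp only [sub_zero, div_one, one_mul] at h
    refine h.congr fun n => ?_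
    have := gam_ne_zero hq0 hq1 n
    rw [norm_norm, norm_norm, ← norm_div, gam_succ]
    congr 1
    field_simp
    ring

theorem summable_norm_gamInv (hq0 : q ≠ 0) (hq1 : ‖q‖ < 1) {x : ℂ} (hx : ‖x‖ < 1) :
    Summable fun n => ‖gamInv q n * x ^ n‖ := by
  refine Summable.of_norm (summable_of_isBigO_nat (summable_norm_gam hq0 hq1 hx) ?_)
  have hq2 : ‖q ^ 2‖ < 1 := by
    rw [norm_pow]; exact pow_lt_one₀ (norm_nonneg _) hq1 two_ne_zero
  -- The ratio of `gamInv q n` to `gam q n` tends to 0, hence is bounded, so the series is dominated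
  -- by that of γ.
  have h1 : Tendsto (fun n : ℕ => q ^ (2 * n) * (1 - q ^ 2) / (q ^ (4 * n) - q ^ 2)) atTop
      (nhds (0 * (1 - q ^ 2) / (0 - q ^ 2))) := by
    refine Tendsto.div (Tendsto.mul_const _ ?_) ((by simpa using tendsto_pow_linear hq1 0 :
      Tendsto (fun n : ℕ => q ^ (4 * n)) atTop (nhds 0)).sub_const _) (by simp [hq0])
    simpa [pow_mul] using tendsto_pow_atTop_nhds_zero_of_norm_lt_one hq2
  have h2 := (h1.isBigO_one ℝ).norm_left.mul
    (Asymptotics.isBigO_refl (fun n => ‖gam q n * x ^ n‖) atTop)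
  refine (h2.congr (fun n => ?_) fun n => one_mul _).norm_left
  rw [← norm_mul, gamInv]
  congr 1
  ring

theorem summable_norm_pow_four (hq1 : ‖q‖ < 1) (x : ℂ) :
    Summable fun j : ℕ => ‖-(x * (q ^ 4) ^ j)‖ := by
  simp only [norm_neg, norm_mul, norm_pow]
  refine (summable_geometric_of_lt_one (by positivity) ?_).mul_left _
  exact pow_lt_one₀ (norm_nonneg _) hq1 (by norm_num)

theorem tendsto_qPoch (hq1 : ‖q‖ < 1) (x : ℂ) :
    Tendsto (fun n => ∏ j ∈ Finset.range n, (1 - x * (q ^ 4) ^ j)) atTop (nhds (qPoch q x)) := by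
  have h := multipliable_one_add_of_summable (summable_norm_pow_four hq1 x)
  simp only [← sub_eq_add_neg] at h
  exact h.hasProd.tendsto_prod_nat

theorem one_sub_mul_pow_ne_zero (hq1 : ‖q‖ < 1) {x : ℂ} (hx : ‖x‖ < 1) (j : ℕ) :
    1 - x * (q ^ 4) ^ j ≠ 0 := by
  intro h
  have h1 : ‖x * (q ^ 4) ^ j‖ = 1 := by rw [← sub_eq_zero.1 h, norm_one]
  rw [norm_mul, norm_pow, norm_pow] at h1
  have h2 : (‖q‖ ^ 4) ^ j ≤ 1 := pow_le_one₀ (by positivity) (pow_le_one₀ (norm_nonneg _) hq1.le)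
  nlinarith [norm_nonneg x]

theorem qPoch_ne_zero (hq1 : ‖q‖ < 1) {x : ℂ} (hx : ‖x‖ < 1) : qPoch q x ≠ 0 := by
  have h := tprod_one_add_ne_zero_of_summable (f := fun j : ℕ => -(x * (q ^ 4) ^ j))
    (fun j => by simpa [← sub_eq_add_neg] using one_sub_mul_pow_ne_zero hq1 hx j)
    (summable_norm_pow_four hq1 x)
  simp only [← sub_eq_add_neg] at h
  exact h

/-- The sum of the series `∑ γ_n xⁿ`. -/
def gamSeries (q x : ℂ) : ℂ := ∑' n, gam q n * x ^ n

theorem hasSum_gamSeries (hq0 : q ≠ 0) (hq1 : ‖q‖ < 1) {x : ℂ} (hx : ‖x‖ < 1) :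
    HasSum (fun n => gam q n * x ^ n) (gamSeries q x) :=
  (summable_norm_gam hq0 hq1 hx).of_norm.hasSum

/-- A Cauchy product of absolutely convergent series. In particular γ has no zero in the unit disc,
which permits the divisions below. -/
theorem gamSeries_mul_gamInv (hq0 : q ≠ 0) (hq1 : ‖q‖ < 1) {x : ℂ} (hx : ‖x‖ < 1) :
    (∑' n, gamInv q n * x ^ n) * gamSeries q x = 1 := by
  rw [gamSeries, tsum_mul_tsum_eq_tsum_sum_antidiagonal_of_summable_norm
    (summable_norm_gamInv hq0 hq1 hx) (summable_norm_gam hq0 hq1 hx)]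
  rw [tsum_eq_single 0]
  · simp [gamInv_zero hq0 hq1, gam_zero]
  · intro n hn
    have h := sum_gamInv_mul_gam hq0 hq1 n
    rw [if_neg hn, ← Finset.Nat.sum_antidiagonal_eq_sum_range_succ
      (f := fun i j => gamInv q j * gam q i), ← Finset.Nat.sum_antidiagonal_swap] at h
    rw [← zero_mul (x ^ n), ← h, Finset.sum_mul]
    refine Finset.sum_congr rfl fun p hp => ?_
    rw [← Finset.HasAntidiagonal.mem_antidiagonal.1 hp, pow_add]
    simp only [Prod.fst_swap, Prod.snd_swap]
    ring

theorem gamSeries_ne_zero (hq0 : q ≠ 0) (hq1 : ‖q‖ < 1) {x : ℂ} (hx : ‖x‖ < 1) :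
    gamSeries q x ≠ 0 :=
  right_ne_zero_of_mul_eq_one (gamSeries_mul_gamInv hq0 hq1 hx)

theorem norm_mul_pow_lt (hq1 : ‖q‖ < 1) {x : ℂ} (hx : ‖x‖ < 1) (n : ℕ) : ‖x * q ^ n‖ < 1 := by
  rw [norm_mul, norm_pow]
  have := pow_le_one₀ (n := n) (norm_nonneg q) hq1.le
  nlinarith [norm_nonneg x]

/-- The recursion γ_{n+1}(1 - q^{4n+4}) = γ_n(1 - q^{4n+2}) says that γ(x) - γ(q⁴x) = xγ(x) -
q²xγ(q⁴x). -/
theorem gamSeries_shift (hq0 : q ≠ 0) (hq1 : ‖q‖ < 1) {x : ℂ} (hx : ‖x‖ < 1) :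
    (1 - x) * gamSeries q x = (1 - q ^ 2 * x) * gamSeries q (x * q ^ 4) := by
  have h1 := hasSum_gamSeries hq0 hq1 hx
  have h2 := hasSum_gamSeries hq0 hq1 (norm_mul_pow_lt hq1 hx 4)
  have h3 := h1.sub h2
  have h4 := (h1.mul_left x).sub (h2.mul_left (q ^ 2 * x))
  rw [← hasSum_nat_add_iff' 1] at h3
  simp only [gam_zero, Finset.range_one, Finset.sum_singleton, pow_zero, sub_self, sub_zero] at h3
  have h5 := h3.unique (h4.congr_fun fun n => ?_) 
  · linear_combination h5
  · have := one_sub_pow_ne_zero hq0 hq1 (a := 4 * n + 4) (by omega)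
    rw [gam_succ]
    field_simp
    ring

theorem continuousAt_gamSeries_zero (hq0 : q ≠ 0) (hq1 : ‖q‖ < 1) :
    ContinuousAt (gamSeries q) 0 := by
  have h : ContinuousOn (gamSeries q) (Metric.closedBall 0 (1 / 2)) := by
    refine continuousOn_tsum (u := fun n => ‖gam q n * (1 / 2) ^ n‖) (fun n => by fun_prop)
      (summable_norm_gam hq0 hq1 (by norm_num)) fun n x hx => ?_
    rw [norm_mul, norm_mul, norm_pow, norm_pow]
    have hx' : ‖x‖ ≤ ‖(1 / 2 : ℂ)‖ := by norm_num; simpa using hx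
    gcongr
  exact h.continuousAt (Metric.closedBall_mem_nhds _ (by norm_num))

/-- The `q`-binomial theorem for the coefficients `γ_n`. -/
theorem gamSeries_eq (hq0 : q ≠ 0) (hq1 : ‖q‖ < 1) {x : ℂ} (hx : ‖x‖ < 1) :
    gamSeries q x = qPoch q (q ^ 2 * x) / qPoch q x := by
  -- Iterate the functional equation n times; then x q^{4n} → 0, and continuity of γ at 0 leaves
  -- only the two infinite products.
  have h1 : ∀ n : ℕ, gamSeries q x * ∏ j ∈ Finset.range n, (1 - x * (q ^ 4) ^ j) =
      (∏ j ∈ Finset.range n, (1 - q ^ 2 * x * (q ^ 4) ^ j)) * gamSeries q (x * q ^ (4 * n)) := by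
    intro n
    induction n with
    | zero => simp
    | succ n ih =>
      have h := gamSeries_shift hq0 hq1 (norm_mul_pow_lt hq1 hx (4 * n))
      rw [Finset.prod_range_succ, Finset.prod_range_succ, ← mul_assoc, ih]
      rw [show x * q ^ (4 * (n + 1)) = x * q ^ (4 * n) * q ^ 4 by ring, ← pow_mul]
      linear_combination (∏ j ∈ Finset.range n, (1 - q ^ 2 * x * (q ^ 4) ^ j)) * h
  have h2 : Tendsto (fun n : ℕ => gamSeries q (x * q ^ (4 * n))) atTop (nhds 1) := by
    have h0 : gamSeries q 0 = 1 := by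
      rw [gamSeries, tsum_eq_single 0 (fun n hn => by simp [hn])]
      simp [gam_zero]
    rw [← h0]
    refine (continuousAt_gamSeries_zero hq0 hq1).tendsto.comp ?_
    simpa using (tendsto_pow_linear hq1 0).const_mul x
  rw [eq_div_iff (qPoch_ne_zero hq1 hx)]
  refine tendsto_nhds_unique ((tendsto_qPoch hq1 x).const_mul _) ?_
  simpa only [h1, mul_one] using (tendsto_qPoch hq1 (q ^ 2 * x)).mul h2

end QSeries

/-! ### Creation and annihilation operators -/

theorem create_single (k : ℕ) (S : Finset ℕ) (c : ℂ) :
    create k (Finsupp.single S c) =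
      if k ∈ S then 0 else Finsupp.single (insert k S) (c * jwSign k S) := by
  simp only [create, Finsupp.linearCombination_single]
  split_ifs <;> simp

theorem annihilate_single (k : ℕ) (S : Finset ℕ) (c : ℂ) :
    annihilate k (Finsupp.single S c) =
      if k ∈ S then Finsupp.single (S.erase k) (c * jwSign k S) else 0 := by
  simp only [annihilate, Finsupp.linearCombination_single]
  split_ifs <;> simp

theorem parity_single (S : Finset ℕ) (c : ℂ) :
    parity (Finsupp.single S c) = Finsupp.single S (c * (-1) ^ S.card) := by
  simp [parity, Finsupp.linearCombination_single]

theorem jwSign_mul_self (k : ℕ) (S : Finset ℕ) : jwSign k S * jwSign k S = 1 := by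
  rw [jwSign, ← mul_pow]
  simp

theorem jwSign_insert_of_lt {k l : ℕ} {S : Finset ℕ} (hl : l ∉ S) (h : l < k) :
    jwSign k (insert l S) = -jwSign k S := by
  rw [jwSign, Finset.filter_insert, if_pos h, Finset.card_insert_of_notMem (by simp [hl]), pow_succ,
    jwSign]
  ring

theorem jwSign_insert_of_le {k l : ℕ} {S : Finset ℕ} (h : k ≤ l) :
    jwSign k (insert l S) = jwSign k S := by
  rw [jwSign, Finset.filter_insert, if_neg (by omega), jwSign]

theorem jwSign_erase_of_lt {k l : ℕ} {S : Finset ℕ} (hl : l ∈ S) (h : l < k) :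
    jwSign k (S.erase l) = -jwSign k S := by
  conv_rhs => rw [← Finset.insert_erase hl, jwSign_insert_of_lt (Finset.notMem_erase l S) h]
  ring

theorem jwSign_erase_of_le {k l : ℕ} {S : Finset ℕ} (h : k ≤ l) :
    jwSign k (S.erase l) = jwSign k S := by
  by_cases hl : l ∈ S
  · conv_rhs => rw [← Finset.insert_erase hl, jwSign_insert_of_le h]
  · rw [Finset.erase_eq_of_notMem hl]

/-- Only the sign belonging to the larger label sees whether the smaller one is occupied, so
exchanging the order costs exactly one sign. -/
theorem create_create (k l : ℕ) (x : Fock) : create k (create l x) = -create l (create k x) := by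
  induction x using Finsupp.induction_linear with
  | zero => simp
  | add x y hx hy => simp only [map_add, hx, hy, neg_add]
  | single S c =>
    wlog h : k ≤ l generalizing k l
    · rw [this l k (by omega), neg_neg]
    rcases h.eq_or_lt with rfl | h
    · by_cases hk : k ∈ S <;> simp [-Finsupp.single_mul, create_single, hk]
    by_cases hk : k ∈ S <;> by_cases hl : l ∈ S <;>
      simp [-Finsupp.single_mul, create_single, hk, hl, h.ne, h.ne']
    rw [jwSign_insert_of_le h.le, jwSign_insert_of_lt hk h, Finset.insert_comm, ← Finsupp.single_neg]
    congr 1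
    ring

theorem annihilate_annihilate (k l : ℕ) (x : Fock) :
    annihilate k (annihilate l x) = -annihilate l (annihilate k x) := by
  induction x using Finsupp.induction_linear with
  | zero => simp
  | add x y hx hy => simp only [map_add, hx, hy, neg_add]
  | single S c =>
    wlog h : k ≤ l generalizing k l
    · rw [this l k (by omega), neg_neg]
    rcases h.eq_or_lt with rfl | h
    · by_cases hk : k ∈ S <;> simp [-Finsupp.single_mul, annihilate_single, hk]
    by_cases hk : k ∈ S <;> by_cases hl : l ∈ S <;>
      simp [-Finsupp.single_mul, annihilate_single, hk, hl, h.ne, h.ne']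
    rw [jwSign_erase_of_le h.le, jwSign_erase_of_lt hk h, Finset.erase_right_comm,
      ← Finsupp.single_neg]
    congr 1
    ring

theorem annihilate_create (k l : ℕ) (x : Fock) :
    annihilate k (create l x) = (if k = l then x else 0) - create l (annihilate k x) := by
  induction x using Finsupp.induction_linear with
  | zero => simp
  | add x y hx hy => simp only [map_add, hx, hy]; split_ifs <;> abel
  | single S c =>
    rcases eq_or_ne k l with rfl | h
    · by_cases hk : k ∈ S
      · simp [-Finsupp.single_mul, create_single, annihilate_single, hk, mul_assoc, jwSign_erase_of_le,
          jwSign_mul_self]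
      · simp [-Finsupp.single_mul, create_single, annihilate_single, hk, mul_assoc, jwSign_insert_of_le,
          jwSign_mul_self]
    · by_cases hk : k ∈ S <;> by_cases hl : l ∈ S <;>
        simp [-Finsupp.single_mul, create_single, annihilate_single, hk, hl, h, h.symm]
      rw [← Finset.erase_insert_of_ne h.symm, ← Finsupp.single_neg]
      congr 1
      rcases h.lt_or_gt with h | h
      · rw [jwSign_insert_of_le h.le, jwSign_erase_of_lt hk h]; ring
      · rw [jwSign_insert_of_lt hl h, jwSign_erase_of_le h.le]; ring

theorem parity_create (k : ℕ) (x : Fock) : parity (create k x) = -create k (parity x) := by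
  induction x using Finsupp.induction_linear with
  | zero => simp
  | add x y hx hy => simp only [map_add, hx, hy, neg_add]
  | single S c =>
    by_cases hk : k ∈ S
    · simp [-Finsupp.single_mul, create_single, parity_single, hk]
    · simp only [create_single, parity_single, hk, if_false, ← Finsupp.single_neg,
        Finset.card_insert_of_notMem hk]
      congr 1
      ring

theorem parity_annihilate (k : ℕ) (x : Fock) :
    parity (annihilate k x) = -annihilate k (parity x) := by
  induction x using Finsupp.induction_linear with
  | zero => simp
  | add x y hx hy => simp only [map_add, hx, hy, neg_add]
  | single S c =>
    by_cases hk : k ∈ S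
    · simp only [annihilate_single, parity_single, hk, if_true, ← Finsupp.single_neg]
      congr 1
      conv_rhs => rw [← Finset.card_erase_add_one hk]
      ring
    · simp [-Finsupp.single_mul, annihilate_single, parity_single, hk]

theorem parity_parity (x : Fock) : parity (parity x) = x := by
  induction x using Finsupp.induction_linear with
  | zero => simp
  | add x y hx hy => simp only [map_add, hx, hy]
  | single S c => simp [-Finsupp.single_mul, parity_single, mul_assoc, ← mul_pow]

theorem annihilate_vac (k : ℕ) : annihilate k vac = 0 := by simp [vac, annihilate_single]

theorem parity_vac : parity vac = vac := by simp [vac, parity_single]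

theorem create_annihilate_single {k : ℕ} {S : Finset ℕ} (hk : k ∈ S) (c : ℂ) :
    create k (annihilate k (Finsupp.single S c)) = Finsupp.single S c := by
  simp [-Finsupp.single_mul, annihilate_single, create_single, hk, mul_assoc, jwSign_erase_of_le, jwSign_mul_self]

theorem eventually_annihilate_eq_zero (x : Fock) :
    ∃ M, ∀ k ≥ M, annihilate k x = 0 := by
  induction x using Finsupp.induction_linear with
  | zero => simp
  | add x y hx hy =>
    obtain ⟨M, hM⟩ := hx
    obtain ⟨M', hM'⟩ := hy
    exact ⟨max M M', fun k hk => by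
      simp [hM k (le_trans (le_max_left _ _) hk), hM' k (le_trans (le_max_right _ _) hk)]⟩
  | single S c =>
    refine ⟨S.sup id + 1, fun k hk => ?_⟩
    rw [annihilate_single, if_neg]
    intro h
    have := Finset.le_sup (f := id) h
    simp only [id] at this
    omega

/-! ### The pairing -/

theorem pairing_single (c : ℕ → ℂ) (S T : Finset ℕ) (a b : ℂ) :
    pairing c (Finsupp.single S a) (Finsupp.single T b) =
      if S = T then a * b * ∏ k ∈ S, c k else 0 := by
  simp only [pairing, Finsupp.linearCombination_single, LinearMap.smul_apply, Finsupp.lapply_apply,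
    Finsupp.single_apply, smul_eq_mul, eq_comm (a := T)]
  split_ifs <;> ring

theorem pairing_comm (c : ℕ → ℂ) (x y : Fock) : pairing c x y = pairing c y x := by
  induction x using Finsupp.induction_linear with
  | zero => simp
  | add x x' hx hx' => simp only [map_add, hx, hx', LinearMap.add_apply]
  | single S a =>
    induction y using Finsupp.induction_linear with
    | zero => simp
    | add y y' hy hy' => simp only [map_add, hy, hy', LinearMap.add_apply]
    | single T b =>
      rw [pairing_single, pairing_single]
      rcases eq_or_ne S T with rfl | h
      · simp [mul_comm]
      · simp [h, h.symm]

theorem pairing_create (c : ℕ → ℂ) (k : ℕ) (x y : Fock) :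
    pairing c (create k x) y = c k * pairing c x (annihilate k y) := by
  induction x using Finsupp.induction_linear with
  | zero => simp
  | add x x' hx hx' => simp only [map_add, hx, hx', LinearMap.add_apply, mul_add]
  | single S a =>
    induction y using Finsupp.induction_linear with
    | zero => simp
    | add y y' hy hy' => simp only [map_add, hy, hy', mul_add]
    | single T b =>
      rw [create_single, annihilate_single]
      by_cases hS : k ∈ S
      · by_cases hT : k ∈ T
        · simp only [hS, hT, if_true, map_zero, LinearMap.zero_apply, pairing_single]
          rw [if_neg (by rintro rfl; simp at hS), mul_zero]
        · simp [hS, hT]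
      · by_cases hT : k ∈ T
        · simp only [hS, hT, if_true, if_false, pairing_single]
          by_cases h : insert k S = T
          · subst h
            rw [if_pos rfl, if_pos (Finset.erase_insert hS).symm, Finset.prod_insert hS,
              jwSign_insert_of_le le_rfl]
            ring
          · rw [if_neg h, if_neg, mul_zero]
            rintro rfl
            exact h (Finset.insert_erase hT)
        · simp only [hS, hT, if_false, pairing_single, map_zero, mul_zero]
          rw [if_neg]
          rintro rfl
          simp at hT

theorem pairing_annihilate (c : ℕ → ℂ) (k : ℕ) (x y : Fock) :
    c k * pairing c (annihilate k x) y = pairing c x (create k y) := by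
  rw [pairing_comm, ← pairing_create, pairing_comm]

theorem pairing_parity (c : ℕ → ℂ) (x y : Fock) :
    pairing c (parity x) y = pairing c x (parity y) := by
  induction x using Finsupp.induction_linear with
  | zero => simp
  | add x x' hx hx' => simp only [map_add, hx, hx', LinearMap.add_apply]
  | single S a =>
    induction y using Finsupp.induction_linear with
    | zero => simp
    | add y y' hy hy' => simp only [map_add, hy, hy']
    | single T b =>
      rw [parity_single, parity_single, pairing_single, pairing_single]
      split_ifs with h
      · subst h; ring
      · rfl

theorem pairing_vac_create (c : ℕ → ℂ) (k : ℕ) (x : Fock) : pairing c vac (create k x) = 0 := by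
  rw [← pairing_annihilate, annihilate_vac]
  simp

theorem pairing_vac_vac (c : ℕ → ℂ) : pairing c vac vac = 1 := by
  simp [vac, pairing_single]

/-! ### Operators on the two sectors together -/

/-- The creation operator for Neveu-Schwarz modes. -/
def createNS (k : ℕ) : Module.End ℂ FockRNS := TensorProduct.map LinearMap.id (create k)

/-- The annihilation operator for Neveu-Schwarz modes. -/
def annihilateNS (k : ℕ) : Module.End ℂ FockRNS := TensorProduct.map LinearMap.id (annihilate k)

/-- The creation operator for Ramond modes. -/
def createR (k : ℕ) : Module.End ℂ FockRNS := TensorProduct.map (create k) parity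

/-- The annihilation operator for Ramond modes. -/
def annihilateR (k : ℕ) : Module.End ℂ FockRNS := TensorProduct.map (annihilate k) parity

/-- The total fermion parity. -/
def parityRNS : Module.End ℂ FockRNS := TensorProduct.map parity parity

@[simp] theorem createNS_tmul (k : ℕ) (r v : Fock) : createNS k (r ⊗ₜ v) = r ⊗ₜ create k v := rfl

@[simp] theorem annihilateNS_tmul (k : ℕ) (r v : Fock) :
    annihilateNS k (r ⊗ₜ v) = r ⊗ₜ annihilate k v := rfl

@[simp] theorem createR_tmul (k : ℕ) (r v : Fock) :
    createR k (r ⊗ₜ v) = create k r ⊗ₜ parity v := rfl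

@[simp] theorem annihilateR_tmul (k : ℕ) (r v : Fock) :
    annihilateR k (r ⊗ₜ v) = annihilate k r ⊗ₜ parity v := rfl

@[simp] theorem parityRNS_tmul (r v : Fock) : parityRNS (r ⊗ₜ v) = parity r ⊗ₜ parity v := rfl

/-- The operators that occur in `Y'`: creation in the Neveu-Schwarz sector, annihilation in the
Ramond sector. -/
def grass : ℕ ⊕ ℕ → Module.End ℂ FockRNS := Sum.elim createNS annihilateR

/-- The operators conjugate to `grass`. -/
def grassDual : ℕ ⊕ ℕ → Module.End ℂ FockRNS := Sum.elim annihilateNS createR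

/-- Within one sector this is the fermionic relation; across sectors the sign comes from the
Neveu-Schwarz parity attached to the Ramond modes. -/
theorem grass_mul_grass (i j : ℕ ⊕ ℕ) : grass i * grass j = -(grass j * grass i) := by
  refine TensorProduct.ext' fun r v => ?_
  rcases i with i | i <;> rcases j with j | j <;>
    simp only [grass, Sum.elim_inl, Sum.elim_inr, Module.End.mul_apply, LinearMap.neg_apply,
      createNS_tmul, annihilateR_tmul]
  · rw [create_create, TensorProduct.tmul_neg]
  · rw [parity_create, TensorProduct.tmul_neg, neg_neg]
  · rw [parity_create, TensorProduct.tmul_neg]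
  · rw [annihilate_annihilate, TensorProduct.neg_tmul]

theorem parityRNS_mul_grass (i : ℕ ⊕ ℕ) : parityRNS * grass i = -(grass i * parityRNS) := by
  refine TensorProduct.ext' fun r v => ?_
  rcases i with i | i <;>
    simp only [grass, Sum.elim_inl, Sum.elim_inr, Module.End.mul_apply, LinearMap.neg_apply,
      createNS_tmul, annihilateR_tmul, parityRNS_tmul]
  · rw [parity_create, TensorProduct.tmul_neg]
  · rw [parity_annihilate, TensorProduct.neg_tmul]

theorem parityRNS_mul_grassDual (i : ℕ ⊕ ℕ) :
    parityRNS * grassDual i = -(grassDual i * parityRNS) := by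
  refine TensorProduct.ext' fun r v => ?_
  rcases i with i | i <;>
    simp only [grassDual, Sum.elim_inl, Sum.elim_inr, Module.End.mul_apply, LinearMap.neg_apply,
      annihilateNS_tmul, createR_tmul, parityRNS_tmul]
  · rw [parity_annihilate, TensorProduct.tmul_neg]
  · rw [parity_create, TensorProduct.neg_tmul]

theorem parityRNS_mul_self : parityRNS * parityRNS = 1 := by
  refine TensorProduct.ext' fun r v => ?_
  simp [parity_parity]

theorem grassDual_mul_grass (i j : ℕ ⊕ ℕ) :
    grassDual i * grass j = (if i = j then 1 else 0) - grass j * grassDual i := by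
  refine TensorProduct.ext' fun r v => ?_
  rcases i with i | i <;> rcases j with j | j <;>
    simp only [grass, grassDual, Sum.elim_inl, Sum.elim_inr, Module.End.mul_apply,
      LinearMap.sub_apply, createNS_tmul, annihilateR_tmul, createR_tmul, annihilateNS_tmul,
      Sum.inl.injEq, Sum.inr.injEq, reduceCtorEq, if_false, LinearMap.zero_apply]
  · rw [annihilate_create, TensorProduct.tmul_sub]
    split_ifs <;> simp
  · rw [parity_annihilate, TensorProduct.tmul_neg]
    simp
  · rw [parity_create, TensorProduct.tmul_neg]
    simp
  · rw [annihilate_create, TensorProduct.sub_tmul]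
    rcases eq_or_ne i j with rfl | h
    · simp [parity_parity]
    · simp [h, h.symm]

theorem braRNS_tmul (q : ℂ) (r r' : FockR) (v v' : FockNS) :
    braRNS q r v (r' ⊗ₜ v') = pairR q r r' * pairNS q v v' := rfl

theorem braRNS_create_right (q : ℂ) (k : ℕ) (r : FockR) (v : FockNS) (x : FockRNS) :
    braRNS q r (create k v) x = eta q (2 * k + 1) * braRNS q r v (annihilateNS k x) := by
  induction x using TensorProduct.induction_on with
  | zero => simp
  | add x y hx hy => simp only [map_add, hx, hy, mul_add]
  | tmul r' v' =>
    rw [annihilateNS_tmul, braRNS_tmul, braRNS_tmul, pairNS, pairing_create]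
    ring

theorem braRNS_createNS (q : ℂ) (k : ℕ) (r : FockR) (v : FockNS) (x : FockRNS) :
    braRNS q r v (createNS k x) = eta q (2 * k + 1) * braRNS q r (annihilate k v) x := by
  induction x using TensorProduct.induction_on with
  | zero => simp
  | add x y hx hy => simp only [map_add, hx, hy, mul_add]
  | tmul r' v' =>
    rw [createNS_tmul, braRNS_tmul, braRNS_tmul, pairNS, ← pairing_annihilate]
    ring

theorem braRNS_vac_createR (q : ℂ) (k : ℕ) (v : FockNS) (x : FockRNS) :
    braRNS q vac v (createR k x) = 0 := by
  induction x using TensorProduct.induction_on with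
  | zero => simp
  | add x y hx hy => simp only [map_add, hx, hy, add_zero]
  | tmul r' v' => rw [createR_tmul, braRNS_tmul, pairR, pairing_vac_create, zero_mul]

/-! ### The exponential of a quadratic expression -/

section NilpotentExp

variable {A : Type*} [Ring A] [Module ℚ A]

omit [Module ℚ A] in
theorem mul_pow_of_commutator {a b c : A} (h : a * b = b * a + c) (hc : Commute b c) (n : ℕ) :
    a * b ^ (n + 1) = b ^ (n + 1) * a + (n + 1) • (b ^ n * c) := by
  induction n with
  | zero => simp [h]
  | succ n ih =>
    have h1 : b ^ n * c * b = b ^ (n + 1) * c := by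
      rw [mul_assoc, ← hc.eq, ← mul_assoc, pow_succ]
    rw [pow_succ b (n + 1), ← mul_assoc, ih, add_mul, mul_assoc, h, smul_mul_assoc, h1, mul_add,
      ← mul_assoc, add_assoc, ← succ_nsmul']

/-- Commuting with a acts on powers of b as a derivation with b ↦ c, and c commutes with b, so it
sends e^b to e^b c. -/
theorem mul_exp_of_commutator {a b c : A} (h : a * b = b * a + c) (hc : Commute b c)
    (hb : IsNilpotent b) : a * IsNilpotent.exp b = IsNilpotent.exp b * (a + c) := by
  obtain ⟨K, hK⟩ := hb
  -- Differentiation lowers the degree by one: the truncation with K + 1 terms is differentiated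
  -- into the one with K terms, and b^K = 0 lets both represent e^b.
  have hK' : b ^ (K + 1) = 0 := by rw [pow_succ, hK, zero_mul]
  have hexp : IsNilpotent.exp b * c = ∑ i ∈ Finset.range K, (i.factorial : ℚ)⁻¹ • b ^ i * c := by
    rw [IsNilpotent.exp_eq_sum hK, Finset.sum_mul]
  rw [mul_add, hexp, IsNilpotent.exp_eq_sum hK', Finset.mul_sum, Finset.sum_mul,
    Finset.sum_range_succ', Finset.sum_range_succ' (fun i => ((i.factorial : ℚ)⁻¹ • b ^ i * a)),
    add_right_comm, ← Finset.sum_add_distrib]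
  congr 1
  · refine Finset.sum_congr rfl fun i _ => ?_
    rw [mul_smul_comm, mul_pow_of_commutator h hc, smul_add, smul_mul_assoc, smul_mul_assoc,
      ← Nat.cast_smul_eq_nsmul ℚ, smul_smul, Nat.factorial_succ]
    congr 2
    push_cast
    field_simp
  · simp

theorem commute_exp {a b : A} (h : Commute a b) (ha : IsNilpotent a) :
    Commute (IsNilpotent.exp a) b := by
  have := mul_exp_of_commutator (a := b) (b := a) (c := 0) (by rw [add_zero, h.eq])
    (Commute.zero_right a) ha
  rw [add_zero] at this
  exact this.symm

end NilpotentExp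

/-- Pairwise anticommuting elements `g i`, their conjugates `g' i`, and an involution `p`
anticommuting with them. -/
structure GrassmannSystem {ι R : Type*} [DecidableEq ι] [Ring R] (g g' : ι → R) (p : R) :
    Prop where
  anticomm : ∀ i j, g i * g j = -(g j * g i)
  dual_mul : ∀ i j, g' i * g j = (if i = j then 1 else 0) - g j * g' i
  parity_mul : ∀ i, p * g i = -(g i * p)
  parity_mul_dual : ∀ i, p * g' i = -(g' i * p)
  parity_sq : p * p = 1

section Grassmann

variable {ι R : Type*} [Ring R] [Algebra ℂ R]

/-- The linear combination of the elements `g i`, `i ∈ I`, with coefficients `d i`. -/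
def linForm (g : ι → R) (d : ι → ℂ) (I : Finset ι) : R := ∑ i ∈ I, d i • g i

/-- Half the quadratic form in the elements `g i`, `i ∈ I`, with coefficients `K i j`. -/
def quadForm (g : ι → R) (K : ι → ι → ℂ) (I : Finset ι) : R :=
  ∑ i ∈ I, ∑ j ∈ I, (1 / 2 * K i j) • (g i * g j)

/-- A quadratic form in the elements `g i` and `p`. -/
def mixedForm (g : ι → R) (p : R) (K : ι → ι → ℂ) (d : ι → ℂ) (I : Finset ι) : R :=
  quadForm g K I + linForm g d I * p

namespace GrassmannSystem

variable [DecidableEq ι] {g g' : ι → R} {p : R} (h : GrassmannSystem g g' p)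
  (K : ι → ι → ℂ) (d e : ι → ℂ) (I : Finset ι)
include h

omit h in
theorem eq_zero_of_eq_neg {x : R} (hx : x = -x) : x = 0 := by
  have h2 : (2 : ℂ) • x = 0 := by
    rw [two_smul]
    nth_rewrite 1 [hx]
    exact neg_add_cancel x
  exact (smul_eq_zero.1 h2).resolve_left two_ne_zero

theorem mul_self (i : ι) : g i * g i = 0 := eq_zero_of_eq_neg (h.anticomm i i)

omit [Algebra ℂ R] in
theorem commute_mul (i j k : ι) : Commute (g i * g j) (g k) := by
  rw [commute_iff_eq, mul_assoc, h.anticomm j k, mul_neg, ← mul_assoc, h.anticomm i k,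
    neg_mul, neg_neg, mul_assoc]

omit [Algebra ℂ R] in
theorem commute_mul_parity (i j : ι) : Commute (g i * g j) p := by
  rw [commute_iff_eq, ← mul_assoc, h.parity_mul, neg_mul, mul_assoc, mul_assoc,
    h.parity_mul, mul_neg, neg_neg]

theorem mul_linForm (i : ι) : g i * linForm g d I = -(linForm g d I * g i) := by
  simp only [linForm, Finset.mul_sum, Finset.sum_mul, ← Finset.sum_neg_distrib, mul_smul_comm,
    smul_mul_assoc, ← smul_neg]
  exact Finset.sum_congr rfl fun j _ => by rw [h.anticomm]

theorem linForm_mul_linForm :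
    linForm g e I * linForm g d I = -(linForm g d I * linForm g e I) := by
  conv_lhs => rw [linForm, Finset.sum_mul]
  conv_rhs => enter [1, 2]; rw [linForm]
  rw [Finset.mul_sum, ← Finset.sum_neg_distrib]
  refine Finset.sum_congr rfl fun j _ => ?_
  rw [smul_mul_assoc, h.mul_linForm, mul_smul_comm, smul_neg]

theorem parity_mul_linForm : p * linForm g d I = -(linForm g d I * p) := by
  simp only [linForm, Finset.mul_sum, Finset.sum_mul, ← Finset.sum_neg_distrib, mul_smul_comm,
    smul_mul_assoc, ← smul_neg]
  exact Finset.sum_congr rfl fun j _ => by rw [h.parity_mul]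

theorem linForm_mul_self : linForm g d I * linForm g d I = 0 :=
  eq_zero_of_eq_neg (h.linForm_mul_linForm d d I)

theorem sq_linForm_mul_parity : (linForm g d I * p) ^ 2 = 0 := by
  rw [sq, mul_assoc, ← mul_assoc p, h.parity_mul_linForm, neg_mul, mul_neg, ← mul_assoc,
    ← mul_assoc, h.linForm_mul_self]
  simp

theorem commute_quadForm (k : ι) : Commute (quadForm g K I) (g k) :=
  Commute.sum_left _ _ _ fun _ _ => Commute.sum_left _ _ _ fun _ _ =>
    (h.commute_mul _ _ _).smul_left _

theorem commute_quadForm_parity : Commute (quadForm g K I) p :=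
  Commute.sum_left _ _ _ fun _ _ => Commute.sum_left _ _ _ fun _ _ =>
    (h.commute_mul_parity _ _).smul_left _

theorem commute_quadForm_linForm : Commute (quadForm g K I) (linForm g d I) :=
  Commute.sum_right _ _ _ fun _ _ => (h.commute_quadForm _ _ _).smul_right _

theorem isNilpotent_quadForm : IsNilpotent (quadForm g K I) := by
  rw [quadForm, ← Finset.sum_product']
  refine Commute.isNilpotent_sum (fun p _ => ⟨2, ?_⟩) fun p p' _ _ => ?_
  · rw [sq, smul_mul_smul_comm, mul_assoc (g p.1), ← mul_assoc (g p.2), h.anticomm p.2 p.1, neg_mul,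
      mul_assoc (g p.1), h.mul_self]
    simp
  · exact (((h.commute_mul _ _ _).mul_right (h.commute_mul _ _ _)).smul_left _).smul_right _

theorem isNilpotent_linForm_mul_parity : IsNilpotent (linForm g d I * p) :=
  ⟨2, h.sq_linForm_mul_parity d I⟩

theorem commute_quadForm_linForm_mul_parity : Commute (quadForm g K I) (linForm g d I * p) :=
  (h.commute_quadForm_linForm K d I).mul_right (h.commute_quadForm_parity K I)

theorem isNilpotent_mixedForm : IsNilpotent (mixedForm g p K d I) :=
  (h.commute_quadForm_linForm_mul_parity K d I).isNilpotent_add (h.isNilpotent_quadForm K I)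
    (h.isNilpotent_linForm_mul_parity d I)

/-- The quadratic part commutes with Lp, where L is the linear form. Since p anticommutes with L and
L² = 0, (Lp)² = 0 and its exponential has just two terms. -/
theorem exp_mixedForm [Module ℚ R] : IsNilpotent.exp (mixedForm g p K d I) =
    IsNilpotent.exp (quadForm g K I) * (1 + linForm g d I * p) := by
  rw [mixedForm, IsNilpotent.exp_add_of_commute (h.commute_quadForm_linForm_mul_parity K d I)
    (h.isNilpotent_quadForm K I) (h.isNilpotent_linForm_mul_parity d I),
    IsNilpotent.exp_eq_sum (h.sq_linForm_mul_parity d I)]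
  simp [Finset.sum_range_succ]

theorem commute_mixedForm (k : ι) : Commute (mixedForm g p K d I) (g k) := by
  refine (h.commute_quadForm K I k).add_left ?_
  rw [commute_iff_eq, mul_assoc, h.parity_mul, mul_neg, ← mul_assoc, ← mul_assoc,
    h.mul_linForm, neg_mul]

variable {I} {i : ι}

theorem dual_mul_linForm (hi : i ∈ I) :
    g' i * linForm g d I = d i • (1 : R) - linForm g d I * g' i := by
  simp only [linForm, Finset.mul_sum, Finset.sum_mul, mul_smul_comm, smul_mul_assoc,
    h.dual_mul, smul_sub, Finset.sum_sub_distrib, smul_ite, smul_zero,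
    Finset.sum_ite_eq, if_pos hi]

/-- The element `g' i` acts as an odd derivative. Antisymmetry of K makes the contributions of the
first and second factor equal, which absorbs the 1/2 in `quadForm`. -/
theorem dual_mul_quadForm (hK : ∀ i j, K i j = -K j i) (hi : i ∈ I) :
    g' i * quadForm g K I = quadForm g K I * g' i + linForm g (K i) I := by
  have h0 : ∀ a b, g' i * (g a * g b) = g a * g b * g' i +
      ((if i = a then g b else 0) - (if i = b then g a else 0)) := by
    intro a b
    rw [← mul_assoc, h.dual_mul, sub_mul, mul_assoc, h.dual_mul, mul_sub, ← mul_assoc, ite_mul,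
      mul_ite]
    simp only [one_mul, zero_mul, mul_one, mul_zero]
    abel
  have h1 : ∑ a ∈ I, ∑ b ∈ I, (if i = a then (1 / 2 * K a b) • g b else 0) =
      ∑ b ∈ I, (1 / 2 * K i b) • g b := by
    rw [Finset.sum_comm]
    simp [hi]
  simp only [quadForm, linForm, Finset.mul_sum, Finset.sum_mul, mul_smul_comm, smul_mul_assoc, h0,
    smul_sub, smul_add, Finset.sum_add_distrib, Finset.sum_sub_distrib, smul_ite, smul_zero]
  rw [h1]
  congr 1
  simp only [Finset.sum_ite_eq, if_pos hi]
  rw [← Finset.sum_sub_distrib]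
  refine Finset.sum_congr rfl fun a _ => ?_
  rw [hK a i, ← sub_smul]
  congr 1
  ring

/-- Bogoliubov transformation. The kernel is corrected by -d_i d_j because p squares to 1: moving
d_i p to the right of 1 + Lp produces the extra term d_i Lpp = d_i L, which has to be subtracted. -/
theorem dual_mul_exp [Module ℚ R] (hK : ∀ i j, K i j = -K j i) (hi : i ∈ I) :
    g' i * IsNilpotent.exp (mixedForm g p K d I) =
      IsNilpotent.exp (mixedForm g p K d I) *
        (g' i + linForm g (fun j => K i j - d i * d j) I + d i • p) := by
  have h1 : linForm g (fun j => K i j - d i * d j) I =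
      linForm g (K i) I - d i • linForm g d I := by
    simp only [linForm, Finset.smul_sum, smul_smul, sub_smul, Finset.sum_sub_distrib]
  have h2 := h.dual_mul_linForm d hi
  have h3 := h.linForm_mul_linForm d (K i) I
  have h4 := h.parity_mul_linForm d I
  have h5 := h.parity_mul_linForm (K i) I
  have h6 := h.parity_mul_dual i
  have h7 := h.linForm_mul_self d I
  have h8 := h.parity_sq
  rw [h1, h.exp_mixedForm, ← mul_assoc, mul_exp_of_commutator (h.dual_mul_quadForm K hK hi)
    (h.commute_quadForm_linForm K (K i) I) (h.isNilpotent_quadForm K I), mul_assoc, mul_assoc]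
  congr 1
  generalize linForm g d I = L at *
  generalize linForm g (K i) I = l at *
  generalize g' i = a at *
  have e1 : a * (L * p) = d i • p + L * p * a := by
    rw [← mul_assoc, h2, sub_mul, smul_mul_assoc, one_mul, mul_assoc, mul_assoc, h6,
      mul_neg, sub_eq_add_neg]
  have e2 : l * (L * p) = L * p * l := by
    rw [← mul_assoc, h3, neg_mul, mul_assoc, mul_assoc, h5, mul_neg]
  have e3 : L * p * L = 0 := by
    rw [mul_assoc, h4, mul_neg, ← mul_assoc, h7, zero_mul, neg_zero]
  have e4 : L * p * p = L := by rw [mul_assoc, h8, mul_one]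
  simp only [mul_add, add_mul, mul_one, one_mul, mul_sub, mul_smul_comm, smul_add, e1, e2, e3, e4, smul_zero]
  abel

end GrassmannSystem

end Grassmann

theorem grassmannSystem : GrassmannSystem grass grassDual parityRNS where
  anticomm := grass_mul_grass
  dual_mul := grassDual_mul_grass
  parity_mul := parityRNS_mul_grass
  parity_mul_dual := parityRNS_mul_grassDual
  parity_sq := parityRNS_mul_self

/-- The quadratic form in the operators `grass i` and `parityRNS`. -/
def grassExponent (K : ℕ ⊕ ℕ → ℕ ⊕ ℕ → ℂ) (d : ℕ ⊕ ℕ → ℂ) (I : Finset (ℕ ⊕ ℕ)) :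
    Module.End ℂ FockRNS :=
  mixedForm grass parityRNS K d I

theorem isNilpotent_grassExponent (K : ℕ ⊕ ℕ → ℕ ⊕ ℕ → ℂ) (d : ℕ ⊕ ℕ → ℂ)
    (I : Finset (ℕ ⊕ ℕ)) : IsNilpotent (grassExponent K d I) :=
  grassmannSystem.isNilpotent_mixedForm K d I

theorem commute_grassExponent_grass (K : ℕ ⊕ ℕ → ℕ ⊕ ℕ → ℂ) (d : ℕ ⊕ ℕ → ℂ)
    (I : Finset (ℕ ⊕ ℕ)) (k : ℕ ⊕ ℕ) : Commute (grassExponent K d I) (grass k) :=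
  grassmannSystem.commute_mixedForm K d I k

section VacuumExpectation

variable (K : ℕ ⊕ ℕ → ℕ ⊕ ℕ → ℂ) (d : ℕ ⊕ ℕ → ℂ) (I : Finset (ℕ ⊕ ℕ)) (q : ℂ)

/-- A Neveu-Schwarz creation operator commutes past the exponent and is killed by the bra; a Ramond
annihilation operator kills the ket. -/
theorem bra_vac_pow_grass (n : ℕ) (i : ℕ ⊕ ℕ) (x : FockRNS)
    (hx : ∀ m, annihilateR m x = 0) :
    braRNS q vac vac ((grassExponent K d I ^ n) (grass i x)) = 0 := by
  rcases i with i | i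
  · rw [← Module.End.mul_apply, ((commute_grassExponent_grass K d I _).pow_left n).eq,
      Module.End.mul_apply, grass, Sum.elim_inl, braRNS_createNS, annihilate_vac]
    simp [braRNS, pairNS, pairR]
  · simp [grass, hx]

theorem bra_vac_pow_grass_grass (n : ℕ) (i j : ℕ ⊕ ℕ) (x : FockRNS)
    (hx : ∀ m, annihilateR m x = 0) :
    braRNS q vac vac ((grassExponent K d I ^ n) ((grass i * grass j) x)) = 0 := by
  -- A vector obtained by Neveu-Schwarz creation is still annihilated by all Ramond annihilators, so
  -- the previous lemma applies to it.
  rcases j with j | j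
  · refine bra_vac_pow_grass K d I q n i _ fun m => ?_
    have h := congrArg (· x) (grass_mul_grass (Sum.inr m) (Sum.inl j))
    simp only [Module.End.mul_apply, LinearMap.neg_apply] at h
    change grass (Sum.inr m) (grass (Sum.inl j) x) = 0
    rw [h, show grass (Sum.inr m) x = 0 from hx m]
    simp
  · simp [grass, hx]

/-- Every term of positive degree in the exponential ends with one or two operators `grass` on the
double vacuum, the parity acting there as 1; such terms vanish. -/
theorem bra_vac_exp_vac :
    braRNS q vac vac (IsNilpotent.exp (grassExponent K d I) (vac ⊗ₜ vac)) = 1 := by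
  obtain ⟨k, hk⟩ := isNilpotent_grassExponent K d I
  have hk' : grassExponent K d I ^ (k + 1) = 0 := by rw [pow_succ, hk, zero_mul]
  have hx : ∀ m, annihilateR m (vac ⊗ₜ vac) = 0 := fun m => by simp [annihilate_vac]
  rw [IsNilpotent.exp_eq_sum hk', LinearMap.sum_apply, map_sum, Finset.sum_range_succ',
    Finset.sum_eq_zero]
  · simp [braRNS_tmul, pairNS, pairR, pairing_vac_vac]
  · intro n _
    rw [LinearMap.smul_apply, map_rat_smul, pow_succ, Module.End.mul_apply]
    conv_lhs => enter [2, 2, 2]; rw [grassExponent]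
    simp only [mixedForm, quadForm, linForm, LinearMap.add_apply, Module.End.mul_apply, parityRNS_tmul,
      parity_vac, LinearMap.sum_apply, LinearMap.smul_apply, map_add, map_sum, map_smul,
      bra_vac_pow_grass K d I q n _ _ hx]
    simp only [← Module.End.mul_apply (grass _) (grass _),
      bra_vac_pow_grass_grass K d I q n _ _ _ hx]
    simp

end VacuumExpectation

/-! ### The cut-off exponent `Y'` -/

theorem sum_lower_triangle {R : Type*} [AddCommGroup R] [Module ℂ R] (f : ℕ → ℕ → R)
    (hf : ∀ k l, f k l = f l k) (hd : ∀ k, f k k = 0) (N : ℕ) :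
    ∑ k ∈ Finset.range N, ∑ l ∈ Finset.range N, (1 / 2 : ℂ) • f k l =
      ∑ k ∈ Finset.range N, ∑ l ∈ Finset.range k, f k l := by
  induction N with
  | zero => simp
  | succ N ih =>
    simp only [Finset.sum_range_succ, Finset.sum_add_distrib, ih, hd, smul_zero, add_zero]
    rw [add_assoc, ← Finset.sum_add_distrib]
    congr 1
    refine Finset.sum_congr rfl fun l _ => ?_
    rw [hf l N, ← add_smul]
    norm_num

/-- The kernel of the quadratic form in the elements `a k` and `b (m + 1)`. -/
def pairKernel (c₁ c₂ c₃ : ℕ → ℕ → ℂ) : ℕ ⊕ ℕ → ℕ ⊕ ℕ → ℂ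
  | Sum.inl k, Sum.inl l => c₁ k l
  | Sum.inr m, Sum.inr n => c₂ (m + 1) (n + 1)
  | Sum.inl k, Sum.inr m => -c₃ k (m + 1)
  | Sum.inr m, Sum.inl k => c₃ k (m + 1)

/-- The coefficients of the products of `a k` and `b (m + 1)` with `b 0`. -/
def pairLin (c₂ c₃ : ℕ → ℕ → ℂ) : ℕ ⊕ ℕ → ℂ
  | Sum.inl k => -c₃ k 0
  | Sum.inr m => c₂ (m + 1) 0

/-- The labels of the modes that occur at the cut-off `N`. -/
def cutoffSet (N : ℕ) : Finset (ℕ ⊕ ℕ) := (Finset.range (N + 1)).disjSum (Finset.range N)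

theorem pairKernel_antisymm {c₁ c₂ c₃ : ℕ → ℕ → ℂ} (h₁ : ∀ k l, c₁ k l = -c₁ l k)
    (h₂ : ∀ k l, c₂ k l = -c₂ l k) (i j : ℕ ⊕ ℕ) :
    pairKernel c₁ c₂ c₃ i j = -pairKernel c₁ c₂ c₃ j i := by
  rcases i with i | i <;> rcases j with j | j
  · exact h₁ _ _
  · rfl
  · exact (neg_neg _).symm
  · exact h₂ _ _

/-- Triangular sums become half of full antisymmetric sums. The element `b 0` is split off as the p
of `mixedForm`, since it need not be nilpotent; hence the shift by one in the labels of b, and N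
such labels against N + 1 for a. -/
theorem sum_eq_mixedForm {R : Type*} [Ring R] [Algebra ℂ R] (a b : ℕ → R)
    (h : ∀ i j, (Sum.elim a (fun m => b (m + 1)) : ℕ ⊕ ℕ → R) i * Sum.elim a (fun m => b (m + 1)) j =
      -(Sum.elim a (fun m => b (m + 1)) j * Sum.elim a (fun m => b (m + 1)) i))
    {c₁ c₂ c₃ : ℕ → ℕ → ℂ} (h₁ : ∀ k l, c₁ k l = -c₁ l k) (h₂ : ∀ k l, c₂ k l = -c₂ l k) (N : ℕ) :
    (∑ k ∈ Finset.range (N + 1), ∑ l ∈ Finset.range k, c₁ k l • (a k * a l)) +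
      (∑ m ∈ Finset.range (N + 1), ∑ n ∈ Finset.range m, c₂ m n • (b m * b n)) -
      ∑ k ∈ Finset.range (N + 1), ∑ m ∈ Finset.range (N + 1), c₃ k m • (a k * b m) =
    mixedForm (Sum.elim a (fun m => b (m + 1))) (b 0) (pairKernel c₁ c₂ c₃) (pairLin c₂ c₃)
      (cutoffSet N) := by
  have haa : ∀ k l, a k * a l = -(a l * a k) := fun k l => h (Sum.inl k) (Sum.inl l)
  have hbb : ∀ k l, b (k + 1) * b (l + 1) = -(b (l + 1) * b (k + 1)) :=
    fun k l => h (Sum.inr k) (Sum.inr l)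
  have hab : ∀ k l, b (l + 1) * a k = -(a k * b (l + 1)) := fun k l => h (Sum.inr l) (Sum.inl k)
  have hz : ∀ c : ℕ → ℕ → ℂ, (∀ k l, c k l = -c l k) → ∀ k, c k k = 0 := fun c hc k =>
    self_eq_neg.1 (hc k k)
  have e₁ := sum_lower_triangle (fun k l => c₁ k l • (a k * a l))
    (fun k l => by rw [haa, h₁, smul_neg, neg_smul, neg_neg]) (fun k => by simp [hz c₁ h₁]) (N + 1)
  have e₂ := sum_lower_triangle (fun k l => c₂ (k + 1) (l + 1) • (b (k + 1) * b (l + 1)))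
    (fun k l => by rw [hbb, h₂, smul_neg, neg_smul, neg_neg]) (fun k => by simp [hz c₂ h₂]) N
  have e₃ : ∑ k ∈ Finset.range (N + 1), ∑ m ∈ Finset.range N,
      ((1 / 2 * -c₃ k (m + 1)) • (a k * b (m + 1))) + ∑ m ∈ Finset.range N,
        ∑ k ∈ Finset.range (N + 1), ((1 / 2 * c₃ k (m + 1)) • (b (m + 1) * a k)) =
      - ∑ k ∈ Finset.range (N + 1), ∑ m ∈ Finset.range N, c₃ k (m + 1) • (a k * b (m + 1)) := by
    rw [Finset.sum_comm (s := Finset.range N), ← Finset.sum_add_distrib, ← Finset.sum_neg_distrib]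
    refine Finset.sum_congr rfl fun k _ => ?_
    rw [← Finset.sum_add_distrib, ← Finset.sum_neg_distrib]
    refine Finset.sum_congr rfl fun m _ => ?_
    rw [hab]
    module
  rw [mixedForm, quadForm, linForm, cutoffSet, Finset.sum_disjSum, Finset.sum_disjSum]
  simp only [Finset.sum_disjSum, pairKernel, pairLin, Sum.elim_inl, Sum.elim_inr,
    Finset.sum_add_distrib]
  simp only [smul_smul] at e₁ e₂
  rw [e₁, e₂, ← add_assoc, add_assoc (∑ k ∈ Finset.range (N + 1), ∑ l ∈ Finset.range k, _) _
    (∑ m ∈ Finset.range N, ∑ k ∈ Finset.range (N + 1), _), e₃]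
  rw [Finset.sum_range_succ' (fun m => ∑ n ∈ Finset.range m, c₂ m n • (b m * b n))]
  simp only [Finset.sum_range_succ' (fun n => c₂ _ n • (b _ * b n)),
    Finset.sum_range_succ' (fun n => c₃ _ n • (a _ * b n)), Finset.sum_add_distrib,
    Finset.range_zero, Finset.sum_empty, add_zero, add_mul, Finset.sum_mul, smul_mul_assoc,
    neg_smul, neg_mul, Finset.sum_neg_distrib]
  abel

theorem mixedForm_smul {ι R : Type*} [Ring R] [Algebra ℂ R] (t : ι → ℂ) (g : ι → R) (p : R)
    (K : ι → ι → ℂ) (d : ι → ℂ) (I : Finset ι) :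
    mixedForm (fun i => t i • g i) p K d I =
      mixedForm g p (fun i j => K i j * (t i * t j)) (fun i => d i * t i) I := by
  simp only [mixedForm, quadForm, linForm, smul_mul_smul_comm, smul_smul, mul_assoc]

/-- The coefficient of `createNS k` in `varphiNSneg q ι k`. -/
def coefNS (q ι : ℂ) (k : ℕ) : ℂ := gam q k * q ^ (5 * k + 2) / eta q (2 * k + 1) * ι

/-- The coefficient of `annihilateR m` in `varphiRpos q (m + 1)`. -/
def coefR (q : ℂ) (m : ℕ) : ℂ := gam q (m + 1) * q ^ (-3 * ((m + 1 : ℕ) : ℤ))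

theorem liftNS_neg (q : ℂ) (k : ℕ) : liftNS q (-k - 1) = createNS k := by
  rw [show (-k - 1 : ℤ) = Int.negSucc k by omega]
  rfl

theorem liftR_succ (q : ℂ) (m : ℕ) :
    liftR q ((m + 1 : ℕ) : ℤ) = eta q (2 * (m + 1)) • annihilateR m :=
  TensorProduct.map_smul_left _ _ _

theorem varphiNSneg_eq (q ι : ℂ) (k : ℕ) : varphiNSneg q ι k = coefNS q ι k • createNS k := by
  rw [varphiNSneg, liftNS_neg, coefNS]

theorem varphiRpos_zero (q : ℂ) : varphiRpos q 0 = parityRNS := rfl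

theorem eta_R_ne_zero {q : ℂ} (hq0 : q ≠ 0) (hq1 : ‖q‖ < 1) (m : ℕ) :
    eta q (2 * (m + 1)) ≠ 0 := by
  exact_mod_cast eta_ne_zero hq0 hq1 (a := 2 * (m + 1)) (by omega)

theorem eta_NS_ne_zero {q : ℂ} (hq0 : q ≠ 0) (hq1 : ‖q‖ < 1) (m : ℕ) :
    eta q (2 * m + 1) ≠ 0 := by
  exact_mod_cast eta_ne_zero hq0 hq1 (a := 2 * m + 1) (by omega)

theorem varphiRpos_succ {q : ℂ} (hq0 : q ≠ 0) (hq1 : ‖q‖ < 1) (m : ℕ) :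
    varphiRpos q (m + 1) = coefR q m • annihilateR m := by
  have h := eta_R_ne_zero hq0 hq1 m
  rw [varphiRpos, if_neg (by omega), liftR_succ, smul_smul, coefR]
  congr 1
  push_cast at h ⊢
  rw [div_mul_cancel₀ _ h]

/-- The scalars by which the rescaled modes of `Y'` differ from `grass`. -/
def grassScale (q ι : ℂ) : ℕ ⊕ ℕ → ℂ := Sum.elim (coefNS q ι) (coefR q)

/-- The coefficients of `Y'` in the Neveu-Schwarz sector. -/
def coefYNS (q s : ℂ) (k l : ℕ) : ℂ :=
  coeffX q (2 * k + 1) (2 * l + 1) * s ^ (2 * ((k : ℤ) + l + 1))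

/-- The coefficients of `Y'` in the Ramond sector. -/
def coefYR (q s : ℂ) (m n : ℕ) : ℂ := coeffX q (2 * m) (2 * n) * s ^ (2 * (-(m : ℤ) - n))

/-- The coefficients of `Y'` that connect the sectors. -/
def coefYMixed (q s : ℂ) (k m : ℕ) : ℂ :=
  coeffX q (-(2 * k) - 1) (2 * m) * s ^ (2 * (k : ℤ) - 2 * m + 1)

theorem coeffX_antisymm (q : ℂ) (a b : ℤ) : coeffX q a b = -coeffX q b a := by
  rw [coeffX, coeffX, add_comm b a]
  ring

theorem coefYNS_antisymm (q s : ℂ) (k l : ℕ) : coefYNS q s k l = -coefYNS q s l k := by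
  rw [coefYNS, coefYNS, coeffX_antisymm, add_comm (k : ℤ) l]
  ring

theorem coefYR_antisymm (q s : ℂ) (k l : ℕ) : coefYR q s k l = -coefYR q s l k := by
  rw [coefYR, coefYR, coeffX_antisymm, sub_eq_add_neg, add_comm (-(k : ℤ)), ← sub_eq_add_neg]
  ring

/-- The kernel of `Y'` in terms of `grass`. -/
def kernelY (q ι s : ℂ) (i j : ℕ ⊕ ℕ) : ℂ :=
  pairKernel (coefYNS q s) (coefYR q s) (coefYMixed q s) i j * (grassScale q ι i * grassScale q ι j)

/-- The coefficients of the products with `φ^R_0` in `Y'`, in terms of `grass`. -/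
def linY (q ι s : ℂ) (i : ℕ ⊕ ℕ) : ℂ :=
  pairLin (coefYR q s) (coefYMixed q s) i * grassScale q ι i

theorem kernelY_antisymm (q ι s : ℂ) (i j : ℕ ⊕ ℕ) : kernelY q ι s i j = -kernelY q ι s j i := by
  rw [kernelY, kernelY, pairKernel_antisymm (coefYNS_antisymm q s) (coefYR_antisymm q s)]
  ring

theorem scaled_grass_eq {q : ℂ} (hq0 : q ≠ 0) (hq1 : ‖q‖ < 1) (ι : ℂ) :
    (Sum.elim (varphiNSneg q ι) fun m => varphiRpos q (m + 1)) =
      fun i => grassScale q ι i • grass i := by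
  funext i
  rcases i with i | i
  · exact varphiNSneg_eq q ι i
  · exact varphiRpos_succ hq0 hq1 i

theorem expY'_eq {q : ℂ} (hq0 : q ≠ 0) (hq1 : ‖q‖ < 1) (ι s : ℂ) (N : ℕ) :
    expY' q ι s N = grassExponent (kernelY q ι s) (linY q ι s) (cutoffSet N) := by
  have h := sum_eq_mixedForm (varphiNSneg q ι) (varphiRpos q) (fun i j => by
    rw [scaled_grass_eq hq0 hq1, smul_mul_smul_comm, smul_mul_smul_comm, grassmannSystem.anticomm,
      smul_neg, mul_comm (grassScale q ι i)]) (c₃ := coefYMixed q s) (coefYNS_antisymm q s)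
    (coefYR_antisymm q s) N
  rw [scaled_grass_eq hq0 hq1, mixedForm_smul] at h
  exact h

theorem isNilpotent_expY' {q : ℂ} (hq0 : q ≠ 0) (hq1 : ‖q‖ < 1) (ι s : ℂ) (N : ℕ) :
    IsNilpotent (expY' q ι s N) := by
  rw [expY'_eq hq0 hq1]
  exact isNilpotent_grassExponent _ _ _

/-! ### The coefficients of the contractions -/

/-- The product of `w` and the argument of `γ` in the expansion at `w = ∞`. -/
def xArg (q s : ℂ) : ℂ := q ^ 5 * s ^ 2

/-- The quotient by `w` of the argument of `γ` in the expansion at `w = 0`. -/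
def yArg (q s : ℂ) : ℂ := (q ^ 3 * s ^ 2)⁻¹

/-- The constant in `rootFactor`. -/
def rootConst (q ι s : ℂ) : ℂ := ι * q ^ 2 * s

section Contractions

variable {q : ℂ}

theorem coeffX_natCast (q : ℂ) (a b : ℕ) :
    coeffX q a b = (q ^ (2 * a) - q ^ (2 * b)) / (1 - q ^ (2 * (a + b))) := by
  rw [coeffX]
  norm_cast

theorem coeffX_neg_natCast (hq0 : q ≠ 0) (a b : ℕ) :
    coeffX q (-a) b = (1 - q ^ (2 * (a + b))) / (q ^ (2 * a) - q ^ (2 * b)) := by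
  have h := pow_ne_zero (2 * a) hq0
  have h1 : q ^ (2 * (-(a : ℤ))) = (q ^ (2 * a))⁻¹ := by
    rw [mul_neg, zpow_neg]
    norm_cast
  have h2 : q ^ (2 * (-(a : ℤ) + b)) = (q ^ (2 * a))⁻¹ * q ^ (2 * b) := by
    rw [mul_add, zpow_add₀ hq0, h1]
    norm_cast
  have h3 : q ^ (2 * (b : ℤ)) = q ^ (2 * b) := by norm_cast
  rw [coeffX, h1, h2, h3, ← mul_div_mul_left _ _ h]
  congr 1
  · field_simp
    ring
  · field_simp

theorem coeffX_neg_zero (hq0 : q ≠ 0) (hq1 : ‖q‖ < 1) (k : ℕ) :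
    coeffX q (-(2 * k) - 1) 0 = -1 := by
  have h := coeffX_neg_natCast hq0 (2 * k + 1) 0
  have h1 := one_sub_pow_ne_zero hq0 hq1 (a := 2 * (2 * k + 1)) (by omega)
  push_cast at h
  rw [show (-(2 * k) - 1 : ℤ) = -(2 * k + 1) by ring, h, add_zero, pow_zero, div_eq_iff
    (by rw [← neg_ne_zero, neg_sub]; exact h1)]
  ring

theorem coeffX_pos_zero (hq0 : q ≠ 0) (hq1 : ‖q‖ < 1) (m : ℕ) :
    coeffX q (2 * (m + 1)) 0 = -1 := by
  have h := coeffX_natCast q (2 * (m + 1)) 0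
  have h1 := one_sub_pow_ne_zero hq0 hq1 (a := 2 * (2 * (m + 1))) (by omega)
  push_cast at h
  rw [h, add_zero, pow_zero, div_eq_iff h1]
  ring

theorem eta_NS_eq (hq0 : q ≠ 0) (k : ℕ) :
    eta q (2 * k + 1) = (1 + q ^ (4 * k + 2)) / q ^ (2 * k + 1) := by
  have h := eta_natCast hq0 (2 * k + 1)
  push_cast at h
  rw [eq_div_iff (pow_ne_zero _ hq0), mul_comm, h]
  ring

theorem eta_R_eq (hq0 : q ≠ 0) (k : ℕ) :
    eta q (2 * (k + 1)) = (1 + q ^ (4 * k + 4)) / q ^ (2 * k + 2) := by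
  have h := eta_natCast hq0 (2 * (k + 1))
  push_cast at h
  rw [eq_div_iff (pow_ne_zero _ hq0), mul_comm, show 2 * k + 2 = 2 * (k + 1) by ring, h]
  ring

theorem one_add_pow_NS_ne_zero (hq0 : q ≠ 0) (hq1 : ‖q‖ < 1) (k : ℕ) : 1 + q ^ (4 * k + 2) ≠ 0 := by
  have h := eta_NS_ne_zero hq0 hq1 k
  rw [eta_NS_eq hq0] at h
  exact (div_ne_zero_iff.1 h).1

theorem coefR_eq (q : ℂ) (m : ℕ) : coefR q m = gam q (m + 1) / q ^ (3 * (m + 1)) := by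
  rw [coefR, neg_mul, zpow_neg, ← div_eq_mul_inv]
  norm_cast

theorem linY_inl (hq0 : q ≠ 0) (hq1 : ‖q‖ < 1) (ι s : ℂ) (k : ℕ) :
    linY q ι s (Sum.inl k) = s ^ (2 * k + 1) * coefNS q ι k := by
  simp only [linY, pairLin, coefYMixed, grassScale, Sum.elim_inl, Nat.cast_zero, mul_zero,
    coeffX_neg_zero hq0 hq1, sub_zero, neg_mul, one_mul, neg_neg]
  norm_cast

theorem linY_inr (hq0 : q ≠ 0) (hq1 : ‖q‖ < 1) (ι s : ℂ) (m : ℕ) :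
    linY q ι s (Sum.inr m) = -((s ^ (2 * (m + 1)))⁻¹ * coefR q m) := by
  simp only [linY, pairLin, coefYR, grassScale, Sum.elim_inr, Nat.cast_zero, mul_zero,
    Nat.cast_succ, coeffX_pos_zero hq0 hq1, sub_zero, neg_mul, one_mul, mul_neg, zpow_neg]
  norm_cast

theorem coefNS_mul_coefNS {ι : ℂ} (hι : ι ^ 2 = -1) (k l : ℕ) : coefNS q ι k * coefNS q ι l =
    -((gam q k * q ^ (5 * k + 2) / eta q (2 * k + 1)) *
      (gam q l * q ^ (5 * l + 2) / eta q (2 * l + 1))) := by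
  rw [coefNS, coefNS]
  linear_combination (gam q k * q ^ (5 * k + 2) / eta q (2 * k + 1)) *
      (gam q l * q ^ (5 * l + 2) / eta q (2 * l + 1)) * hι

/-- This and the following lemmas identify the corrected kernel, which combines X with a product of
two linear coefficients, with the convolution kernels. It is where the choice of X and of the
rescaled modes enters. -/
theorem contraction_NS_NS (hq0 : q ≠ 0) (hq1 : ‖q‖ < 1) {ι : ℂ} (hι : ι ^ 2 = -1) (s : ℂ)
    (k l : ℕ) :
    eta q (2 * k + 1) * (kernelY q ι s (Sum.inl k) (Sum.inl l) -
      linY q ι s (Sum.inl k) * linY q ι s (Sum.inl l)) =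
      xArg q s ^ (k + l + 1) * kerF q k l := by
  have h1 := one_add_pow_NS_ne_zero hq0 hq1 k
  have h2 := one_add_pow_NS_ne_zero hq0 hq1 l
  have h3 := one_sub_pow_ne_zero hq0 hq1 (a := 4 * (k + l + 1)) (by omega)
  have hs : s ^ (2 * ((k : ℤ) + l + 1)) = s ^ (2 * (k + l + 1)) := by norm_cast
  have hX := coeffX_natCast q (2 * k + 1) (2 * l + 1)
  push_cast at hX
  rw [linY_inl hq0 hq1, linY_inl hq0 hq1]
  simp only [kernelY, pairKernel, coefYNS, grassScale, Sum.elim_inl]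
  rw [mul_mul_mul_comm (s ^ _), coefNS_mul_coefNS hι, eta_NS_eq hq0, eta_NS_eq hq0, hs, hX, kerF, xArg]
  rw [show 2 * (2 * k + 1 + (2 * l + 1)) = 4 * (k + l + 1) by ring]
  field_simp
  ring

theorem contraction_NS_R (hq0 : q ≠ 0) (hq1 : ‖q‖ < 1) {s : ℂ} (hs0 : s ≠ 0) (ι : ℂ)
    (k m : ℕ) :
    eta q (2 * k + 1) * (kernelY q ι s (Sum.inl k) (Sum.inr m) -
      linY q ι s (Sum.inl k) * linY q ι s (Sum.inr m)) =
      rootConst q ι s * (xArg q s ^ k * yArg q s ^ (m + 1) * kerH q k (m + 1) *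
        eta q (2 * (m + 1))) := by
  have h1 := one_add_pow_NS_ne_zero hq0 hq1 k
  have h3 := pow_sub_pow_ne_zero hq0 hq1 (a := 4 * (m + 1)) (b := 4 * k + 2) (by omega)
  have h4 := pow_sub_pow_ne_zero hq0 hq1 (b := 4 * (m + 1)) (a := 4 * k + 2) (by omega)
  have hs : s ^ (2 * (k : ℤ) - 2 * (m + 1 : ℕ) + 1) = s ^ (2 * k + 1) / s ^ (2 * (m + 1)) := by
    rw [sub_add_eq_add_sub, zpow_sub₀ hs0]
    norm_cast
  have hX : coeffX q (-(2 * k) - 1) (2 * (m + 1 : ℕ)) = 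
      (1 - q ^ (2 * (2 * k + 1 + 2 * (m + 1)))) / (q ^ (4 * k + 2) - q ^ (4 * (m + 1))) := by
    have := coeffX_neg_natCast hq0 (2 * k + 1) (2 * (m + 1))
    rw [show 4 * k + 2 = 2 * (2 * k + 1) by ring, show 4 * (m + 1) = 2 * (2 * (m + 1)) by ring,
      ← this]
    push_cast
    ring_nf
  rw [linY_inl hq0 hq1, linY_inr hq0 hq1]
  simp only [kernelY, pairKernel, coefYMixed, grassScale, Sum.elim_inl, Sum.elim_inr]
  rw [hs, hX, coefNS, coefR_eq, eta_NS_eq hq0, eta_R_eq hq0, kerH, xArg, yArg, rootConst,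
    ← neg_sub (q ^ (4 * k + 2)) (q ^ (4 * (m + 1))), div_neg, inv_pow]
  field_simp
  ring

theorem contraction_NS_zero (hq0 : q ≠ 0) (hq1 : ‖q‖ < 1) (ι s : ℂ) (k : ℕ) :
    eta q (2 * k + 1) * linY q ι s (Sum.inl k) =
      rootConst q ι s * (xArg q s ^ k * kerH q k 0) := by
  have h := eta_NS_ne_zero hq0 hq1 k
  rw [linY_inl hq0 hq1, coefNS, kerH_zero_right hq0 hq1, xArg, rootConst]
  field_simp
  ring

/-- The minus signs in the contractions with a Ramond creation mode come from solving the
conjugation identity for the term on its right-hand side. -/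
theorem contraction_R_NS (hq0 : q ≠ 0) (hq1 : ‖q‖ < 1) {ι : ℂ} (hι : ι ^ 2 = -1) {s : ℂ}
    (hs0 : s ≠ 0) (m l : ℕ) :
    -(kernelY q ι s (Sum.inr m) (Sum.inl l) - linY q ι s (Sum.inr m) * linY q ι s (Sum.inl l)) =
      (rootConst q ι s)⁻¹ * (yArg q s ^ m * xArg q s ^ l * kerH q m l) := by
  have h1 := one_add_pow_NS_ne_zero hq0 hq1 l
  have h2 := one_sub_pow_ne_zero hq0 hq1 (a := 4 * m + 4) (by omega)
  have h3 := pow_sub_pow_ne_zero hq0 hq1 (a := 4 * l) (b := 4 * m + 2) (by omega)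
  have hι0 : ι⁻¹ = -ι := inv_eq_of_mul_eq_one_right (by linear_combination -hι)
  have hs : s ^ (2 * (l : ℤ) - 2 * (m + 1 : ℕ) + 1) = s ^ (2 * l + 1) / s ^ (2 * (m + 1)) := by
    rw [sub_add_eq_add_sub, zpow_sub₀ hs0]
    norm_cast
  have hX : coeffX q (-(2 * l) - 1) (2 * (m + 1 : ℕ)) = 
      (1 - q ^ (2 * (2 * l + 1 + 2 * (m + 1)))) / (q ^ 2 * (q ^ (4 * l) - q ^ (4 * m + 2))) := by
    have := coeffX_neg_natCast hq0 (2 * l + 1) (2 * (m + 1))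
    rw [show q ^ 2 * (q ^ (4 * l) - q ^ (4 * m + 2)) = q ^ (2 * (2 * l + 1)) -
      q ^ (2 * (2 * (m + 1))) by ring, ← this]
    push_cast
    ring_nf
  rw [linY_inl hq0 hq1, linY_inr hq0 hq1]
  simp only [kernelY, pairKernel, coefYMixed, grassScale, Sum.elim_inl, Sum.elim_inr]
  rw [hs, hX, coefNS, coefR_eq, eta_NS_eq hq0, kerH, xArg, yArg, rootConst, gam_succ, mul_inv,
    mul_inv, hι0, inv_pow]
  field_simp
  ring

theorem contraction_R_R (hq0 : q ≠ 0) (hq1 : ‖q‖ < 1) {s : ℂ} (hs0 : s ≠ 0) (ι : ℂ) (m n : ℕ) :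
    -(kernelY q ι s (Sum.inr m) (Sum.inr n) - linY q ι s (Sum.inr m) * linY q ι s (Sum.inr n)) =
      yArg q s ^ (m + 1 + (n + 1)) * kerF q m (n + 1) * eta q (2 * (n + 1)) := by
  have h2 := one_sub_pow_ne_zero hq0 hq1 (a := 4 * m + 4) (by omega)
  have h3 := one_sub_pow_ne_zero hq0 hq1 (a := 4 * (m + (n + 1) + 1)) (by omega)
  have hs : s ^ (2 * (-((m + 1 : ℕ) : ℤ) - (n + 1 : ℕ))) =
      (s ^ (2 * (m + 1)))⁻¹ * (s ^ (2 * (n + 1)))⁻¹ := by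
    rw [mul_sub, sub_eq_add_neg, zpow_add₀ hs0, mul_neg, zpow_neg, zpow_neg]
    norm_cast
  have hX := coeffX_natCast q (2 * (m + 1)) (2 * (n + 1))
  push_cast at hX
  rw [linY_inr hq0 hq1, linY_inr hq0 hq1]
  simp only [kernelY, pairKernel, coefYR, grassScale, Sum.elim_inr, hs]
  push_cast
  rw [hX, coefR_eq, coefR_eq, eta_R_eq hq0, kerF, yArg, gam_succ m,
    show 2 * (2 * (m + 1) + 2 * (n + 1)) = 4 * (m + (n + 1) + 1) by ring, inv_pow]
  field_simp
  ring

theorem contraction_R_zero (hq0 : q ≠ 0) (hq1 : ‖q‖ < 1) (ι s : ℂ) (m : ℕ) :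
    -linY q ι s (Sum.inr m) = yArg q s ^ (m + 1) * kerF q m 0 := by
  rw [linY_inr hq0 hq1, kerF_zero_right, coefR_eq, yArg, inv_pow, mul_pow, mul_inv, ← pow_mul]
  field_simp
  ring

end Contractions

/-! ### The matrix elements of the cut-off exponential -/

theorem braRNS_add_right (q : ℂ) (r : FockR) (v v' : FockNS) (x : FockRNS) :
    braRNS q r (v + v') x = braRNS q r v x + braRNS q r v' x := by
  simp [braRNS, TensorProduct.map_add_right]

theorem braRNS_smul_right (q : ℂ) (r : FockR) (c : ℂ) (v : FockNS) (x : FockRNS) :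
    braRNS q r (c • v) x = c * braRNS q r v x := by
  simp [braRNS, TensorProduct.map_smul_right]

/-- The bilinear form `cutRNS`. -/
def cutForm (q ι s : ℂ) (N : ℕ) : FockNS →ₗ[ℂ] FockR →ₗ[ℂ] ℂ :=
  LinearMap.mk₂ ℂ (fun out inc => cutRNS q ι s N out inc)
    (fun _ _ _ => braRNS_add_right _ _ _ _ _) (fun _ _ _ => braRNS_smul_right _ _ _ _ _)
    (fun _ _ _ => by simp only [cutRNS, TensorProduct.add_tmul, map_add])
    (fun _ _ _ => by
      simp only [cutRNS, ← TensorProduct.smul_tmul', map_smul])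

theorem cutForm_apply (q ι s : ℂ) (N : ℕ) (out : FockNS) (inc : FockR) :
    cutForm q ι s N out inc =
      braRNS q vac out (IsNilpotent.exp (expY' q ι s N) (inc ⊗ₜ vac)) := rfl

/-- The reduction of `⟨out| φ^{NS}_{k+1/2} Ω |inc⟩` by contractions. -/
def wickNS (q ι s : ℂ) (Om : FockNS →ₗ[ℂ] FockR →ₗ[ℂ] ℂ) (k M : ℕ) (out : FockNS)
    (inc : FockR) : ℂ :=
  ∑ l ∈ Finset.range M, xArg q s ^ (k + l + 1) * kerF q k l * Om (phiNS q l out) inc +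
    rootConst q ι s * ∑ m ∈ Finset.range M,
      xArg q s ^ k * yArg q s ^ m * kerH q k m * Om out (phiR q m inc)

/-- The reduction of `⟨out| Ω φ^R_{-i-1} |inc⟩` by contractions. -/
def wickR (q ι s : ℂ) (Om : FockNS →ₗ[ℂ] FockR →ₗ[ℂ] ℂ) (i M : ℕ) (out : FockNS)
    (inc : FockR) : ℂ :=
  ∑ n ∈ Finset.range M, yArg q s ^ (i + 1 + n) * kerF q i n * Om out (phiR q n inc) +
    (rootConst q ι s)⁻¹ * ∑ l ∈ Finset.range M,
      yArg q s ^ i * xArg q s ^ l * kerH q i l * Om (phiNS q l out) inc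

theorem phiR_zero (q : ℂ) : phiR q 0 = parity := rfl

theorem phiR_succ (q : ℂ) (m : ℕ) :
    phiR q ((m + 1 : ℕ) : ℤ) = eta q (2 * (m + 1)) • annihilate m := rfl

theorem phiR_negSucc (q : ℂ) (m : ℕ) : phiR q (Int.negSucc m) = create m := rfl

theorem phiNS_natCast (q : ℂ) (k : ℕ) : phiNS q k = eta q (2 * k + 1) • annihilate k := rfl

theorem phiNS_negSucc (q : ℂ) (k : ℕ) : phiNS q (Int.negSucc k) = create k := rfl

theorem eta_mul_bra_exp_grass_inr (q ι s : ℂ) (N m : ℕ) (out : FockNS) (inc : FockR) :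
    eta q (2 * (m + 1)) *
      braRNS q vac out (IsNilpotent.exp (expY' q ι s N) (grass (Sum.inr m) (inc ⊗ₜ vac))) =
      cutForm q ι s N out (phiR q (m + 1 : ℕ) inc) := by
  rw [phiR_succ, LinearMap.smul_apply, map_smul, smul_eq_mul, cutForm_apply]
  simp only [grass, Sum.elim_inr, annihilateR_tmul, parity_vac]

theorem bra_exp_parity (q ι s : ℂ) (N : ℕ) (out : FockNS) (inc : FockR) :
    braRNS q vac out (IsNilpotent.exp (expY' q ι s N) (parityRNS (inc ⊗ₜ vac))) =
      cutForm q ι s N out (phiR q (0 : ℕ) inc) := by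
  rw [parityRNS_tmul, parity_vac]
  rfl

section Cutoff

variable {q ι s : ℂ} (hq0 : q ≠ 0) (hq1 : ‖q‖ < 1)
include hq0 hq1

theorem bra_exp_grass_inl (N l : ℕ) (out : FockNS) (inc : FockR) :
    braRNS q vac out (IsNilpotent.exp (expY' q ι s N) (grass (Sum.inl l) (inc ⊗ₜ vac))) =
      cutForm q ι s N (phiNS q l out) inc := by
  have h := commute_exp (commute_grassExponent_grass (kernelY q ι s) (linY q ι s) (cutoffSet N)
    (Sum.inl l)) (isNilpotent_grassExponent _ _ _)
  rw [← expY'_eq hq0 hq1] at h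
  rw [← Module.End.mul_apply, h.eq, Module.End.mul_apply, cutForm_apply, phiNS_natCast,
    LinearMap.smul_apply, braRNS_smul_right]
  exact braRNS_createNS _ _ _ _ _

/-- The conjugation formula between the two vacua. The Neveu-Schwarz creators in the linear form
commute with e^{Y'} and become annihilators on `out`; the Ramond annihilators and the parity act on
`inc`. -/
theorem bra_grassDual_exp (N : ℕ) {i : ℕ ⊕ ℕ} (hi : i ∈ cutoffSet N) (out : FockNS)
    (inc : FockR) :
    braRNS q vac out (grassDual i (IsNilpotent.exp (expY' q ι s N) (inc ⊗ₜ vac))) =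
      braRNS q vac out (IsNilpotent.exp (expY' q ι s N) (grassDual i (inc ⊗ₜ vac))) +
      (∑ l ∈ Finset.range (N + 1), (kernelY q ι s i (Sum.inl l) -
          linY q ι s i * linY q ι s (Sum.inl l)) * cutForm q ι s N (phiNS q l out) inc +
        ∑ m ∈ Finset.range N, (kernelY q ι s i (Sum.inr m) -
          linY q ι s i * linY q ι s (Sum.inr m)) *
          braRNS q vac out (IsNilpotent.exp (expY' q ι s N) (grass (Sum.inr m) (inc ⊗ₜ vac)))) +
        linY q ι s i * cutForm q ι s N out (phiR q (0 : ℕ) inc) := by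
  have h := grassmannSystem.dual_mul_exp (kernelY q ι s) (linY q ι s)
    (kernelY_antisymm q ι s) hi
  have h3 : mixedForm grass parityRNS (kernelY q ι s) (linY q ι s) (cutoffSet N) =
    expY' q ι s N := (expY'_eq hq0 hq1 ι s N).symm
  rw [h3] at h
  have h2 := congrArg (fun f => braRNS q vac out (f (inc ⊗ₜ vac))) h
  simp only [Module.End.mul_apply, LinearMap.add_apply, linForm, LinearMap.sum_apply,
    LinearMap.smul_apply, map_add, map_sum, map_smul, cutoffSet, Finset.sum_disjSum,
    smul_eq_mul, bra_exp_parity, bra_exp_grass_inl hq0 hq1] at h2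
  exact h2

/-- The conjugated operator annihilates the inner Neveu-Schwarz vacuum, so only contractions remain.
-/
theorem cutForm_create_left (hι : ι ^ 2 = -1) (hs : s ≠ 0) {k N : ℕ} (hk : k ≤ N)
    (out : FockNS) (inc : FockR) :
    cutForm q ι s N (create k out) inc = wickNS q ι s (cutForm q ι s N) k (N + 1) out inc := by
  have h := bra_grassDual_exp (ι := ι) (s := s) hq0 hq1 N (i := Sum.inl k)
    (by simpa [cutoffSet] using hk) out inc
  have h0 : grassDual (Sum.inl k) (inc ⊗ₜ vac) = 0 := by
    simp [grassDual, annihilate_vac]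
  rw [h0, map_zero, map_zero, zero_add] at h
  rw [cutForm_apply, braRNS_create_right, show annihilateNS k = grassDual (Sum.inl k) from rfl, h,
    wickNS, Finset.sum_range_succ' (fun m => xArg q s ^ k * yArg q s ^ m * kerH q k m *
      cutForm q ι s N out (phiR q m inc)) N, mul_add, mul_add, mul_add (rootConst q ι s), ← add_assoc,
    ← mul_assoc _ (linY _ _ _ _), contraction_NS_zero hq0 hq1, pow_zero, mul_one, Finset.mul_sum,
    Finset.mul_sum, Finset.mul_sum]
  congr 1
  · congr 1
    · refine Finset.sum_congr rfl fun l _ => ?_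
      rw [← mul_assoc, contraction_NS_NS hq0 hq1 hι]
    · refine Finset.sum_congr rfl fun m _ => ?_
      rw [← mul_assoc, contraction_NS_R hq0 hq1 hs, ← eta_mul_bra_exp_grass_inr]
      ring
  · ring

/-- The Ramond creator on the left is killed by the inner bra, so the identity can be solved for the
creator acting on `inc`. Strictness of i < N reflects that label i is the mode i + 1. -/
theorem cutForm_create_right (hι : ι ^ 2 = -1) (hs : s ≠ 0) {i N : ℕ} (hi : i < N)
    (out : FockNS) (inc : FockR) :
    cutForm q ι s N out (create i inc) = wickR q ι s (cutForm q ι s N) i (N + 1) out inc := by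
  have h := bra_grassDual_exp (ι := ι) (s := s) hq0 hq1 N (i := Sum.inr i)
    (by simpa [cutoffSet] using hi) out inc
  rw [show grassDual (Sum.inr i) = createR i from rfl, braRNS_vac_createR, createR_tmul,
    parity_vac, ← cutForm_apply, add_assoc, eq_comm, ← eq_neg_iff_add_eq_zero] at h
  rw [h, wickR, Finset.sum_range_succ' (fun n => yArg q s ^ (i + 1 + n) * kerF q i n *
      cutForm q ι s N out (phiR q n inc)) N, neg_add, neg_add, ← neg_mul,
    contraction_R_zero hq0 hq1, add_zero, ← Finset.sum_neg_distrib, ← Finset.sum_neg_distrib,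
    Finset.mul_sum, add_right_comm, add_comm _ (∑ m ∈ Finset.range N, _), ← add_assoc, add_right_comm]
  congr 1
  · congr 1
    · refine Finset.sum_congr rfl fun m _ => ?_
      rw [← neg_mul, contraction_R_R hq0 hq1 hs, ← eta_mul_bra_exp_grass_inr]
      ring
  · refine Finset.sum_congr rfl fun l _ => ?_
    rw [← neg_mul, contraction_R_NS hq0 hq1 hι hs]
    ring

theorem cutForm_vac_vac (N : ℕ) : cutForm q ι s N vac vac = 1 := by
  rw [cutForm_apply, expY'_eq hq0 hq1]
  exact bra_vac_exp_vac _ _ _ _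

end Cutoff

/-! ### Induction on the fermion number -/

/-- Induction on the total number of particles of two basis vectors. In the creation steps the pairs
assumed have one particle fewer (parity) or three fewer (annihilation), which is the shape of the
Wick rules. -/
theorem fock_pair_induction {P : Fock → Fock → Prop}
    (zero_left : ∀ y, P 0 y) (zero_right : ∀ x, P x 0)
    (add_left : ∀ x x' y, P x y → P x' y → P (x + x') y)
    (add_right : ∀ x y y', P x y → P x y' → P x (y + y'))
    (smul_left : ∀ (c : ℂ) x y, P x y → P (c • x) y)
    (smul_right : ∀ (c : ℂ) x y, P x y → P x (c • y))
    (vac_vac : P vac vac)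
    (create_left : ∀ k x y, (∀ l, P (annihilate l x) y) → (∀ m, P x (annihilate m y)) →
      P x (parity y) → P (create k x) y)
    (create_right : ∀ k x y, (∀ l, P (annihilate l x) y) → (∀ m, P x (annihilate m y)) →
      P x (parity y) → P x (create k y)) (x y : Fock) : P x y := by
  have single_smul : ∀ (S : Finset ℕ) (c : ℂ), Finsupp.single S c = c • Finsupp.single S 1 := by
    simp
  have main : ∀ n : ℕ, ∀ (S T : Finset ℕ) (a b : ℂ), S.card + T.card = n →
      P (Finsupp.single S a) (Finsupp.single T b) := by
    intro n
    induction n using Nat.strong_induction_on with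
    | _ n ih =>
      intro S T a b hn
      rcases S.eq_empty_or_nonempty with rfl | ⟨k, hk⟩
      · rcases T.eq_empty_or_nonempty with rfl | ⟨k, hk⟩
        · rw [single_smul, single_smul _ b]
          exact smul_left _ _ _ (smul_right _ _ _ vac_vac)
        · have hc := Finset.card_erase_add_one hk
          rw [← create_annihilate_single hk]
          refine create_right k _ _ (fun l => ?_) (fun m => ?_) ?_
          · simpa [annihilate_single] using zero_left _
          · rw [annihilate_single, if_pos hk, annihilate_single]
            split_ifs with hm
            · exact ih _ (by have := Finset.card_erase_add_one hm; omega) _ _ _ _ rfl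
            · exact zero_right _
          · rw [annihilate_single, if_pos hk, parity_single]
            exact ih _ (by omega) _ _ _ _ rfl
      · have hc := Finset.card_erase_add_one hk
        rw [← create_annihilate_single hk]
        refine create_left k _ _ (fun l => ?_) (fun m => ?_) ?_
        · rw [annihilate_single, if_pos hk, annihilate_single]
          split_ifs with hm
          · exact ih _ (by have := Finset.card_erase_add_one hm; omega) _ _ _ _ rfl
          · exact zero_left _
        · rw [annihilate_single, if_pos hk, annihilate_single]
          split_ifs with hm
          · exact ih _ (by have := Finset.card_erase_add_one hm; omega) _ _ _ _ rfl
          · exact zero_right _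
        · rw [annihilate_single, if_pos hk, parity_single]
          exact ih _ (by omega) _ _ _ _ rfl
  induction x using Finsupp.induction_linear with
  | zero => exact zero_left _
  | add x x' hx hx' => exact add_left _ _ _ hx hx'
  | single S a =>
    induction y using Finsupp.induction_linear with
    | zero => exact zero_right _
    | add y y' hy hy' => exact add_right _ _ _ hy hy'
    | single T b => exact main _ S T a b rfl

/-! ### Stabilization -/

/-- The sequence is eventually constant. -/
def EventuallyConst (f : ℕ → ℂ) : Prop := ∃ v, ∀ᶠ N in atTop, f N = v

theorem EventuallyConst.add {f g : ℕ → ℂ} (hf : EventuallyConst f) (hg : EventuallyConst g) :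
    EventuallyConst fun N => f N + g N := by
  obtain ⟨v, hv⟩ := hf
  obtain ⟨w, hw⟩ := hg
  exact ⟨v + w, by filter_upwards [hv, hw] with N h1 h2 using by rw [h1, h2]⟩

theorem EventuallyConst.const_mul {f : ℕ → ℂ} (hf : EventuallyConst f) (c : ℂ) :
    EventuallyConst fun N => c * f N := by
  obtain ⟨v, hv⟩ := hf
  exact ⟨c * v, by filter_upwards [hv] with N h1 using by rw [h1]⟩

theorem EventuallyConst.sum {κ : Type*} {f : κ → ℕ → ℂ} (hf : ∀ i, EventuallyConst (f i))
    (s : Finset κ) : EventuallyConst fun N => ∑ i ∈ s, f i N := by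
  classical
  induction s using Finset.induction_on with
  | empty => exact ⟨0, by simp⟩
  | insert i s hi ih =>
    simp only [Finset.sum_insert hi]
    exact (hf i).add ih

theorem EventuallyConst.congr {f g : ℕ → ℂ} (hf : EventuallyConst f)
    (h : ∀ᶠ N in atTop, g N = f N) : EventuallyConst g := by
  obtain ⟨v, hv⟩ := hf
  exact ⟨v, by filter_upwards [hv, h] with N h1 h2 using by rw [h2, h1]⟩

/-- All labels of occupied modes are less than `M`. -/
def BoundedBy (M : ℕ) (x : Fock) : Prop := ∀ k ≥ M, annihilate k x = 0

theorem exists_boundedBy (x y : Fock) : ∃ M, BoundedBy M x ∧ BoundedBy M y := by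
  obtain ⟨M, hM⟩ := eventually_annihilate_eq_zero x
  obtain ⟨M', hM'⟩ := eventually_annihilate_eq_zero y
  exact ⟨max M M', fun k hk => hM k (le_trans (le_max_left _ _) hk),
    fun k hk => hM' k (le_trans (le_max_right _ _) hk)⟩

theorem BoundedBy.phiNS_eq_zero {M : ℕ} {x : Fock} (h : BoundedBy M x) (q : ℂ) {l : ℕ}
    (hl : M < l) : phiNS q l x = 0 := by
  rw [phiNS_natCast, LinearMap.smul_apply, h l hl.le, smul_zero]

theorem BoundedBy.phiR_eq_zero {M : ℕ} {x : Fock} (h : BoundedBy M x) (q : ℂ) {l : ℕ}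
    (hl : M < l) : phiR q l x = 0 := by
  obtain ⟨l, rfl⟩ : ∃ l', l = l' + 1 := ⟨l - 1, by omega⟩
  rw [phiR_succ, LinearMap.smul_apply, h l (by omega), smul_zero]

section Truncate

variable {q ι s : ℂ} {Om : FockNS →ₗ[ℂ] FockR →ₗ[ℂ] ℂ} {M : ℕ} {out : FockNS} {inc : FockR}

theorem wickNS_truncate (h : BoundedBy M out) (h' : BoundedBy M inc) (k : ℕ) {M' : ℕ}
    (hM : M ≤ M') : wickNS q ι s Om k (M' + 1) out inc = wickNS q ι s Om k (M + 1) out inc := by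
  have hsub : Finset.range (M + 1) ⊆ Finset.range (M' + 1) := by simpa using hM
  rw [wickNS, wickNS]
  refine congrArg₂ (· + ·) ?_ (congrArg (HMul.hMul _) ?_)
  · refine (Finset.sum_subset hsub fun l _ hl => ?_).symm
    rw [h.phiNS_eq_zero q (not_lt.1 (mt Finset.mem_range.2 hl))]
    simp
  · refine (Finset.sum_subset hsub fun l _ hl => ?_).symm
    rw [h'.phiR_eq_zero q (not_lt.1 (mt Finset.mem_range.2 hl))]
    simp

theorem wickR_truncate (h : BoundedBy M out) (h' : BoundedBy M inc) (k : ℕ) {M' : ℕ}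
    (hM : M ≤ M') : wickR q ι s Om k (M' + 1) out inc = wickR q ι s Om k (M + 1) out inc := by
  have hsub : Finset.range (M + 1) ⊆ Finset.range (M' + 1) := by simpa using hM
  rw [wickR, wickR]
  refine congrArg₂ (· + ·) ?_ (congrArg (HMul.hMul _) ?_)
  · refine (Finset.sum_subset hsub fun l _ hl => ?_).symm
    rw [h'.phiR_eq_zero q (not_lt.1 (mt Finset.mem_range.2 hl))]
    simp
  · refine (Finset.sum_subset hsub fun l _ hl => ?_).symm
    rw [h.phiNS_eq_zero q (not_lt.1 (mt Finset.mem_range.2 hl))]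
    simp

end Truncate

/-! ### Stabilization of the matrix elements and the Wick rules for the limit -/

section Omega

variable {q ι s : ℂ} (hq0 : q ≠ 0) (hq1 : ‖q‖ < 1)
include hq0 hq1

/-- Once N exceeds a bound M on the occupied labels, the Wick rules are sums whose length depends on
M only, with coefficients independent of N and terms that stabilize by induction. -/
theorem eventuallyConst_cutForm (hι : ι ^ 2 = -1) (hs : s ≠ 0) (out : FockNS) (inc : FockR) :
    EventuallyConst fun N => cutForm q ι s N out inc := by
  have hR : ∀ {out inc}, (∀ m, EventuallyConst fun N => cutForm q ι s N out (annihilate m inc)) →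
      (EventuallyConst fun N => cutForm q ι s N out (parity inc)) →
      ∀ m : ℕ, EventuallyConst fun N => cutForm q ι s N out (phiR q m inc) := by
    intro out inc h h' m
    cases m with
    | zero => exact h'
    | succ m =>
      simp only [phiR_succ, LinearMap.smul_apply, map_smul, smul_eq_mul]
      exact (h m).const_mul _
  have hNS : ∀ {out inc}, (∀ m, EventuallyConst fun N => cutForm q ι s N (annihilate m out) inc) →
      ∀ m : ℕ, EventuallyConst fun N => cutForm q ι s N (phiNS q m out) inc := by
    intro out inc h m
    simp only [phiNS_natCast, LinearMap.smul_apply, map_smul, smul_eq_mul]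
    exact (h m).const_mul _
  refine fock_pair_induction (P := fun out inc => EventuallyConst fun N => cutForm q ι s N out inc)
    (fun _ => ⟨0, by simp⟩) (fun _ => ⟨0, by simp⟩)
    (fun x x' y h h' => by simpa only [map_add, LinearMap.add_apply] using h.add h')
    (fun x x' y h h' => by simpa only [map_add] using h.add h')
    (fun c x y h => by simpa only [map_smul, LinearMap.smul_apply, smul_eq_mul] using h.const_mul c)
    (fun c x y h => by simpa only [map_smul, smul_eq_mul] using h.const_mul c)
    ⟨1, by simp [cutForm_vac_vac hq0 hq1]⟩ (fun k x y h1 h2 h3 => ?_) (fun k x y h1 h2 h3 => ?_)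
    out inc
  · obtain ⟨M, hx, hy⟩ := exists_boundedBy x y
    have h4 : EventuallyConst fun N => wickNS q ι s (cutForm q ι s N) k (M + 1) x y :=
      (EventuallyConst.sum (fun l => (hNS h1 l).const_mul _) _).add
        ((EventuallyConst.sum (fun l => (hR h2 h3 l).const_mul _) _).const_mul _)
    refine h4.congr ?_
    filter_upwards [eventually_ge_atTop M, eventually_ge_atTop k] with N hN hk
    rw [cutForm_create_left hq0 hq1 hι hs hk, wickNS_truncate hx hy k hN]
  · obtain ⟨M, hx, hy⟩ := exists_boundedBy x y
    have h4 : EventuallyConst fun N => wickR q ι s (cutForm q ι s N) k (M + 1) x y :=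
      (EventuallyConst.sum (fun l => (hR h2 h3 l).const_mul _) _).add
        ((EventuallyConst.sum (fun l => (hNS h1 l).const_mul _) _).const_mul _)
    refine h4.congr ?_
    filter_upwards [eventually_ge_atTop M, eventually_gt_atTop k] with N hN hk
    rw [cutForm_create_right hq0 hq1 hι hs hk, wickR_truncate hx hy k hN]

theorem cutForm_eventually_eq (hι : ι ^ 2 = -1) (hs : s ≠ 0) (out : FockNS) (inc : FockR) :
    ∀ᶠ N in atTop, cutForm q ι s N out inc = OmegaRNS q ι s out inc := by
  induction out using Finsupp.induction_linear with
  | zero => simp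
  | add x x' hx hx' =>
    filter_upwards [hx, hx'] with N h1 h2
    simp only [map_add, LinearMap.add_apply, h1, h2]
  | single S a =>
    induction inc using Finsupp.induction_linear with
    | zero => simp
    | add x x' hx hx' =>
      filter_upwards [hx, hx'] with N h1 h2
      simp only [map_add, h1, h2]
    | single T b =>
      obtain ⟨v, hv⟩ := eventuallyConst_cutForm hq0 hq1 hι hs (Finsupp.single S 1)
        (Finsupp.single T 1)
      have hlim : (limUnder atTop fun N =>
          cutRNS q ι s N (Finsupp.single S 1) (Finsupp.single T 1)) = v :=
        (tendsto_const_nhds.congr' (hv.mono fun N h => h.symm)).limUnder_eq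
      filter_upwards [hv] with N hN
      have hS : (Finsupp.single S a : Fock) = a • Finsupp.single S 1 := by simp
      have hT : (Finsupp.single T b : Fock) = b • Finsupp.single T 1 := by simp
      rw [hS, hT]
      simp only [map_smul, LinearMap.smul_apply, hN]
      simp only [OmegaRNS, Finsupp.linearCombination_single, one_smul, hlim]

theorem OmegaRNS_vac_vac (hι : ι ^ 2 = -1) (hs : s ≠ 0) : OmegaRNS q ι s vac vac = 1 := by
  obtain ⟨N, hN⟩ := (cutForm_eventually_eq hq0 hq1 hι hs vac vac).exists
  rw [← hN, cutForm_vac_vac hq0 hq1]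

theorem wickNS_eventually_eq (hι : ι ^ 2 = -1) (hs : s ≠ 0) (k M : ℕ) (out : FockNS)
    (inc : FockR) : ∀ᶠ N in atTop, wickNS q ι s (cutForm q ι s N) k M out inc =
      wickNS q ι s (OmegaRNS q ι s) k M out inc := by
  have h1 : ∀ᶠ N in atTop, ∀ l ∈ Finset.range M, cutForm q ι s N (phiNS q l out) inc =
      OmegaRNS q ι s (phiNS q l out) inc :=
    (Filter.eventually_all_finset _).2 fun l _ => cutForm_eventually_eq hq0 hq1 hι hs _ _
  have h2 : ∀ᶠ N in atTop, ∀ l ∈ Finset.range M, cutForm q ι s N out (phiR q l inc) =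
      OmegaRNS q ι s out (phiR q l inc) :=
    (Filter.eventually_all_finset _).2 fun l _ => cutForm_eventually_eq hq0 hq1 hι hs _ _
  filter_upwards [h1, h2] with N h1 h2
  rw [wickNS, wickNS]
  refine congrArg₂ (· + ·) ?_ (congrArg (HMul.hMul _) ?_)
  · exact Finset.sum_congr rfl fun l hl => by rw [h1 l hl]
  · exact Finset.sum_congr rfl fun l hl => by rw [h2 l hl]

theorem wickR_eventually_eq (hι : ι ^ 2 = -1) (hs : s ≠ 0) (k M : ℕ) (out : FockNS)
    (inc : FockR) : ∀ᶠ N in atTop, wickR q ι s (cutForm q ι s N) k M out inc =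
      wickR q ι s (OmegaRNS q ι s) k M out inc := by
  have h1 : ∀ᶠ N in atTop, ∀ l ∈ Finset.range M, cutForm q ι s N (phiNS q l out) inc =
      OmegaRNS q ι s (phiNS q l out) inc :=
    (Filter.eventually_all_finset _).2 fun l _ => cutForm_eventually_eq hq0 hq1 hι hs _ _
  have h2 : ∀ᶠ N in atTop, ∀ l ∈ Finset.range M, cutForm q ι s N out (phiR q l inc) =
      OmegaRNS q ι s out (phiR q l inc) :=
    (Filter.eventually_all_finset _).2 fun l _ => cutForm_eventually_eq hq0 hq1 hι hs _ _
  filter_upwards [h1, h2] with N h1 h2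
  rw [wickR, wickR]
  refine congrArg₂ (· + ·) ?_ (congrArg (HMul.hMul _) ?_)
  · exact Finset.sum_congr rfl fun l hl => by rw [h2 l hl]
  · exact Finset.sum_congr rfl fun l hl => by rw [h1 l hl]

theorem OmegaRNS_create_left (hι : ι ^ 2 = -1) (hs : s ≠ 0) {M : ℕ} {out : FockNS} {inc : FockR}
    (hx : BoundedBy M out) (hy : BoundedBy M inc) (k : ℕ) :
    OmegaRNS q ι s (create k out) inc = wickNS q ι s (OmegaRNS q ι s) k (M + 1) out inc := by
  obtain ⟨N, h1, h2, hN, hk⟩ := ((cutForm_eventually_eq hq0 hq1 hι hs (create k out) inc).and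
    ((wickNS_eventually_eq hq0 hq1 hι hs k (M + 1) out inc).and
      ((eventually_ge_atTop M).and (eventually_ge_atTop k)))).exists
  rw [← h1, ← h2, cutForm_create_left hq0 hq1 hι hs hk, wickNS_truncate hx hy k hN]

theorem OmegaRNS_create_right (hι : ι ^ 2 = -1) (hs : s ≠ 0) {M : ℕ} {out : FockNS}
    {inc : FockR} (hx : BoundedBy M out) (hy : BoundedBy M inc) (i : ℕ) :
    OmegaRNS q ι s out (create i inc) = wickR q ι s (OmegaRNS q ι s) i (M + 1) out inc := by
  obtain ⟨N, h1, h2, hN, hk⟩ := ((cutForm_eventually_eq hq0 hq1 hι hs out (create i inc)).and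
    ((wickR_eventually_eq hq0 hq1 hι hs i (M + 1) out inc).and
      ((eventually_ge_atTop M).and (eventually_gt_atTop i)))).exists
  rw [← h1, ← h2, cutForm_create_right hq0 hq1 hι hs hk, wickR_truncate hx hy i hN]

end Omega

/-! ### The duality between the two emission operators -/

theorem grassDual_mul_grassDual (i j : ℕ ⊕ ℕ) :
    grassDual i * grassDual j = -(grassDual j * grassDual i) := by
  refine TensorProduct.ext' fun r v => ?_
  rcases i with i | i <;> rcases j with j | j <;>
    simp only [grassDual, Sum.elim_inl, Sum.elim_inr, Module.End.mul_apply, LinearMap.neg_apply,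
      createR_tmul, annihilateNS_tmul]
  · rw [annihilate_annihilate, TensorProduct.tmul_neg]
  · rw [parity_annihilate, TensorProduct.tmul_neg, neg_neg]
  · rw [parity_annihilate, TensorProduct.tmul_neg]
  · rw [create_create, TensorProduct.neg_tmul]

/-- The relations are symmetric under exchange of the operators with their conjugates, so nilpotency
of Y follows from the general statement as well. -/
theorem grassmannSystem_dual : GrassmannSystem grassDual grass parityRNS where
  anticomm := grassDual_mul_grassDual
  dual_mul i j := by
    rw [grassDual_mul_grass j i]
    simp only [eq_comm (a := j)]
    exact (sub_sub_cancel _ _).symm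
  parity_mul := parityRNS_mul_grassDual
  parity_mul_dual := parityRNS_mul_grass
  parity_sq := parityRNS_mul_self

theorem liftNS_natCast (q : ℂ) (k : ℕ) :
    liftNS q k = eta q (2 * k + 1) • annihilateNS k :=
  TensorProduct.map_smul_right _ _ _

theorem varphiNSpos_eq (q ι : ℂ) (k : ℕ) : varphiNSpos q ι k =
    (gam q k * q ^ (-3 * (k : ℤ) - 2) / eta q (2 * k + 1) * (-ι) * eta q (2 * k + 1)) •
      annihilateNS k := by
  rw [varphiNSpos, liftNS_natCast, smul_smul]

theorem varphiRneg_succ (q : ℂ) (m : ℕ) : varphiRneg q (m + 1) =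
    (gam q (m + 1) * q ^ (5 * (m + 1)) / eta q (2 * (m + 1 : ℕ))) • createR m := by
  rw [varphiRneg, if_neg (by omega)]
  rfl

theorem scaled_grassDual (q ι : ℂ) : ∃ t : ℕ ⊕ ℕ → ℂ,
    (Sum.elim (varphiNSpos q ι) fun m => varphiRneg q (m + 1)) = fun i => t i • grassDual i := by
  refine ⟨Sum.elim (fun k => gam q k * q ^ (-3 * (k : ℤ) - 2) / eta q (2 * k + 1) * (-ι) *
    eta q (2 * k + 1)) fun m => gam q (m + 1) * q ^ (5 * (m + 1)) / eta q (2 * (m + 1 : ℕ)), ?_⟩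
  funext i
  rcases i with i | i
  · exact varphiNSpos_eq q ι i
  · exact varphiRneg_succ q i

theorem varphiRneg_mul_varphiNSpos (q ι : ℂ) (m k : ℕ) :
    varphiRneg q m * varphiNSpos q ι k = -(varphiNSpos q ι k * varphiRneg q m) := by
  rw [varphiNSpos_eq]
  cases m with
  | zero =>
    have h : parityRNS * annihilateNS k = -(annihilateNS k * parityRNS) :=
      parityRNS_mul_grassDual (Sum.inl k)
    rw [show varphiRneg q 0 = parityRNS from rfl, mul_smul_comm, smul_mul_assoc, h]
    exact smul_neg _ _
  | succ m =>
    have h : createR m * annihilateNS k = -(annihilateNS k * createR m) :=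
      grassDual_mul_grassDual (Sum.inr m) (Sum.inl k)
    rw [varphiRneg_succ, smul_mul_smul_comm, smul_mul_smul_comm, h, mul_comm]
    exact smul_neg _ _

theorem isNilpotent_expY (q ι s : ℂ) (N : ℕ) : IsNilpotent (expY q ι s N) := by
  obtain ⟨t, ht⟩ := scaled_grassDual q ι
  have h := sum_eq_mixedForm (varphiNSpos q ι) (varphiRneg q) (fun i j => by
    rw [ht, smul_mul_smul_comm, smul_mul_smul_comm, grassmannSystem_dual.anticomm,
      smul_neg, mul_comm (t i)])
    (c₁ := fun k l => -(coeffX q (2 * k + 1) (2 * l + 1) * s ^ (2 * (-(k : ℤ) - l - 1))))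
    (c₂ := fun m n => -(coeffX q (2 * m) (2 * n) * s ^ (2 * ((m : ℤ) + n))))
    (c₃ := fun k m => coeffX q (2 * m) (-(2 * k) - 1) * s ^ (2 * (m : ℤ) - 2 * k - 1))
    (fun k l => by
      rw [coeffX_antisymm, show -(k : ℤ) - l - 1 = -(l : ℤ) - k - 1 by ring]
      ring)
    (fun k l => by
      rw [coeffX_antisymm, add_comm (k : ℤ) l]
      ring) N
  rw [ht, mixedForm_smul] at h
  refine (congrArg IsNilpotent (Eq.trans ?_ h)).mpr ?_
  · rw [Finset.sum_comm (s := Finset.range (N + 1)) (t := Finset.range (N + 1))]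
    have h3 : ∀ (c : ℂ) (k m : ℕ), c • (varphiNSpos q ι k * varphiRneg q m) =
        -(c • (varphiRneg q m * varphiNSpos q ι k)) := by
      intro c k m
      rw [varphiRneg_mul_varphiNSpos]
      module
    simp only [neg_smul, h3, Finset.sum_neg_distrib]
    rw [expY, sub_neg_eq_add]
    abel
  · exact grassmannSystem_dual.isNilpotent_mixedForm _ _ _

/-- The bilinear form on the tensor product. -/
def formRNS (q : ℂ) : FockRNS →ₗ[ℂ] FockRNS →ₗ[ℂ] ℂ :=
  TensorProduct.lift (LinearMap.mk₂ ℂ (braRNS q)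
    (fun _ _ _ => by simp [braRNS, TensorProduct.map_add_left, LinearMap.comp_add])
    (fun _ _ _ => by simp [braRNS, TensorProduct.map_smul_left, LinearMap.comp_smul])
    (fun _ _ _ => by simp [braRNS, TensorProduct.map_add_right, LinearMap.comp_add])
    (fun _ _ _ => by simp [braRNS, TensorProduct.map_smul_right, LinearMap.comp_smul]))

theorem formRNS_tmul (q : ℂ) (r v r' v' : Fock) :
    formRNS q (r ⊗ₜ v) (r' ⊗ₜ v') = pairR q r r' * pairNS q v v' := rfl

theorem formRNS_comm (q : ℂ) (x y : FockRNS) : formRNS q x y = formRNS q y x := by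
  induction x using TensorProduct.induction_on with
  | zero => simp
  | add x x' hx hx' => simp only [map_add, LinearMap.add_apply, hx, hx']
  | tmul r v =>
    induction y using TensorProduct.induction_on with
    | zero => simp
    | add y y' hy hy' => simp only [map_add, LinearMap.add_apply, hy, hy']
    | tmul r' v' =>
      rw [formRNS_tmul, formRNS_tmul, pairR, pairNS, pairing_comm, pairing_comm _ v]

/-- The operators `f` and `f'` are adjoint with respect to `formRNS`. -/
def IsAdjointRNS (q : ℂ) (f f' : Module.End ℂ FockRNS) : Prop :=
  ∀ x y, formRNS q (f x) y = formRNS q x (f' y)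

theorem isAdjointRNS_map {q : ℂ} {f f' g g' : Fock →ₗ[ℂ] Fock}
    (hf : ∀ x y, pairR q (f x) y = pairR q x (f' y))
    (hg : ∀ x y, pairNS q (g x) y = pairNS q x (g' y)) :
    IsAdjointRNS q (TensorProduct.map f g) (TensorProduct.map f' g') := by
  intro x y
  induction x using TensorProduct.induction_on with
  | zero => simp
  | add x x' hx hx' => simp only [map_add, LinearMap.add_apply, hx, hx']
  | tmul r v =>
    induction y using TensorProduct.induction_on with
    | zero => simp
    | add y y' hy hy' => simp only [map_add, hy, hy']
    | tmul r' v' =>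
      rw [TensorProduct.map_tmul, TensorProduct.map_tmul, formRNS_tmul, formRNS_tmul, hf, hg]

namespace IsAdjointRNS

variable {q : ℂ} {f f' g g' : Module.End ℂ FockRNS}

theorem add (hf : IsAdjointRNS q f f') (hg : IsAdjointRNS q g g') :
    IsAdjointRNS q (f + g) (f' + g') := fun x y => by
  simp only [LinearMap.add_apply, map_add, hf x y, hg x y]

theorem smul (hf : IsAdjointRNS q f f') (c : ℂ) : IsAdjointRNS q (c • f) (c • f') := fun x y => by
  simp only [LinearMap.smul_apply, map_smul, hf x y]

theorem neg (hf : IsAdjointRNS q f f') : IsAdjointRNS q (-f) (-f') := fun x y => by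
  simp only [LinearMap.neg_apply, map_neg, hf x y]

theorem mul (hf : IsAdjointRNS q f f') (hg : IsAdjointRNS q g g') :
    IsAdjointRNS q (f * g) (g' * f') := fun x y => by
  rw [Module.End.mul_apply, hf, hg, Module.End.mul_apply]

theorem pow (hf : IsAdjointRNS q f f') (n : ℕ) : IsAdjointRNS q (f ^ n) (f' ^ n) := by
  induction n with
  | zero => exact fun x y => rfl
  | succ n ih => rw [pow_succ, pow_succ']; exact ih.mul hf

theorem sum {κ : Type*} {F F' : κ → Module.End ℂ FockRNS} (s : Finset κ)
    (h : ∀ i ∈ s, IsAdjointRNS q (F i) (F' i)) :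
    IsAdjointRNS q (∑ i ∈ s, F i) (∑ i ∈ s, F' i) := fun x y => by
  simp only [LinearMap.sum_apply, map_sum]
  exact Finset.sum_congr rfl fun i hi => h i hi x y

theorem exp (h : IsAdjointRNS q f f') (hf : IsNilpotent f) (hf' : IsNilpotent f') :
    IsAdjointRNS q (IsNilpotent.exp f) (IsNilpotent.exp f') := by
  obtain ⟨k, hk⟩ := hf
  obtain ⟨k', hk'⟩ := hf'
  rw [IsNilpotent.exp_eq_sum (pow_eq_zero_of_le (le_max_left k k') hk),
    IsNilpotent.exp_eq_sum (pow_eq_zero_of_le (le_max_right k k') hk')]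
  refine sum _ fun i _ x y => ?_
  simp only [LinearMap.smul_apply, map_rat_smul, h.pow i x y]

end IsAdjointRNS

theorem isAdjointRNS_annihilateNS (q : ℂ) (k : ℕ) :
    IsAdjointRNS q (eta q (2 * k + 1) • annihilateNS k) (createNS k) := by
  rw [← liftNS_natCast]
  refine isAdjointRNS_map (fun _ _ => rfl) fun x y => ?_
  rw [phiNS_natCast, LinearMap.smul_apply, map_smul, LinearMap.smul_apply, smul_eq_mul]
  exact pairing_annihilate (fun k => eta q (2 * (k : ℤ) + 1)) k x y

theorem isAdjointRNS_createR (q : ℂ) (k : ℕ) :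
    IsAdjointRNS q (createR k) (eta q (2 * (k + 1)) • annihilateR k) := by
  rw [← liftR_succ]
  refine isAdjointRNS_map (fun x y => ?_) (pairing_parity _)
  rw [phiR_succ, LinearMap.smul_apply, map_smul]
  exact pairing_create _ k x y

theorem isAdjointRNS_parityRNS (q : ℂ) : IsAdjointRNS q parityRNS parityRNS :=
  isAdjointRNS_map (pairing_parity _) (pairing_parity _)

/-- The square root of `z` for which `Y'` is adjoint to `Y` at `s`. -/
def dualRoot (q s : ℂ) : ℂ := -(q ^ 4 * s)⁻¹

section Dual

variable {q : ℂ} (hq0 : q ≠ 0) (hq1 : ‖q‖ < 1)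
include hq0

/-- The factor is -(q⁸)^{-(k+1/2)}; for the Ramond mode -m it is (q⁸)^m. A factor geometric in the
mode number can be absorbed into z, which dictates `dualRoot`. -/
theorem isAdjointRNS_varphiNSpos (ι : ℂ) (k : ℕ) :
    IsAdjointRNS q (varphiNSpos q ι k) ((-(q ^ (8 * k + 4))⁻¹) • varphiNSneg q ι k) := by
  have h := (isAdjointRNS_annihilateNS q k).smul
    (gam q k * q ^ (-3 * (k : ℤ) - 2) / eta q (2 * k + 1) * (-ι))
  rw [varphiNSneg_eq, smul_smul]
  rw [varphiNSpos, liftNS_natCast]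
  convert h using 2
  have h1 : q ^ (-3 * (k : ℤ) - 2) = (q ^ (8 * k + 4))⁻¹ * q ^ (5 * k + 2) := by
    rw [eq_inv_mul_iff_mul_eq₀ (pow_ne_zero _ hq0), ← zpow_natCast, ← zpow_natCast, ← zpow_add₀ hq0]
    congr 1
    push_cast
    ring
  rw [h1, coefNS]
  ring

include hq1 in
theorem isAdjointRNS_varphiRneg (m : ℕ) :
    IsAdjointRNS q (varphiRneg q m) (q ^ (8 * m) • varphiRpos q m) := by
  cases m with
  | zero =>
    rw [varphiRpos_zero, mul_zero, pow_zero, one_smul]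
    exact isAdjointRNS_parityRNS q
  | succ m =>
    have h := (isAdjointRNS_createR q m).smul
      (gam q (m + 1) * q ^ (5 * (m + 1)) / eta q (2 * (m + 1 : ℕ)))
    have h0 := eta_R_ne_zero hq0 hq1 m
    rw [varphiRneg_succ, varphiRpos_succ hq0 hq1, smul_smul]
    rw [smul_smul] at h
    convert h using 2
    push_cast
    rw [div_mul_cancel₀ _ h0, coefR_eq]
    field_simp
    ring

include hq1 in
theorem varphiRpos_mul_varphiRpos {m n : ℕ} (h : n < m) :
    varphiRpos q n * varphiRpos q m = -(varphiRpos q m * varphiRpos q n) := by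
  obtain ⟨m, rfl⟩ : ∃ m', m = m' + 1 := ⟨m - 1, by omega⟩
  rw [varphiRpos_succ hq0 hq1]
  cases n with
  | zero =>
    have h : parityRNS * annihilateR m = -(annihilateR m * parityRNS) :=
      parityRNS_mul_grass (Sum.inr m)
    rw [varphiRpos_zero, mul_smul_comm, smul_mul_assoc, h]
    exact smul_neg _ _
  | succ n =>
    have h : annihilateR n * annihilateR m = -(annihilateR m * annihilateR n) :=
      grass_mul_grass (Sum.inr n) (Sum.inr m)
    rw [varphiRpos_succ hq0 hq1, smul_mul_smul_comm, smul_mul_smul_comm, h, mul_comm]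
    exact smul_neg _ _

omit hq0 in
theorem varphiNSneg_mul_varphiNSneg (ι : ℂ) (k l : ℕ) :
    varphiNSneg q ι l * varphiNSneg q ι k = -(varphiNSneg q ι k * varphiNSneg q ι l) := by
  have h : createNS l * createNS k = -(createNS k * createNS l) :=
    grass_mul_grass (Sum.inl l) (Sum.inl k)
  rw [varphiNSneg_eq, varphiNSneg_eq, smul_mul_smul_comm, smul_mul_smul_comm, h, mul_comm]
  exact smul_neg _ _

omit hq0 in
theorem dualRoot_zpow (s : ℂ) (a : ℤ) :
    dualRoot q s ^ a = (-1) ^ a * (q ^ (4 * a))⁻¹ * s ^ (-a) := by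
  rw [dualRoot, neg_eq_neg_one_mul, mul_inv, mul_zpow, mul_zpow, inv_zpow, inv_zpow, zpow_neg,
    zpow_mul, mul_assoc]
  norm_cast

include hq1 in
-- Taking adjoints reverses products. In the same-sector terms reordering costs a sign, which turns
-- the minus signs of Y into the plus signs of Y'; the mixed terms come out in the right order.
theorem isAdjointRNS_expY (ι : ℂ) {s : ℂ} (hs : s ≠ 0) (N : ℕ) :
    IsAdjointRNS q (expY q ι s N) (expY' q ι (dualRoot q s) N) := by
  have h1 : IsAdjointRNS q (∑ m ∈ Finset.range (N + 1), ∑ n ∈ Finset.range m,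
      (coeffX q (2 * m) (2 * n) * s ^ (2 * ((m : ℤ) + n))) • (varphiRneg q m * varphiRneg q n))
      (∑ m ∈ Finset.range (N + 1), ∑ n ∈ Finset.range m,
      -((coeffX q (2 * m) (2 * n) * dualRoot q s ^ (2 * (-(m : ℤ) - n))) •
        (varphiRpos q m * varphiRpos q n))) := by
    refine IsAdjointRNS.sum _ fun m _ => IsAdjointRNS.sum _ fun n hn => ?_
    have h := ((isAdjointRNS_varphiRneg hq0 hq1 m).mul (isAdjointRNS_varphiRneg hq0 hq1 n)).smul
      (coeffX q (2 * m) (2 * n) * s ^ (2 * ((m : ℤ) + n)))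
    rw [smul_mul_smul_comm, varphiRpos_mul_varphiRpos hq0 hq1 (Finset.mem_range.1 hn),
      smul_smul] at h
    convert h using 1
    refine Eq.trans ?_ (smul_neg _ _).symm
    congr 2
    rw [dualRoot_zpow, zpow_mul, show -(2 * (-(m : ℤ) - n)) = 2 * ((m : ℤ) + n) by ring,
      show 4 * (2 * (-(m : ℤ) - n)) = -((8 * n + 8 * m : ℕ) : ℤ) by push_cast; ring, zpow_neg,
      inv_inv, zpow_natCast, pow_add]
    norm_num
    ring
  have h2 : IsAdjointRNS q (∑ k ∈ Finset.range (N + 1), ∑ l ∈ Finset.range k,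
      (coeffX q (2 * k + 1) (2 * l + 1) * s ^ (2 * (-(k : ℤ) - l - 1))) •
        (varphiNSpos q ι k * varphiNSpos q ι l)) (∑ k ∈ Finset.range (N + 1),
        ∑ l ∈ Finset.range k,
      -((coeffX q (2 * k + 1) (2 * l + 1) * dualRoot q s ^ (2 * ((k : ℤ) + l + 1))) •
        (varphiNSneg q ι k * varphiNSneg q ι l))) := by
    refine IsAdjointRNS.sum _ fun k _ => IsAdjointRNS.sum _ fun l _ => ?_
    have h := ((isAdjointRNS_varphiNSpos hq0 ι k).mul (isAdjointRNS_varphiNSpos hq0 ι l)).smul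
      (coeffX q (2 * k + 1) (2 * l + 1) * s ^ (2 * (-(k : ℤ) - l - 1)))
    rw [smul_mul_smul_comm, varphiNSneg_mul_varphiNSneg, smul_smul] at h
    convert h using 1
    refine Eq.trans ?_ (smul_neg _ _).symm
    congr 2
    rw [dualRoot_zpow, zpow_mul,
      show -(2 * ((k : ℤ) + l + 1)) = 2 * (-(k : ℤ) - l - 1) by ring,
      show 4 * (2 * ((k : ℤ) + l + 1)) = ((8 * k + 4 + (8 * l + 4) : ℕ) : ℤ) by push_cast; ring,
      zpow_natCast, pow_add, mul_inv]
    norm_num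
    ring
  have h3 : IsAdjointRNS q (∑ m ∈ Finset.range (N + 1), ∑ k ∈ Finset.range (N + 1),
      (coeffX q (2 * m) (-(2 * k) - 1) * s ^ (2 * (m : ℤ) - 2 * k - 1)) •
        (varphiRneg q m * varphiNSpos q ι k)) (∑ m ∈ Finset.range (N + 1),
      ∑ k ∈ Finset.range (N + 1),
      -((coeffX q (-(2 * k) - 1) (2 * m) * dualRoot q s ^ (2 * (k : ℤ) - 2 * m + 1)) •
        (varphiNSneg q ι k * varphiRpos q m))) := by
    refine IsAdjointRNS.sum _ fun m _ => IsAdjointRNS.sum _ fun k _ => ?_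
    have h := ((isAdjointRNS_varphiRneg hq0 hq1 m).mul (isAdjointRNS_varphiNSpos hq0 ι k)).smul
      (coeffX q (2 * m) (-(2 * k) - 1) * s ^ (2 * (m : ℤ) - 2 * k - 1))
    rw [smul_mul_smul_comm, smul_smul] at h
    convert h using 1
    refine (neg_smul _ _).symm.trans ?_
    congr 1
    -- Only the mixed terms contain an odd power of the root, so only they see the sign chosen in
    -- `dualRoot`.
    have h4 : (-1 : ℂ) ^ (2 * (k : ℤ) - 2 * m + 1) = -1 := by
      rw [zpow_add₀ (by norm_num), zpow_sub₀ (by norm_num), zpow_mul, zpow_mul]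
      norm_num
    rw [dualRoot_zpow, h4, coeffX_antisymm,
      show -(2 * (k : ℤ) - 2 * m + 1) = 2 * (m : ℤ) - 2 * k - 1 by ring,
      show 4 * (2 * (k : ℤ) - 2 * m + 1) = ((8 * k + 4 : ℕ) : ℤ) - ((8 * m : ℕ) : ℤ) by
        push_cast; ring, zpow_sub₀ hq0, zpow_natCast, zpow_natCast]
    have := pow_ne_zero (8 * m) hq0
    have := pow_ne_zero (8 * k + 4) hq0
    field_simp
  have h := (h1.neg.add h2.neg).add h3
  rw [Finset.sum_comm (s := Finset.range (N + 1)) (t := Finset.range (N + 1)) (f := fun m k =>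
    -((coeffX q (-(2 * k) - 1) (2 * m) * dualRoot q s ^ (2 * (k : ℤ) - 2 * m + 1)) •
        (varphiNSneg q ι k * varphiRpos q m)))] at h
  simp only [Finset.sum_neg_distrib, neg_neg] at h
  convert h using 1
  · exact congrArg (· + _) (sub_eq_add_neg _ _)
  · refine (sub_eq_add_neg _ _).trans ?_
    exact congrArg (· + _) (add_comm _ _)

omit hq0 in
theorem dualRoot_ne_zero (hq0 : q ≠ 0) {s : ℂ} (hs : s ≠ 0) : dualRoot q s ≠ 0 :=
  neg_ne_zero.2 (inv_ne_zero (mul_ne_zero (pow_ne_zero _ hq0) hs))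

include hq1 in
theorem cutNSR_eq (ι : ℂ) {s : ℂ} (hs : s ≠ 0) (N : ℕ) (out : FockR) (inc : FockNS) :
    cutNSR q ι s N out inc = cutForm q ι (dualRoot q s) N inc out := by
  have h := (isAdjointRNS_expY hq0 hq1 ι hs N).exp (isNilpotent_expY q ι s N)
    (isNilpotent_expY' hq0 hq1 ι (dualRoot q s) N) (vac ⊗ₜ inc) (out ⊗ₜ vac)
  rw [formRNS_comm] at h
  exact h

include hq1 in
theorem OmegaNSR_eq (ι : ℂ) {s : ℂ} (hs : s ≠ 0) (out : FockR) (inc : FockNS) :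
    OmegaNSR q ι s out inc = OmegaRNS q ι (dualRoot q s) inc out := by
  have h : OmegaNSR q ι s = (OmegaRNS q ι (dualRoot q s)).flip := by
    refine Finsupp.lhom_ext' fun S => LinearMap.ext_ring ?_
    refine Finsupp.lhom_ext' fun T => LinearMap.ext_ring ?_
    simp only [LinearMap.comp_apply, Finsupp.lsingle_apply, LinearMap.flip_apply, OmegaNSR,
      OmegaRNS, Finsupp.linearCombination_single, one_smul, cutNSR_eq hq0 hq1 ι hs]
    rfl
  rw [h, LinearMap.flip_apply]

end Dual

/-! ### Generating functions -/

theorem hasSum_of_eq {κ : Type*} {f g : κ → ℂ} {a b : ℂ} (h : HasSum f a)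
    (hf : ∀ n, g n = f n) (hb : b = a) : HasSum g b := by
  rwa [funext hf, hb]

/-- Coefficients of the Laurent series at infinity that has a given factor and starts with
`w ^ (l + 1)`. -/
def laurentF (q x : ℂ) (l : ℕ) (n : ℤ) : ℂ :=
  ∑ j ∈ Finset.range (l + 1), gamInv q (l - j) * x ^ (l - j) *
    (gamZ q (n + j + 1) * x ^ (n + j + 1))

/-- Coefficients of the Laurent series at infinity that has a given factor and starts with
`w ^ 0`. -/
def laurentH (q x y : ℂ) (m : ℕ) (n : ℤ) : ℂ :=
  ∑ j ∈ Finset.range (m + 1), gamInv q (m - j) * y ^ (m - j) * (gamZ q (n - j) * x ^ (n - j))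

/-- The polynomial part of the solutions. -/
def laurentPoly (q y : ℂ) (m : ℕ) (v : ℂ) : ℂ :=
  ∑ j ∈ Finset.range (m + 1), gamInv q (m - j) * y ^ (m - j) * v ^ j

section Laurent

variable {q : ℂ} (hq0 : q ≠ 0) (hq1 : ‖q‖ < 1)
include hq0 hq1

theorem laurentF_natCast {x : ℂ} (l k : ℕ) : laurentF q x l k = x ^ (k + l + 1) * kerF q k l := by
  rw [← sum_gamInv_mul_gam_add hq0 hq1, Finset.mul_sum, laurentF]
  refine Finset.sum_congr rfl fun j hj => ?_
  have hj := Finset.mem_range.1 hj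
  rw [show (k : ℤ) + j + 1 = ((k + 1 + j : ℕ) : ℤ) by push_cast; ring, gamZ_natCast, zpow_natCast,
    show k + l + 1 = (l - j) + (k + 1 + j) by omega, pow_add]
  ring

/-- γ(x/w) times the part of w^{l+1}/γ(x/w) in positive powers of w is w^{l+1} plus nonpositive
powers of w. On coefficients this is the convolution identity for γ and 1/γ. -/
theorem laurentF_neg {x : ℂ} (l k : ℕ) : laurentF q x l (-k - 1) = if l = k then 1 else 0 := by
  rw [laurentF]
  rcases lt_or_ge l k with h | h
  · rw [if_neg h.ne, Finset.sum_eq_zero]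
    intro j hj
    have hj := Finset.mem_range.1 hj
    rw [gamZ_of_neg (by omega)]
    ring
  · obtain ⟨d, rfl⟩ := Nat.exists_eq_add_of_le h
    rw [add_assoc, Finset.sum_range_add, Finset.sum_eq_zero, zero_add]
    · have h1 := sum_gamInv_mul_gam hq0 hq1 d
      have h2 : (if k + d = k then (1 : ℂ) else 0) = x ^ d * if d = 0 then 1 else 0 := by
        by_cases hd : d = 0 <;> simp [hd]
      rw [h2, ← h1, Finset.mul_sum]
      refine Finset.sum_congr rfl fun j hj => ?_
      have hj := Finset.mem_range.1 hj
      rw [show -(k : ℤ) - 1 + ((k + j : ℕ) : ℤ) + 1 = (j : ℤ) by push_cast; ring, gamZ_natCast,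
        zpow_natCast, show k + d - (k + j) = d - j by omega,
        show x ^ d = x ^ (d - j) * x ^ j by rw [← pow_add]; congr 1; omega]
      ring
    · intro j hj
      have hj := Finset.mem_range.1 hj
      rw [gamZ_of_neg (by omega)]
      ring

theorem laurentH_natCast {x y : ℂ} (hxy : x * y = q ^ 2) (m k : ℕ) :
    laurentH q x y m k = x ^ k * y ^ m * kerH q k m := by
  have hx : x ≠ 0 := left_ne_zero_of_mul (hxy ▸ pow_ne_zero 2 hq0)
  have hy : y ≠ 0 := right_ne_zero_of_mul (hxy ▸ pow_ne_zero 2 hq0)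
  rw [← sum_gamInv_mul_gam_sub hq0 hq1, Finset.mul_sum, laurentH]
  refine Finset.sum_congr rfl fun j hj => ?_
  have hj := Finset.mem_range.1 hj
  rw [zpow_sub₀ hx, zpow_natCast, zpow_natCast, ← hxy, mul_pow,
    show y ^ m = y ^ (m - j) * y ^ j by rw [← pow_add]; congr 1; omega]
  have := pow_ne_zero j hx
  have := pow_ne_zero j hy
  field_simp

omit hq0 hq1 in
theorem laurentH_neg {x y : ℂ} (m k : ℕ) : laurentH q x y m (-k - 1) = 0 := by
  rw [laurentH, Finset.sum_eq_zero]
  intro j hj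
  rw [gamZ_of_neg (by omega)]
  ring

theorem hasSum_gamZ {x w v : ℂ} (hwv : w * v = 1) (hv : ‖x * v‖ < 1) (N : ℤ) :
    HasSum (fun n : ℤ => gamZ q (n - N) * x ^ (n - N) * v ^ n) (gamSeries q (x * v) * v ^ N) := by
  have hv0 : v ≠ 0 := right_ne_zero_of_mul_eq_one hwv
  have hi : Function.Injective fun k : ℕ => (k : ℤ) + N := fun a b h => by
    simpa using h
  rw [← hi.hasSum_iff]
  · refine hasSum_of_eq ((hasSum_gamSeries hq0 hq1 hv).mul_right (v ^ N)) (fun k => ?_) rfl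
    simp only [Function.comp, add_sub_cancel_right, gamZ_natCast, zpow_natCast, zpow_add₀ hv0,
      mul_pow]
    ring
  · intro n hn
    have : n - N < 0 := by
      by_contra h
      exact hn ⟨(n - N).toNat, by dsimp only; omega⟩
    rw [gamZ_of_neg this]
    ring

theorem hasSum_laurentF {x w v : ℂ} (hwv : w * v = 1) (hv : ‖x * v‖ < 1) (l : ℕ) :
    HasSum (fun n : ℤ => laurentF q x l n * v ^ n)
      (gamSeries q (x * v) * (w * laurentPoly q x l w)) := by
  have hv0 : v ≠ 0 := right_ne_zero_of_mul_eq_one hwv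
  have h := hasSum_sum (s := Finset.range (l + 1)) fun j _ =>
    (hasSum_gamZ hq0 hq1 hwv hv (-j - 1)).mul_left (gamInv q (l - j) * x ^ (l - j))
  refine hasSum_of_eq h (fun n => ?_) ?_
  · rw [laurentF, Finset.sum_mul]
    refine Finset.sum_congr rfl fun j _ => ?_
    rw [show n - (-(j : ℤ) - 1) = n + j + 1 by ring]
    ring
  · rw [laurentPoly, Finset.mul_sum, Finset.mul_sum]
    refine Finset.sum_congr rfl fun j _ => ?_
    rw [show -(j : ℤ) - 1 = -((j + 1 : ℕ) : ℤ) by push_cast; ring, zpow_neg, zpow_natCast,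
      ← inv_pow, ← eq_inv_of_mul_eq_one_left hwv]
    ring

theorem hasSum_laurentH {x y w v : ℂ} (hwv : w * v = 1) (hv : ‖x * v‖ < 1) (m : ℕ) :
    HasSum (fun n : ℤ => laurentH q x y m n * v ^ n)
      (gamSeries q (x * v) * laurentPoly q y m v) := by
  have h := hasSum_sum (s := Finset.range (m + 1)) fun j _ =>
    (hasSum_gamZ hq0 hq1 hwv hv j).mul_left (gamInv q (m - j) * y ^ (m - j))
  refine hasSum_of_eq h (fun n => ?_) ?_
  · rw [laurentH, Finset.sum_mul]
    refine Finset.sum_congr rfl fun j _ => ?_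
    ring
  · rw [laurentPoly, Finset.mul_sum]
    refine Finset.sum_congr rfl fun j _ => ?_
    rw [zpow_natCast]
    ring

/-- The basis series have prescribed coefficients at negative indices (a delta, respectively zero)
and the kernels at nonnegative ones. A sequence obeying the Wick rule is therefore the combination
given by its annihilation part. -/
theorem eq_sum_laurent {x y : ℂ} (hxy : x * y = q ^ 2) {a b : ℤ → ℂ} {M : ℕ}
    (h0 : ∀ l : ℕ, M ≤ l → a (-l - 1) = 0)
    (h : ∀ k : ℕ, a k = ∑ l ∈ Finset.range M, x ^ (k + l + 1) * kerF q k l * a (-l - 1) +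
      ∑ m ∈ Finset.range M, x ^ k * y ^ m * kerH q k m * b (-m - 1)) (n : ℤ) :
    a n = ∑ l ∈ Finset.range M, a (-l - 1) * laurentF q x l n +
      ∑ m ∈ Finset.range M, b (-m - 1) * laurentH q x y m n := by
  obtain ⟨k, rfl⟩ | ⟨k, rfl⟩ : (∃ k : ℕ, n = k) ∨ ∃ k : ℕ, n = -k - 1 := by
    rcases n with k | k
    · exact Or.inl ⟨k, rfl⟩
    · exact Or.inr ⟨k, by rw [Int.negSucc_eq]; ring⟩
  · rw [h k]
    simp only [laurentF_natCast hq0 hq1, laurentH_natCast hq0 hq1 hxy, mul_comm]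
  · simp only [laurentF_neg hq0 hq1, laurentH_neg, mul_zero, Finset.sum_const_zero, add_zero,
      mul_ite, mul_one, Finset.sum_ite_eq', Finset.mem_range]
    split_ifs with hk
    · rfl
    · exact h0 k (not_lt.1 hk)

theorem hasSum_of_recursion {x y w v : ℂ} (hxy : x * y = q ^ 2) (hwv : w * v = 1)
    (hv : ‖x * v‖ < 1) {a b : ℤ → ℂ} {M : ℕ} (h0 : ∀ l : ℕ, M ≤ l → a (-l - 1) = 0)
    (h : ∀ k : ℕ, a k = ∑ l ∈ Finset.range M, x ^ (k + l + 1) * kerF q k l * a (-l - 1) +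
      ∑ m ∈ Finset.range M, x ^ k * y ^ m * kerH q k m * b (-m - 1)) :
    HasSum (fun n : ℤ => a n * v ^ n) (gamSeries q (x * v) *
      (∑ l ∈ Finset.range M, a (-l - 1) * (w * laurentPoly q x l w) +
        ∑ m ∈ Finset.range M, b (-m - 1) * laurentPoly q y m v)) := by
  have h1 := (hasSum_sum (s := Finset.range M) fun l _ =>
    (hasSum_laurentF hq0 hq1 hwv hv l).mul_left (a (-l - 1))).add
    (hasSum_sum (s := Finset.range M) fun m _ =>
    (hasSum_laurentH hq0 hq1 (y := y) hwv hv m).mul_left (b (-m - 1)))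
  refine hasSum_of_eq h1 (fun n => ?_) ?_
  · rw [eq_sum_laurent hq0 hq1 hxy h0 h n, add_mul, Finset.sum_mul, Finset.sum_mul]
    simp only [mul_assoc]
  · rw [mul_add, Finset.mul_sum, Finset.mul_sum]
    simp only [mul_left_comm (gamSeries q (x * v))]

/-- Two sequences that determine each other by the contraction rules have generating functions
that differ by the exchange factor. -/
theorem exists_hasSum_of_recursion {x y w v : ℂ} (hxy : x * y = q ^ 2) (hwv : w * v = 1)
    (hv : ‖x * v‖ < 1) (hw : ‖y * w‖ < 1) {a b : ℤ → ℂ} {M : ℕ}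
    (ha0 : ∀ l : ℕ, M ≤ l → a (-l - 1) = 0) (hb0 : ∀ l : ℕ, M ≤ l → b (-l - 1) = 0)
    (ha : ∀ k : ℕ, a k = ∑ l ∈ Finset.range M, x ^ (k + l + 1) * kerF q k l * a (-l - 1) +
      ∑ m ∈ Finset.range M, x ^ k * y ^ m * kerH q k m * b (-m - 1))
    (hb : ∀ k : ℕ, b k = ∑ m ∈ Finset.range M, y ^ (k + m + 1) * kerF q k m * b (-m - 1) +
      ∑ l ∈ Finset.range M, y ^ k * x ^ l * kerH q k l * a (-l - 1)) :
    ∃ d, HasSum (fun n : ℤ => a n * v ^ n) (gamSeries q (x * v) * d) ∧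
      HasSum (fun n : ℤ => b n * w ^ n) (gamSeries q (y * w) * (v * d)) := by
  refine ⟨_, hasSum_of_recursion hq0 hq1 hxy hwv hv ha0 ha, ?_⟩
  refine hasSum_of_eq (hasSum_of_recursion hq0 hq1 (mul_comm x y ▸ hxy) (mul_comm w v ▸ hwv) hw
    hb0 hb) (fun _ => rfl) (congrArg (gamSeries q (y * w) * ·) ?_)
  -- Exchanging a with b, x with y and w with v sends d to d/w, since the factor w occurs in front
  -- of the first family of polynomials only.
  rw [mul_add, Finset.mul_sum, Finset.mul_sum, add_comm]
  congr 1
  · exact Finset.sum_congr rfl fun m _ => by ring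
  · refine Finset.sum_congr rfl fun m _ => ?_
    linear_combination (a (-m - 1) * laurentPoly q x m w) * hwv

end Laurent

/-! ### The exchange relation for Ω^{NS}_R -/

section Existence

variable {q ι s : ℂ} (hq0 : q ≠ 0) (hq1 : ‖q‖ < 1)

theorem xArg_mul_yArg (hq0 : q ≠ 0) (hs : s ≠ 0) : xArg q s * yArg q s = q ^ 2 := by
  rw [xArg, yArg]
  field_simp

theorem rootConst_ne_zero (hq0 : q ≠ 0) (hι : ι ^ 2 = -1) (hs : s ≠ 0) :
    rootConst q ι s ≠ 0 := by
  have : ι ≠ 0 := by rintro rfl; norm_num at hι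
  exact mul_ne_zero (mul_ne_zero this (pow_ne_zero _ hq0)) hs

theorem norm_xArg_mul_lt {u : ℂ} (h : ‖q ^ 5 * s ^ 2‖ < ‖u ^ 2‖) :
    ‖xArg q s * (u ^ 2)⁻¹‖ < 1 := by
  rw [norm_mul, norm_inv, ← div_eq_mul_inv]
  exact (div_lt_one ((norm_nonneg _).trans_lt h)).2 h

theorem norm_yArg_mul_lt {u : ℂ} (h : ‖u ^ 2‖ < ‖q ^ 3 * s ^ 2‖) :
    ‖yArg q s * u ^ 2‖ < 1 := by
  rw [yArg, norm_mul, norm_inv, inv_mul_eq_div]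
  exact (div_lt_one ((norm_nonneg _).trans_lt h)).2 h

theorem ne_zero_of_norm_lt {a u : ℂ} (h : ‖a‖ < ‖u ^ 2‖) : u ≠ 0 := by
  rintro rfl
  simp only [ne_eq, OfNat.ofNat_ne_zero, not_false_eq_true, zero_pow, norm_zero] at h
  exact absurd h (not_lt.2 (norm_nonneg _))

include hq0 hq1

theorem exchangeFactor_eq {u : ℂ} (h1 : ‖q ^ 5 * s ^ 2‖ < ‖u ^ 2‖)
    (h2 : ‖u ^ 2‖ < ‖q ^ 3 * s ^ 2‖) :
    exchangeFactor q ι s u * gamSeries q (yArg q s * u ^ 2) =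
      rootConst q ι s * u⁻¹ * gamSeries q (xArg q s * (u ^ 2)⁻¹) := by
  have hu := ne_zero_of_norm_lt h1
  have hx := norm_xArg_mul_lt h1
  have hy := norm_yArg_mul_lt h2
  have e1 : q ^ 2 * (yArg q s * u ^ 2) = u ^ 2 / (q * s ^ 2) := by
    rw [yArg, div_eq_mul_inv, mul_inv, mul_inv]
    field_simp
  have e2 : yArg q s * u ^ 2 = u ^ 2 / (q ^ 3 * s ^ 2) := by rw [yArg, inv_mul_eq_div]
  have e3 : q ^ 2 * (xArg q s * (u ^ 2)⁻¹) = q ^ 7 * s ^ 2 / u ^ 2 := by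
    rw [xArg]
    ring
  have e4 : xArg q s * (u ^ 2)⁻¹ = q ^ 5 * s ^ 2 / u ^ 2 := by rw [xArg]; ring
  have g := gamSeries_ne_zero hq0 hq1 hy
  have p1 := qPoch_ne_zero hq1 hy
  have p2 := qPoch_ne_zero hq1 hx
  rw [gamSeries_eq hq0 hq1 hy] at g ⊢
  rw [gamSeries_eq hq0 hq1 hx]
  have p3 := (div_ne_zero_iff.1 g).1
  rw [exchangeFactor, rootFactor, rootConst, ← e1, ← e2, ← e3, ← e4]
  generalize qPoch q (q ^ 2 * (yArg q s * u ^ 2)) = a at *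
  generalize qPoch q (yArg q s * u ^ 2) = b at *
  generalize qPoch q (q ^ 2 * (xArg q s * (u ^ 2)⁻¹)) = c at *
  generalize qPoch q (xArg q s * (u ^ 2)⁻¹) = d at *
  field_simp

theorem exchangeRNS_OmegaRNS (hι : ι ^ 2 = -1) (hs : s ≠ 0) :
    ExchangeRNS q ι s (OmegaRNS q ι s) := by
  intro out inc u h1 h2
  have hu := ne_zero_of_norm_lt h1
  have hκ := rootConst_ne_zero hq0 hι hs
  obtain ⟨M, hM, hM'⟩ := exists_boundedBy out inc
  obtain ⟨d, ha, hb⟩ := exists_hasSum_of_recursion hq0 hq1 (xArg_mul_yArg hq0 hs)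
    (mul_inv_cancel₀ (pow_ne_zero 2 hu)) (norm_xArg_mul_lt h1) (norm_yArg_mul_lt h2)
    (a := fun n => OmegaRNS q ι s (phiNS q (-n - 1) out) inc)
    -- Scaling by κ makes the two Wick rules symmetric. Nonnegative indices are creation modes in
    -- both sequences; index -1 of the second is the zero mode φ^R_0, hence the bound M + 1.
    (b := fun n => rootConst q ι s * OmegaRNS q ι s out (phiR q (-n - 1) inc)) (M := M + 1)
    (fun l hl => by
      simp only [neg_sub, sub_neg_eq_add, add_sub_cancel_left]
      rw [hM.phiNS_eq_zero q (by omega), map_zero, LinearMap.zero_apply])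
    (fun l hl => by
      simp only [neg_sub, sub_neg_eq_add, add_sub_cancel_left]
      rw [hM'.phiR_eq_zero q (by omega), map_zero, mul_zero])
    (fun k => by
      simp only [neg_sub, sub_neg_eq_add, add_sub_cancel_left]
      rw [show -(k : ℤ) - 1 = Int.negSucc k by rw [Int.negSucc_eq]; ring, phiNS_negSucc,
        OmegaRNS_create_left hq0 hq1 hι hs hM hM', wickNS, Finset.mul_sum]
      simp only [mul_left_comm])
    (fun k => by
      simp only [neg_sub, sub_neg_eq_add, add_sub_cancel_left]
      rw [show -(k : ℤ) - 1 = Int.negSucc k by rw [Int.negSucc_eq]; ring, phiR_negSucc,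
        OmegaRNS_create_right hq0 hq1 hι hs hM hM', wickR, mul_add, mul_inv_cancel_left₀ hκ,
        Finset.mul_sum]
      simp only [mul_left_comm, add_right_comm])
  have hA : HasSum (fun n : ℤ => OmegaRNS q ι s (phiNS q (-n - 1) out) inc * u ^ (-(2 * n + 1)))
      (u⁻¹ * (gamSeries q (xArg q s * (u ^ 2)⁻¹) * d)) := by
    refine hasSum_of_eq (ha.mul_left u⁻¹) (fun n => ?_) rfl
    rw [neg_add, zpow_add₀ hu, zpow_neg, zpow_neg_one, zpow_mul, inv_zpow]
    norm_cast
    ring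
  have hB : HasSum (fun n : ℤ => OmegaRNS q ι s out (phiR q n inc) * u ^ (-(2 * n)))
      ((rootConst q ι s)⁻¹ * (gamSeries q (yArg q s * u ^ 2) * d)) := by
    have hinj : Function.Involutive fun n : ℤ => -n - 1 := fun n => by ring
    rw [← hinj.toPerm.hasSum_iff]
    refine hasSum_of_eq (hb.mul_left ((rootConst q ι s)⁻¹ * u ^ 2)) (fun n => ?_) ?_
    · simp only [Function.comp, Function.Involutive.coe_toPerm]
      rw [show -(2 * (-n - 1)) = 2 * n + 2 by ring, zpow_add₀ hu, zpow_mul]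
      norm_cast
      field_simp
    · field_simp
  refine ⟨hA.summable, hB.summable, ?_⟩
  rw [hA.tsum_eq, hB.tsum_eq]
  linear_combination (-(rootConst q ι s)⁻¹ * d) * exchangeFactor_eq (ι := ι) hq0 hq1 h1 h2 -
    (u⁻¹ * gamSeries q (xArg q s * (u ^ 2)⁻¹) * d) * (inv_mul_cancel₀ hκ)

end Existence

/-! ### Uniqueness of Laurent expansions -/

/-- A Laurent series that converges absolutely to zero on the unit circle is zero. -/
theorem eq_zero_of_laurent_eq_zero {e : ℤ → ℂ} (he : Summable e)
    (h : ∀ ζ : ℂ, ‖ζ‖ = 1 → ∑' k, e k * ζ ^ k = 0) (m : ℤ) : e m = 0 := by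
  have hT : Fact ((0 : ℝ) < 1) := ⟨one_pos⟩
  have hs : Summable fun k => e k • (fourier k : C(AddCircle (1 : ℝ), ℂ)) :=
    Summable.of_norm (by simpa [norm_smul, fourier_norm] using he.norm)
  have h0 : HasSum (fun k => e k • (fourier k : C(AddCircle (1 : ℝ), ℂ))) 0 := by
    -- The Fourier series converges uniformly, so its sum is the zero function; the inner product
    -- with the m-th character then isolates the m-th coefficient.
    convert hs.hasSum
    ext t
    refine Eq.trans ?_ (ContinuousMap.tsum_apply hs t)
    refine (h (AddCircle.toCircle t) (Circle.norm_coe _)).symm.trans (tsum_congr fun k => ?_)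
    simp [fourier_apply, AddCircle.toCircle_zsmul]
  have h1 := ((innerSL ℂ (fourierLp (T := 1) 2 m)).hasSum
    ((ContinuousMap.toLp (E := ℂ) 2 AddCircle.haarAddCircle ℂ).hasSum h0))
  rw [map_zero, map_zero] at h1
  have h2 : (fun k => innerSL ℂ (fourierLp (T := 1) 2 m)
      (ContinuousMap.toLp (E := ℂ) 2 AddCircle.haarAddCircle ℂ
        (e k • (fourier k : C(AddCircle (1 : ℝ), ℂ))))) = fun k => if k = m then e m else 0 := by
    funext k
    have h3 := orthonormal_iff_ite.1 (orthonormal_fourier (T := 1)) m k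
    rw [map_smul, map_smul, innerSL_apply_apply]
    refine (congrArg (e k • ·) h3).trans ?_
    by_cases hk : k = m
    · simp [hk]
    · simp [hk, Ne.symm hk]
  exact (hasSum_ite_eq m (e m)).unique (hasSum_of_eq h1 (fun k => (congrFun h2 k).symm) rfl)

section Uniqueness

variable {q : ℂ} (hq0 : q ≠ 0) (hq1 : ‖q‖ < 1)
include hq0 hq1

/-- The coefficients of the quotient of a power series by the factor `gamSeries q (x * v)`. -/
def quotCoeff (q x : ℂ) (a : ℕ → ℂ) (n : ℕ) : ℂ :=
  ∑ p ∈ Finset.HasAntidiagonal.antidiagonal n, gamInv q p.1 * x ^ p.1 * a p.2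

/-- The system is triangular with diagonal entry `gamInv q 0 = 1`. -/
theorem eq_zero_of_quotCoeff_eq_zero {x : ℂ} {a : ℕ → ℂ} (h : ∀ n, quotCoeff q x a n = 0)
    (n : ℕ) : a n = 0 := by
  induction n using Nat.strong_induction_on with
  | _ n ih =>
    have h1 := h n
    rw [quotCoeff, Finset.sum_eq_single (0, n)] at h1
    · simpa [gamInv_zero hq0 hq1] using h1
    · rintro ⟨i, j⟩ hij hne
      rw [Finset.HasAntidiagonal.mem_antidiagonal] at hij
      have : i ≠ 0 := by
        rintro rfl
        exact hne (by simp_all)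
      simp only at hij
      rw [ih j (by omega), mul_zero]
    · simp

theorem summable_quotCoeff {x v : ℂ} (hv : ‖x * v‖ < 1) {a : ℕ → ℂ}
    (ha : Summable fun n => a n * v ^ n) : Summable fun n => quotCoeff q x a n * v ^ n := by
  have h := summable_norm_sum_mul_antidiagonal_of_summable_norm
    (summable_norm_gamInv hq0 hq1 hv) ha.norm
  refine h.of_norm.congr fun n => ?_
  rw [quotCoeff, Finset.sum_mul]
  refine Finset.sum_congr rfl fun p hp => ?_
  rw [← Finset.HasAntidiagonal.mem_antidiagonal.1 hp, pow_add, mul_pow]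
  ring

theorem tsum_quotCoeff {x v : ℂ} (hv : ‖x * v‖ < 1) {a : ℕ → ℂ}
    (ha : Summable fun n => a n * v ^ n) :
    gamSeries q (x * v) * ∑' n, quotCoeff q x a n * v ^ n = ∑' n, a n * v ^ n := by
  have h := tsum_mul_tsum_eq_tsum_sum_antidiagonal_of_summable_norm
    (summable_norm_gamInv hq0 hq1 hv) ha.norm
  have h2 : ∑' n, quotCoeff q x a n * v ^ n = ∑' n, ∑ p ∈ Finset.HasAntidiagonal.antidiagonal n,
      gamInv q p.1 * (x * v) ^ p.1 * (a p.2 * v ^ p.2) := by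
    refine tsum_congr fun n => ?_
    rw [quotCoeff, Finset.sum_mul]
    refine Finset.sum_congr rfl fun p hp => ?_
    rw [← Finset.HasAntidiagonal.mem_antidiagonal.1 hp, pow_add, mul_pow]
    ring
  rw [h2, ← h, ← mul_assoc, mul_comm (gamSeries q (x * v)), gamSeries_mul_gamInv hq0 hq1 hv,
    one_mul]

/-- If a power series in `1 / w` divided by its factor equals a power series in `w` without
constant term divided by its factor, then both are zero. -/
theorem eq_zero_of_exchange {x y w₀ : ℂ} (hw₀ : w₀ ≠ 0) (hx : ‖x * w₀⁻¹‖ < 1) (hy : ‖y * w₀‖ < 1)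
    {a b : ℕ → ℂ} (ha : Summable fun n => a n * w₀⁻¹ ^ n) (hb : Summable fun n => b n * w₀ ^ n)
    (h : ∀ w : ℂ, ‖w‖ = ‖w₀‖ → gamSeries q (y * w) * ∑' n, a n * w⁻¹ ^ n =
      gamSeries q (x * w⁻¹) * (w * ∑' n, b n * w ^ n)) :
    (∀ n, a n = 0) ∧ ∀ n, b n = 0 := by
  -- The difference of the two quotients as a Laurent series in ζ, where w = w₀/ζ: nonnegative
  -- indices carry the powers of 1/w, negative ones the positive powers of w.
  let e : ℤ → ℂ := fun k => Int.rec (motive := fun _ => ℂ) (fun n => quotCoeff q x a n * w₀⁻¹ ^ n)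
    (fun n => -(w₀ * (quotCoeff q y b n * w₀ ^ n))) k
  have e_nat : ∀ n : ℕ, e n = quotCoeff q x a n * w₀⁻¹ ^ n := fun n => rfl
  have e_neg : ∀ n : ℕ, e (-((n : ℤ) + 1)) = -(w₀ * (quotCoeff q y b n * w₀ ^ n)) := fun n => by
    rw [← Int.negSucc_eq]
  have hsa := summable_quotCoeff hq0 hq1 hx ha
  have hsb := summable_quotCoeff hq0 hq1 hy hb
  have he : Summable e := Summable.of_nat_of_neg_add_one (by simpa only [e_nat] using hsa)
    (by simpa only [e_neg] using (hsb.mul_left w₀).neg)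
  have hzero : ∀ ζ : ℂ, ‖ζ‖ = 1 → ∑' k, e k * ζ ^ k = 0 := by
    intro ζ hζ
    have hζ0 : ζ ≠ 0 := by
      rintro rfl
      simp at hζ
    have hw : ‖w₀ * ζ⁻¹‖ = ‖w₀‖ := by rw [norm_mul, norm_inv, hζ, inv_one, mul_one]
    have hw' : ‖(w₀ * ζ⁻¹)⁻¹‖ = ‖w₀⁻¹‖ := by rw [norm_inv, hw, norm_inv]
    have hx' : ‖x * (w₀ * ζ⁻¹)⁻¹‖ < 1 := by rwa [norm_mul, hw', ← norm_mul]
    have hy' : ‖y * (w₀ * ζ⁻¹)‖ < 1 := by rwa [norm_mul, hw, ← norm_mul]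
    have ha' : Summable fun n => a n * (w₀ * ζ⁻¹)⁻¹ ^ n :=
      Summable.of_norm (ha.norm.congr fun n => by
        rw [norm_mul, norm_mul, norm_pow, norm_pow, hw'])
    have hb' : Summable fun n => b n * (w₀ * ζ⁻¹) ^ n :=
      Summable.of_norm (hb.norm.congr fun n => by
        rw [norm_mul, norm_mul, norm_pow, norm_pow, hw])
    have h1 := h _ hw
    have ga := gamSeries_ne_zero hq0 hq1 hx'
    have gb := gamSeries_ne_zero hq0 hq1 hy'
    rw [← tsum_quotCoeff hq0 hq1 hx' ha', ← tsum_quotCoeff hq0 hq1 hy' hb'] at h1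
    have h2 : ∑' n, quotCoeff q x a n * (w₀ * ζ⁻¹)⁻¹ ^ n =
        (w₀ * ζ⁻¹) * ∑' n, quotCoeff q y b n * (w₀ * ζ⁻¹) ^ n := by
      refine mul_left_cancel₀ (mul_ne_zero ga gb) ?_
      linear_combination h1
    have s1 := (summable_quotCoeff hq0 hq1 hx' ha').hasSum
    have s2 := ((summable_quotCoeff hq0 hq1 hy' hb').hasSum.mul_left (w₀ * ζ⁻¹)).neg
    rw [h2] at s1
    have s3 : HasSum (fun k : ℤ => e k * ζ ^ k) _ := HasSum.of_nat_of_neg_add_one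
      (f := fun k : ℤ => e k * ζ ^ k)
      (hasSum_of_eq s1 (fun n => by
        rw [e_nat, zpow_natCast, mul_inv, inv_inv, mul_pow, mul_assoc]) rfl)
      (hasSum_of_eq s2 (fun n => by
        simp only [e_neg]
        rw [show -((n : ℤ) + 1) = -((n + 1 : ℕ) : ℤ) by push_cast; ring, zpow_neg, zpow_natCast,
          ← inv_pow, pow_succ, mul_pow]
        ring) rfl)
    rw [s3.tsum_eq, add_neg_cancel]
  have key := eq_zero_of_laurent_eq_zero he hzero
  refine ⟨eq_zero_of_quotCoeff_eq_zero hq0 hq1 (x := x) fun n => ?_,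
    eq_zero_of_quotCoeff_eq_zero hq0 hq1 (x := y) fun n => ?_⟩
  · have h1 := key n
    rw [e_nat] at h1
    exact (mul_eq_zero.1 h1).resolve_right (pow_ne_zero _ (inv_ne_zero hw₀))
  · have h1 := key (-((n : ℤ) + 1))
    rw [e_neg, neg_eq_zero] at h1
    exact (mul_eq_zero.1 ((mul_eq_zero.1 h1).resolve_left hw₀)).resolve_right (pow_ne_zero _ hw₀)

end Uniqueness

/-! ### Uniqueness for Ω^{NS}_R -/

section Exchange

variable {q ι s : ℂ}

theorem ExchangeRNS.sub {Om Om' : FockNS →ₗ[ℂ] FockR →ₗ[ℂ] ℂ} (h : ExchangeRNS q ι s Om)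
    (h' : ExchangeRNS q ι s Om') : ExchangeRNS q ι s (Om - Om') := by
  intro out inc u h1 h2
  obtain ⟨s1, s2, e⟩ := h out inc u h1 h2
  obtain ⟨s1', s2', e'⟩ := h' out inc u h1 h2
  simp only [LinearMap.sub_apply, sub_mul]
  refine ⟨s1.sub s1', s2.sub s2', ?_⟩
  rw [s1.tsum_sub s1', s2.tsum_sub s2', e, e', mul_sub]

theorem hasSum_nat_of_neg_eq_zero {f : ℤ → ℂ} (hf : Summable f) (h : ∀ n : ℕ, f (-(n + 1)) = 0) :
    HasSum (fun n : ℕ => f n) (∑' n, f n) := by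
  have hi : Function.Injective ((↑) : ℕ → ℤ) := Nat.cast_injective
  refine (hi.hasSum_iff fun n hn => ?_).2 hf.hasSum
  rcases n with n | n
  · exact absurd ⟨n, rfl⟩ hn
  · rw [Int.negSucc_eq, h]

theorem hasSum_neg_of_nat_eq_zero {f : ℤ → ℂ} (hf : Summable f) (h : ∀ n : ℕ, f n = 0) :
    HasSum (fun n : ℕ => f (-(n + 1))) (∑' n, f n) := by
  have hi : Function.Injective fun n : ℕ => -((n : ℤ) + 1) := fun a b h => by
    simpa using h
  refine (hi.hasSum_iff fun n hn => ?_).2 hf.hasSum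
  rcases n with n | n
  · exact h n
  · exact absurd ⟨n, (Int.negSucc_eq n).symm⟩ hn

/-- A solution of the exchange relation whose matrix elements between `out` and `inc` vanish
after an annihilation operator also vanishes after a creation operator. -/
theorem ExchangeRNS.create_eq_zero (hq0 : q ≠ 0) (hq1 : ‖q‖ < 1) (hι : ι ^ 2 = -1) (hs : s ≠ 0)
    {Om : FockNS →ₗ[ℂ] FockR →ₗ[ℂ] ℂ} (h : ExchangeRNS q ι s Om) {out : FockNS} {inc : FockR}
    (hout : ∀ l, Om (annihilate l out) inc = 0) (hinc : ∀ m, Om out (annihilate m inc) = 0)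
    (hpar : Om out (parity inc) = 0) :
    (∀ k, Om (create k out) inc = 0) ∧ ∀ k, Om out (create k inc) = 0 := by
  have hκ := rootConst_ne_zero hq0 hι hs
  have hqn : 0 < ‖q‖ := norm_pos_iff.2 hq0
  have hsn : 0 < ‖s‖ := norm_pos_iff.2 hs
  -- The circle |w| = |q⁴z| lies strictly inside the annulus.
  have norm1 : ‖q ^ 5 * s ^ 2‖ < ‖(q ^ 2 * s) ^ 2‖ := by
    simp only [norm_mul, norm_pow, mul_pow, ← pow_mul]
    exact mul_lt_mul_of_pos_right (pow_lt_pow_right_of_lt_one₀ hqn hq1 (by norm_num))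
      (pow_pos hsn 2)
  have norm2 : ‖(q ^ 2 * s) ^ 2‖ < ‖q ^ 3 * s ^ 2‖ := by
    simp only [norm_mul, norm_pow, mul_pow, ← pow_mul]
    exact mul_lt_mul_of_pos_right (pow_lt_pow_right_of_lt_one₀ hqn hq1 (by norm_num))
      (pow_pos hsn 2)
  -- After dropping the vanishing elements, and up to half-integral powers of w, the left side is a
  -- power series in 1/w. The right one starts at w¹, as `hpar` removes the zero mode.
  have negA : ∀ n : ℕ, Om (phiNS q (-(-((n : ℤ) + 1)) - 1) out) inc = 0 := fun n => by
    rw [neg_neg, add_sub_cancel_right, phiNS_natCast, LinearMap.smul_apply, map_smul,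
      LinearMap.smul_apply, hout, smul_zero]
  have natB : ∀ n : ℕ, Om out (phiR q n inc) = 0 := fun n => by
    cases n with
    | zero => exact hpar
    | succ n => rw [phiR_succ, LinearMap.smul_apply, map_smul, hinc, smul_zero]
  have natA : ∀ n : ℕ, Om (phiNS q (-(n : ℤ) - 1) out) inc = Om (create n out) inc := fun n => by
    rw [show -(n : ℤ) - 1 = Int.negSucc n by rw [Int.negSucc_eq]; ring, phiNS_negSucc]
  have negB : ∀ n : ℕ, Om out (phiR q (-((n : ℤ) + 1)) inc) = Om out (create n inc) := fun n => by
    rw [← Int.negSucc_eq, phiR_negSucc]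
  have sums : ∀ u : ℂ, ‖u ^ 2‖ = ‖(q ^ 2 * s) ^ 2‖ →
      Summable (fun n : ℕ => Om (create n out) inc * (u ^ 2)⁻¹ ^ n) ∧
      Summable (fun n : ℕ => rootConst q ι s * Om out (create n inc) * (u ^ 2) ^ n) ∧
      gamSeries q (yArg q s * u ^ 2) * ∑' n : ℕ, Om (create n out) inc * (u ^ 2)⁻¹ ^ n =
      gamSeries q (xArg q s * (u ^ 2)⁻¹) *
        (u ^ 2 * ∑' n : ℕ, rootConst q ι s * Om out (create n inc) * (u ^ 2) ^ n) := by
    intro u hu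
    rw [← hu] at norm1 norm2
    have hu0 := ne_zero_of_norm_lt norm1
    obtain ⟨s1, s2, e⟩ := h out inc u norm1 norm2
    have s3 := hasSum_of_eq ((hasSum_nat_of_neg_eq_zero s1 fun n => by
      rw [negA, zero_mul]).mul_left u) (g := fun n : ℕ => Om (create n out) inc * (u ^ 2)⁻¹ ^ n)
      (fun n => by
        rw [natA, neg_add, zpow_add₀ hu0, zpow_neg, zpow_neg_one, zpow_mul, inv_pow]
        norm_cast
        field_simp) rfl
    have s4 := hasSum_of_eq ((hasSum_neg_of_nat_eq_zero s2 fun n => by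
      rw [natB, zero_mul]).mul_left (rootConst q ι s * (u ^ 2)⁻¹))
      (g := fun n : ℕ => rootConst q ι s * Om out (create n inc) * (u ^ 2) ^ n)
      (fun n => by
        rw [negB, show -(2 * -((n : ℤ) + 1)) = ((2 * n + 2 : ℕ) : ℤ) by push_cast; ring,
          zpow_natCast, pow_add, pow_mul]
        field_simp) rfl
    refine ⟨s3.summable, s4.summable, ?_⟩
    rw [s3.tsum_eq, s4.tsum_eq, e]
    have := exchangeFactor_eq (ι := ι) hq0 hq1 norm1 norm2
    generalize ∑' n : ℤ, Om out (phiR q n inc) * u ^ (-(2 * n)) = S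
    rw [show gamSeries q (yArg q s * u ^ 2) * (u * (exchangeFactor q ι s u * S)) =
      (exchangeFactor q ι s u * gamSeries q (yArg q s * u ^ 2)) * u * S by ring, this]
    field_simp
  obtain ⟨s1, s2, -⟩ := sums (q ^ 2 * s) rfl
  have hw0 : (q ^ 2 * s) ^ 2 ≠ 0 := pow_ne_zero 2 (ne_zero_of_norm_lt norm1)
  obtain ⟨ha, hb⟩ := eq_zero_of_exchange hq0 hq1 hw0 (norm_xArg_mul_lt norm1)
    (norm_yArg_mul_lt norm2) s1 s2 (fun w hw => by
      obtain ⟨u, rfl⟩ := IsAlgClosed.exists_pow_nat_eq w (n := 2) two_pos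
      exact (sums u hw).2.2)
  exact ⟨ha, fun k => (mul_eq_zero.1 (hb k)).resolve_left hκ⟩

theorem ExchangeRNS.eq_zero (hq0 : q ≠ 0) (hq1 : ‖q‖ < 1) (hι : ι ^ 2 = -1) (hs : s ≠ 0)
    {Om : FockNS →ₗ[ℂ] FockR →ₗ[ℂ] ℂ} (h : ExchangeRNS q ι s Om) (h0 : Om vac vac = 0) :
    Om = 0 := by
  refine LinearMap.ext fun x => LinearMap.ext fun y => ?_
  refine fock_pair_induction (P := fun x y => Om x y = 0) ?_ ?_ ?_ ?_ ?_ ?_ h0 ?_ ?_ x y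
  · simp
  · simp
  · intro x x' y h1 h2
    simp [h1, h2]
  · intro x y y' h1 h2
    simp [h1, h2]
  · intro c x y h1
    simp [h1]
  · intro c x y h1
    simp [h1]
  · intro k x y h1 h2 h3
    exact (h.create_eq_zero hq0 hq1 hι hs h1 h2 h3).1 k
  · intro k x y h1 h2 h3
    exact (h.create_eq_zero hq0 hq1 hι hs h1 h2 h3).2 k

theorem exchangeRNS_iff (hq0 : q ≠ 0) (hq1 : ‖q‖ < 1) (hι : ι ^ 2 = -1) (hs : s ≠ 0)
    (Om : FockNS →ₗ[ℂ] FockR →ₗ[ℂ] ℂ) :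
    (ExchangeRNS q ι s Om ∧ Om vac vac = 1) ↔ Om = OmegaRNS q ι s := by
  constructor
  · rintro ⟨h, h1⟩
    refine sub_eq_zero.1 ((h.sub (exchangeRNS_OmegaRNS hq0 hq1 hι hs)).eq_zero hq0 hq1 hι hs ?_)
    rw [LinearMap.sub_apply, LinearMap.sub_apply, h1, OmegaRNS_vac_vac hq0 hq1 hι hs, sub_self]
  · rintro rfl
    exact ⟨exchangeRNS_OmegaRNS hq0 hq1 hι hs, OmegaRNS_vac_vac hq0 hq1 hι hs⟩

end Exchange

/-! ### The exchange relation of the dual operator -/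

section DualExchange

variable {q ι s : ℂ}

theorem dualRoot_dualRoot (hq0 : q ≠ 0) (hs : s ≠ 0) : dualRoot q (dualRoot q s) = s := by
  rw [dualRoot, dualRoot]
  field_simp

theorem pow_five_mul_dualRoot_sq (hq0 : q ≠ 0) (hs : s ≠ 0) :
    q ^ 5 * dualRoot q s ^ 2 = (q ^ 3 * s ^ 2)⁻¹ := by
  rw [dualRoot]
  field_simp

theorem pow_three_mul_dualRoot_sq (hq0 : q ≠ 0) (hs : s ≠ 0) :
    q ^ 3 * dualRoot q s ^ 2 = (q ^ 5 * s ^ 2)⁻¹ := by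
  rw [dualRoot]
  field_simp

theorem xArg_dualRoot (hq0 : q ≠ 0) (hs : s ≠ 0) : xArg q (dualRoot q s) = yArg q s :=
  pow_five_mul_dualRoot_sq hq0 hs

theorem rootConst_dualRoot (hq0 : q ≠ 0) (hι : ι ^ 2 = -1) (hs : s ≠ 0) :
    rootConst q ι (dualRoot q s) = (rootConst q ι s)⁻¹ := by
  refine eq_inv_of_mul_eq_one_left ?_
  rw [rootConst, rootConst, dualRoot]
  field_simp
  linear_combination -hι

theorem norm_dualRoot_lt (hq0 : q ≠ 0) (hs : s ≠ 0) {u : ℂ} (hu : u ≠ 0) :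
    (‖q ^ 5 * dualRoot q s ^ 2‖ < ‖u⁻¹ ^ 2‖ ∧ ‖u⁻¹ ^ 2‖ < ‖q ^ 3 * dualRoot q s ^ 2‖) ↔
      (‖q ^ 5 * s ^ 2‖ < ‖u ^ 2‖ ∧ ‖u ^ 2‖ < ‖q ^ 3 * s ^ 2‖) := by
  have h5 : 0 < ‖q ^ 5 * s ^ 2‖ := norm_pos_iff.2 (mul_ne_zero (pow_ne_zero _ hq0) (pow_ne_zero _ hs))
  have h3 : 0 < ‖q ^ 3 * s ^ 2‖ := norm_pos_iff.2 (mul_ne_zero (pow_ne_zero _ hq0) (pow_ne_zero _ hs))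
  have h2 : 0 < ‖u ^ 2‖ := norm_pos_iff.2 (pow_ne_zero _ hu)
  rw [pow_five_mul_dualRoot_sq hq0 hs, pow_three_mul_dualRoot_sq hq0 hs, inv_pow, norm_inv,
    norm_inv, norm_inv, inv_lt_inv₀ h3 h2, inv_lt_inv₀ h2 h5, and_comm]

/-- Under the duality and w ↦ 1/w the arguments x/w and yw are exchanged and κ is inverted, so the
factor is inverted. -/
theorem exchangeFactor_mul_dualRoot (hq0 : q ≠ 0) (hq1 : ‖q‖ < 1) (hι : ι ^ 2 = -1) (hs : s ≠ 0)
    {u : ℂ} (h1 : ‖q ^ 5 * s ^ 2‖ < ‖u ^ 2‖) (h2 : ‖u ^ 2‖ < ‖q ^ 3 * s ^ 2‖) :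
    exchangeFactor q ι s u * exchangeFactor q ι (dualRoot q s) u⁻¹ = 1 := by
  have hu := ne_zero_of_norm_lt h1
  have hκ := rootConst_ne_zero hq0 hι hs
  have e := exchangeFactor_eq (ι := ι) hq0 hq1 h1 h2
  obtain ⟨h1', h2'⟩ := (norm_dualRoot_lt hq0 hs hu).2 ⟨h1, h2⟩
  have e' := exchangeFactor_eq (ι := ι) hq0 hq1 h1' h2'
  have hy := gamSeries_ne_zero hq0 hq1 (norm_yArg_mul_lt h2)
  have hx := gamSeries_ne_zero hq0 hq1 (norm_xArg_mul_lt h1)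
  have hyx : yArg q (dualRoot q s) = xArg q s := by
    rw [← xArg_dualRoot hq0 (dualRoot_ne_zero hq0 hs), dualRoot_dualRoot hq0 hs]
  rw [hyx, xArg_dualRoot hq0 hs, rootConst_dualRoot hq0 hι hs, inv_pow, inv_inv, inv_inv] at e'
  refine mul_right_cancel₀ (mul_ne_zero hy hx) ?_
  rw [one_mul, mul_mul_mul_comm, e, e']
  field_simp

theorem exchange_dual_iff (hq0 : q ≠ 0) (hq1 : ‖q‖ < 1) (hι : ι ^ 2 = -1) (hs : s ≠ 0)
    {u : ℂ} (h1 : ‖q ^ 5 * s ^ 2‖ < ‖u ^ 2‖) (h2 : ‖u ^ 2‖ < ‖q ^ 3 * s ^ 2‖) (A B : ℤ → ℂ) :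
    (Summable (fun n : ℤ => A (-n) * u ^ (-(2 * n))) ∧
      Summable (fun n : ℤ => B n * u ^ (-(2 * n + 1))) ∧
      ∑' n : ℤ, A (-n) * u ^ (-(2 * n)) =
        exchangeFactor q ι s u * ∑' n : ℤ, B n * u ^ (-(2 * n + 1))) ↔
    (Summable (fun n : ℤ => B (-n - 1) * u⁻¹ ^ (-(2 * n + 1))) ∧
      Summable (fun n : ℤ => A n * u⁻¹ ^ (-(2 * n))) ∧
      ∑' n : ℤ, B (-n - 1) * u⁻¹ ^ (-(2 * n + 1)) =
        exchangeFactor q ι (dualRoot q s) u⁻¹ * ∑' n : ℤ, A n * u⁻¹ ^ (-(2 * n))) := by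
  have hinv : Function.Involutive fun n : ℤ => -n - 1 := fun n => by ring
  have eA : (fun n : ℤ => A (-n) * u ^ (-(2 * n))) =
      (fun n : ℤ => A n * u⁻¹ ^ (-(2 * n))) ∘ Equiv.neg ℤ := by
    funext n
    simp
  have eB : (fun n : ℤ => B (-n - 1) * u⁻¹ ^ (-(2 * n + 1))) =
      (fun n : ℤ => B n * u ^ (-(2 * n + 1))) ∘ hinv.toPerm := by
    funext n
    simp only [Function.comp, Function.Involutive.coe_toPerm]
    rw [inv_zpow', show -(2 * (-n - 1) + 1) = - -(2 * n + 1) by ring]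
  have hf := exchangeFactor_mul_dualRoot hq0 hq1 hι hs h1 h2
  have f0 := left_ne_zero_of_mul_eq_one hf
  have hsA : ∑' n : ℤ, A (-n) * u ^ (-(2 * n)) = ∑' n : ℤ, A n * u⁻¹ ^ (-(2 * n)) := by
    rw [eA]
    exact (Equiv.neg ℤ).tsum_eq fun n : ℤ => A n * u⁻¹ ^ (-(2 * n))
  have hsB : ∑' n : ℤ, B (-n - 1) * u⁻¹ ^ (-(2 * n + 1)) = ∑' n : ℤ, B n * u ^ (-(2 * n + 1)) := by
    rw [eB]
    exact hinv.toPerm.tsum_eq fun n : ℤ => B n * u ^ (-(2 * n + 1))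
  rw [hsA, hsB, eA, eB, Equiv.summable_iff, Equiv.summable_iff]
  generalize ∑' n : ℤ, A n * u⁻¹ ^ (-(2 * n)) = S
  generalize ∑' n : ℤ, B n * u ^ (-(2 * n + 1)) = T
  rw [← and_assoc, ← and_assoc, and_comm (a := Summable _)]
  refine and_congr_right fun _ => ⟨fun h => ?_, fun h => ?_⟩
  · rw [h]
    linear_combination -T * hf
  · rw [h]
    linear_combination -S * hf

/-- The map w ↦ 1/w carries one annulus to the other, and transposition swaps the two sides of the
relation. Existence and uniqueness are thereby transferred together. -/
theorem exchangeNSR_iff_flip (hq0 : q ≠ 0) (hq1 : ‖q‖ < 1) (hι : ι ^ 2 = -1) (hs : s ≠ 0)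
    (Om : FockR →ₗ[ℂ] FockNS →ₗ[ℂ] ℂ) :
    ExchangeNSR q ι s Om ↔ ExchangeRNS q ι (dualRoot q s) Om.flip := by
  constructor
  · intro h out inc u h1 h2
    have hu := ne_zero_of_norm_lt h1
    rw [← inv_inv u] at h1 h2
    obtain ⟨h1', h2'⟩ := (norm_dualRoot_lt hq0 hs (inv_ne_zero hu)).1 ⟨h1, h2⟩
    have h3 := (exchange_dual_iff hq0 hq1 hι hs h1' h2' (fun n => Om (phiR q n inc) out)
      (fun n => Om inc (phiNS q n out))).1 (h inc out u⁻¹ h1' h2')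
    rwa [inv_inv] at h3
  · intro h out inc u h1 h2
    have hu := ne_zero_of_norm_lt h1
    obtain ⟨h1', h2'⟩ := (norm_dualRoot_lt hq0 hs hu).2 ⟨h1, h2⟩
    exact (exchange_dual_iff hq0 hq1 hι hs h1 h2 (fun n => Om (phiR q n out) inc)
      (fun n => Om out (phiNS q n inc))).2 (h inc out u⁻¹ h1' h2')

theorem exchangeNSR_iff (hq0 : q ≠ 0) (hq1 : ‖q‖ < 1) (hι : ι ^ 2 = -1) (hs : s ≠ 0)
    (Om : FockR →ₗ[ℂ] FockNS →ₗ[ℂ] ℂ) :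
    (ExchangeNSR q ι s Om ∧ Om vac vac = 1) ↔ Om = OmegaNSR q ι s := by
  rw [exchangeNSR_iff_flip hq0 hq1 hι hs, show Om vac vac = Om.flip vac vac from rfl,
    exchangeRNS_iff hq0 hq1 hι (dualRoot_ne_zero hq0 hs)]
  constructor
  · intro h
    refine LinearMap.ext fun x => LinearMap.ext fun y => ?_
    rw [OmegaNSR_eq hq0 hq1 ι hs, ← h, LinearMap.flip_apply]
  · rintro rfl
    refine LinearMap.ext fun x => LinearMap.ext fun y => ?_
    rw [LinearMap.flip_apply, OmegaNSR_eq hq0 hq1 ι hs]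

end DualExchange

/-! ### One-point and two-point functions -/

section Correlators

variable {q ι s : ℂ}

theorem boundedBy_vac : BoundedBy 0 vac := fun k _ => annihilate_vac k

theorem phiNS_natCast_vac (n : ℕ) : phiNS q n vac = 0 := by
  rw [phiNS_natCast, LinearMap.smul_apply, annihilate_vac, smul_zero]

theorem phiR_zero_vac : phiR q 0 vac = vac := parity_vac

theorem phiR_succ_vac (n : ℕ) : phiR q (n + 1 : ℕ) vac = 0 := by
  rw [phiR_succ, LinearMap.smul_apply, annihilate_vac, smul_zero]

variable (hq0 : q ≠ 0) (hq1 : ‖q‖ < 1) (hι : ι ^ 2 = -1) (hs : s ≠ 0)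
include hq0 hq1 hι hs

theorem OmegaRNS_create_vac (k : ℕ) :
    OmegaRNS q ι s (create k vac) vac = rootConst q ι s * (gam q k * xArg q s ^ k) := by
  rw [OmegaRNS_create_left hq0 hq1 hι hs boundedBy_vac boundedBy_vac, wickNS]
  simp only [zero_add, Finset.sum_range_one]
  rw [phiNS_natCast_vac, Nat.cast_zero, phiR_zero_vac, OmegaRNS_vac_vac hq0 hq1 hι hs,
    kerH_zero_right hq0 hq1, map_zero, LinearMap.zero_apply]
  ring

theorem OmegaRNS_vac_create (k : ℕ) :
    OmegaRNS q ι s vac (create k vac) = gam q (k + 1) * yArg q s ^ (k + 1) := by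
  rw [OmegaRNS_create_right hq0 hq1 hι hs boundedBy_vac boundedBy_vac, wickR]
  simp only [zero_add, Finset.sum_range_one]
  rw [phiNS_natCast_vac, Nat.cast_zero, phiR_zero_vac, OmegaRNS_vac_vac hq0 hq1 hι hs,
    kerF_zero_right, map_zero, LinearMap.zero_apply]
  ring

theorem OmegaRNS_vac_phiR_neg_vac (n : ℕ) :
    OmegaRNS q ι s vac (phiR q (-n) vac) = gam q n * yArg q s ^ n := by
  cases n with
  | zero =>
    rw [Nat.cast_zero, neg_zero, phiR_zero_vac, OmegaRNS_vac_vac hq0 hq1 hι hs, gam_zero, pow_zero,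
      one_mul]
  | succ n =>
    rw [show -((n + 1 : ℕ) : ℤ) = Int.negSucc n from rfl, phiR_negSucc,
      OmegaRNS_vac_create hq0 hq1 hι hs]

/-- The matrix elements are γ_n yⁿ, so the sum is γ(yw); no lower bound on |w| is needed because no
negative powers of w occur. -/
theorem hasSum_OmegaRNS_one_point {u : ℂ} (hu : u ≠ 0) (h : ‖u ^ 2‖ < ‖q ^ 3 * s ^ 2‖) :
    HasSum (fun n : ℤ => OmegaRNS q ι s vac (phiR q n vac) * u ^ (-(2 * n)))
      (qPoch q (u ^ 2 / (q * s ^ 2)) / qPoch q (u ^ 2 / (q ^ 3 * s ^ 2))) := by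
  have hy := norm_yArg_mul_lt h
  have h0 := hasSum_gamSeries hq0 hq1 hy
  have e1 : q ^ 2 * (yArg q s * u ^ 2) = u ^ 2 / (q * s ^ 2) := by
    rw [yArg, div_eq_mul_inv, mul_inv, mul_inv]
    field_simp
  have e2 : yArg q s * u ^ 2 = u ^ 2 / (q ^ 3 * s ^ 2) := by rw [yArg, inv_mul_eq_div]
  rw [← e1, ← e2, ← gamSeries_eq hq0 hq1 hy]
  have hi : Function.Injective fun n : ℕ => -(n : ℤ) := fun a b h => by simpa using h
  refine (hi.hasSum_iff fun n hn => ?_).1 (hasSum_of_eq h0 (fun n => ?_) rfl)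
  · rcases n with n | n
    · cases n with
      | zero => exact absurd ⟨0, by simp⟩ hn
      | succ n =>
        rw [show Int.ofNat (n + 1) = ((n + 1 : ℕ) : ℤ) from rfl, phiR_succ_vac, map_zero, zero_mul]
    · exact absurd ⟨n + 1, rfl⟩ hn
  · simp only [Function.comp]
    rw [OmegaRNS_vac_phiR_neg_vac hq0 hq1 hι hs, mul_pow, ← mul_assoc,
      show -(2 * -(n : ℤ)) = ((2 * n : ℕ) : ℤ) by push_cast; ring, zpow_natCast, pow_mul]

theorem hasSum_OmegaNSR_one_point {u : ℂ} (hu : u ≠ 0) (h : ‖u ^ 2‖ < ‖q ^ 3 * s ^ 2‖) :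
    HasSum (fun n : ℤ => OmegaNSR q ι s vac (phiNS q n vac) * u ^ (-(2 * n + 1)))
      ((rootFactor q ι s u)⁻¹ *
        (qPoch q (u ^ 2 / (q * s ^ 2)) / qPoch q (u ^ 2 / (q ^ 3 * s ^ 2)))) := by
  have hy := norm_yArg_mul_lt h
  have hs' := dualRoot_ne_zero hq0 hs
  have e1 : q ^ 2 * (yArg q s * u ^ 2) = u ^ 2 / (q * s ^ 2) := by
    rw [yArg, div_eq_mul_inv, mul_inv, mul_inv]
    field_simp
  have e2 : yArg q s * u ^ 2 = u ^ 2 / (q ^ 3 * s ^ 2) := by rw [yArg, inv_mul_eq_div]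
  have h0 := (hasSum_gamSeries hq0 hq1 hy).mul_left (rootFactor q ι s u)⁻¹
  rw [← e1, ← e2, ← gamSeries_eq hq0 hq1 hy]
  have hi : Function.Injective fun n : ℕ => -(n : ℤ) - 1 := fun a b h => by simpa using h
  simp only [OmegaNSR_eq hq0 hq1 ι hs]
  refine (hi.hasSum_iff fun n hn => ?_).1 (hasSum_of_eq h0 (fun n => ?_) rfl)
  · rcases n with n | n
    · rw [show Int.ofNat n = (n : ℤ) from rfl, phiNS_natCast_vac, map_zero, LinearMap.zero_apply,
        zero_mul]
    · exact absurd ⟨n, by simp only [Int.negSucc_eq]; ring⟩ hn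
  · simp only [Function.comp]
    rw [show -(n : ℤ) - 1 = Int.negSucc n by rw [Int.negSucc_eq]; ring, phiNS_negSucc,
      OmegaRNS_create_vac hq0 hq1 hι hs', rootConst_dualRoot hq0 hι hs, xArg_dualRoot hq0 hs,
      show -(2 * Int.negSucc n + 1) = ((2 * n + 1 : ℕ) : ℤ) by
        rw [Int.negSucc_eq]; push_cast; ring,
      zpow_natCast, pow_succ, pow_mul, mul_pow, rootFactor, rootConst]
    field_simp

end Correlators

/-! ### Two-point functions -/

section TwoPoint

theorem boundedBy_create_vac (m : ℕ) : BoundedBy (m + 1) (create m vac) := fun k hk => by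
  rw [annihilate_create, if_neg (by omega), annihilate_vac, map_zero, sub_zero]

theorem BoundedBy.mono {M N : ℕ} {x : Fock} (h : BoundedBy M x) (hMN : M ≤ N) : BoundedBy N x :=
  fun k hk => h k (hMN.trans hk)

variable {q ι s : ℂ}

theorem annihilate_create_vac (k l : ℕ) :
    annihilate k (create l vac) = if k = l then vac else 0 := by
  rw [annihilate_create, annihilate_vac, map_zero, sub_zero]

theorem parity_create_vac (m : ℕ) : parity (create m vac) = -create m vac := by
  rw [parity_create, parity_vac]

theorem sum_phiNS_create_vac (f : Fock →ₗ[ℂ] ℂ) (c : ℕ → ℂ) (k : ℕ) :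
    ∑ j ∈ Finset.range (k + 2), c j * f (phiNS q j (create k vac)) =
      c k * (eta q (2 * k + 1) * f vac) := by
  rw [Finset.sum_eq_single k]
  · rw [phiNS_natCast, LinearMap.smul_apply, annihilate_create_vac, if_pos rfl, map_smul,
      smul_eq_mul]
  · intro j _ hj
    rw [phiNS_natCast, LinearMap.smul_apply, annihilate_create_vac, if_neg hj, smul_zero, map_zero,
      mul_zero]
  · intro h
    exact absurd (Finset.mem_range.2 (by omega)) h

theorem sum_phiR_create_vac (f : Fock →ₗ[ℂ] ℂ) (c : ℕ → ℂ) (m : ℕ) :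
    ∑ j ∈ Finset.range (m + 2), c j * f (phiR q j (create m vac)) =
      c (m + 1) * (eta q (2 * (m + 1)) * f vac) - c 0 * f (create m vac) := by
  rw [Finset.sum_range_succ', Finset.sum_eq_single m]
  · rw [phiR_succ, LinearMap.smul_apply, annihilate_create_vac, if_pos rfl, map_smul,
      smul_eq_mul, Nat.cast_zero, phiR_zero, parity_create_vac, map_neg]
    ring
  · intro j _ hj
    rw [phiR_succ, LinearMap.smul_apply, annihilate_create_vac, if_neg hj, smul_zero, map_zero,
      mul_zero]
  · intro h
    exact absurd (Finset.mem_range.2 (by omega)) h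

variable (hq0 : q ≠ 0) (hq1 : ‖q‖ < 1)
include hq0 hq1

/-- The direct contraction and the product of one-point functions combine into a single X. The
product enters with a minus sign because φ^R_0 acts as -1 on a one-fermion state. -/
theorem kerF_R_sub (n m : ℕ) :
    kerF q n (m + 1) * eta q (2 * (m + 1)) - gam q (n + 1) * gam q (m + 1) =
      coeffX q (2 * (m + 1 : ℕ)) (2 * (n + 1 : ℕ)) * gam q (n + 1) * gam q (m + 1) := by
  have h2 := one_sub_pow_ne_zero hq0 hq1 (a := 4 * n + 4) (by omega)
  have h3 := one_sub_pow_ne_zero hq0 hq1 (a := 4 * (n + (m + 1) + 1)) (by omega)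
  have hX := coeffX_natCast q (2 * (m + 1)) (2 * (n + 1))
  push_cast at hX ⊢
  have h4 : 2 * (2 * (m + 1) + 2 * (n + 1)) = 4 * (n + (m + 1) + 1) := by ring
  have hg : gam q (n + 1) = _ := gam_succ n
  rw [hX, eta_R_eq hq0, kerF, h4, hg]
  field_simp
  ring

theorem kerH_R_sub (k n : ℕ) :
    kerH q k (n + 1) * eta q (2 * (n + 1)) - gam q k * gam q (n + 1) =
      -(coeffX q (-(2 * k) - 1) (2 * (n + 1 : ℕ)) * gam q k * gam q (n + 1)) := by
  have h3 := pow_sub_pow_ne_zero hq0 hq1 (a := 4 * (n + 1)) (b := 4 * k + 2) (by omega)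
  have h4 := pow_sub_pow_ne_zero hq0 hq1 (b := 4 * (n + 1)) (a := 4 * k + 2) (by omega)
  have hX := coeffX_neg_natCast hq0 (2 * k + 1) (2 * (n + 1))
  push_cast at hX ⊢
  rw [show (-(2 * k) - 1 : ℤ) = -(2 * k + 1) by ring, hX, eta_R_eq hq0, kerH,
    show 2 * (2 * k + 1) = 4 * k + 2 by ring, show 2 * (2 * (n + 1)) = 4 * (n + 1) by ring,
    show q ^ (4 * k + 2) - q ^ (4 * (n + 1)) = -(q ^ (4 * (n + 1)) - q ^ (4 * k + 2)) by ring]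
  field_simp
  ring

theorem kerF_NS_sub (l k : ℕ) :
    kerF q l k * eta q (2 * k + 1) - gam q l * gam q k / q =
      -(coeffX q (2 * l + 1) (2 * k + 1) * gam q l * gam q k / q) := by
  have h3 := one_sub_pow_ne_zero hq0 hq1 (a := 4 * (l + k + 1)) (by omega)
  have hX := coeffX_natCast q (2 * l + 1) (2 * k + 1)
  push_cast at hX
  have h4 : 2 * (2 * l + 1 + (2 * k + 1)) = 4 * (l + k + 1) := by ring
  rw [hX, eta_NS_eq hq0, kerF, h4]
  field_simp
  ring

variable (hι : ι ^ 2 = -1) (hs : s ≠ 0)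
include hι hs

theorem OmegaRNS_two_point_R {n m : ℕ} (h : (n, m) ≠ (0, 0)) :
    OmegaRNS q ι s vac (phiR q (-n) (phiR q (-m) vac)) =
      coeffX q (2 * m) (2 * n) * gam q n * gam q m * yArg q s ^ (n + m) := by
  cases n with
  | zero =>
    obtain ⟨m, rfl⟩ : ∃ m', m = m' + 1 := ⟨m - 1, by
      have : m ≠ 0 := by rintro rfl; exact h rfl
      omega⟩
    have hX := coeffX_pos_zero hq0 hq1 m
    push_cast at hX ⊢
    rw [show -((m : ℤ) + 1) = Int.negSucc m by rw [Int.negSucc_eq], phiR_negSucc, neg_zero,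
      phiR_zero, parity_create_vac, map_neg, OmegaRNS_vac_create hq0 hq1 hι hs, hX,
      gam_zero]
    ring
  | succ n =>
    rw [show -((n + 1 : ℕ) : ℤ) = Int.negSucc n from rfl, phiR_negSucc]
    cases m with
    | zero =>
      have hX := coeffX_natCast q 0 (2 * (n + 1))
      have h2 := one_sub_pow_ne_zero hq0 hq1 (a := 2 * (2 * (n + 1))) (by omega)
      push_cast at hX ⊢
      rw [neg_zero, phiR_zero_vac, OmegaRNS_vac_create hq0 hq1 hι hs, hX, pow_zero,
        zero_add, div_self h2, gam_zero]
      ring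
    | succ m =>
      rw [show -((m + 1 : ℕ) : ℤ) = Int.negSucc m from rfl, phiR_negSucc,
        OmegaRNS_create_right hq0 hq1 hι hs (boundedBy_vac.mono (Nat.zero_le _))
          (boundedBy_create_vac m), wickR, sum_phiR_create_vac, OmegaRNS_vac_vac hq0 hq1 hι hs,
        OmegaRNS_vac_create hq0 hq1 hι hs, kerF_zero_right]
      simp only [phiNS_natCast_vac, map_zero, LinearMap.zero_apply, mul_zero,
        Finset.sum_const_zero, add_zero]
      have hk := kerF_R_sub hq0 hq1 n m
      rw [← hk]
      ring

theorem OmegaRNS_two_point_mixed (n k : ℕ) :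
    OmegaRNS q ι s (phiNS q (-k - 1) vac) (phiR q (-n) vac) =
      -(rootConst q ι s * coeffX q (-(2 * k) - 1) (2 * n) * gam q n * gam q k *
        (xArg q s ^ k * yArg q s ^ n)) := by
  rw [show -(k : ℤ) - 1 = Int.negSucc k by rw [Int.negSucc_eq]; ring, phiNS_negSucc]
  cases n with
  | zero =>
    rw [Nat.cast_zero, neg_zero, phiR_zero_vac, OmegaRNS_create_vac hq0 hq1 hι hs, mul_zero,
      coeffX_neg_zero hq0 hq1, gam_zero]
    ring
  | succ n =>
    rw [show -((n + 1 : ℕ) : ℤ) = Int.negSucc n from rfl, phiR_negSucc,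
      OmegaRNS_create_left hq0 hq1 hι hs (boundedBy_vac.mono (Nat.zero_le _))
        (boundedBy_create_vac n), wickNS, sum_phiR_create_vac, OmegaRNS_vac_vac hq0 hq1 hι hs,
      OmegaRNS_vac_create hq0 hq1 hι hs, kerH_zero_right hq0 hq1]
    simp only [phiNS_natCast_vac, map_zero, LinearMap.zero_apply, mul_zero,
      Finset.sum_const_zero, zero_add]
    have hk := kerH_R_sub hq0 hq1 k n
    linear_combination (rootConst q ι s * xArg q s ^ k * yArg q s ^ (n + 1)) * hk

theorem OmegaRNS_two_point_NS (k l : ℕ) :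
    OmegaRNS q ι s (phiNS q (-l - 1) (phiNS q (-k - 1) vac)) vac =
      -(coeffX q (2 * l + 1) (2 * k + 1) * gam q l * gam q k * xArg q s ^ (l + k + 1) / q) := by
  rw [show -(k : ℤ) - 1 = Int.negSucc k by rw [Int.negSucc_eq]; ring, phiNS_negSucc,
    show -(l : ℤ) - 1 = Int.negSucc l by rw [Int.negSucc_eq]; ring, phiNS_negSucc,
    OmegaRNS_create_left hq0 hq1 hι hs (boundedBy_create_vac k)
      (boundedBy_vac.mono (Nat.zero_le _)), wickNS]
  have h1 := sum_phiNS_create_vac (q := q) ((OmegaRNS q ι s).flip vac)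
    (fun j => xArg q s ^ (l + j + 1) * kerF q l j) k
  simp only [LinearMap.flip_apply] at h1
  have h2 : ∑ m ∈ Finset.range (k + 1 + 1), xArg q s ^ l * yArg q s ^ m * kerH q l m *
      OmegaRNS q ι s (create k vac) (phiR q m vac) =
      xArg q s ^ l * gam q l * (rootConst q ι s * (gam q k * xArg q s ^ k)) := by
    rw [Finset.sum_range_succ', Finset.sum_eq_zero, Nat.cast_zero, phiR_zero_vac,
      OmegaRNS_create_vac hq0 hq1 hι hs, kerH_zero_right hq0 hq1]
    · ring
    · intro j _
      rw [phiR_succ_vac, map_zero, mul_zero]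
  -- Here φ^R_0 acts on the vacuum by +1. The sign of the disconnected term, and the 1/q, come
  -- instead from κ², one κ from each one-point function.
  have hκ : rootConst q ι s ^ 2 = -(xArg q s / q) := by
    rw [rootConst, xArg, mul_pow, mul_pow, hι]
    field_simp
  have hk := kerF_NS_sub hq0 hq1 l k
  rw [h1, h2, OmegaRNS_vac_vac hq0 hq1 hι hs]
  linear_combination (xArg q s ^ (l + k + 1)) * hk +
    xArg q s ^ (l + k) * gam q l * gam q k * hκ

end TwoPoint

/-! ### The point z = q⁻⁴, where x = y = q -/

section Special

variable {q ι : ℂ} (hq0 : q ≠ 0)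
include hq0

theorem xArg_special : xArg q (q ^ (-2 : ℤ)) = q := by
  rw [xArg]
  field_simp

theorem yArg_special : yArg q (q ^ (-2 : ℤ)) = q := by
  rw [yArg]
  field_simp

theorem rootConst_special : rootConst q ι (q ^ (-2 : ℤ)) = ι := by
  rw [rootConst]
  field_simp

theorem special_ne_zero : q ^ (-2 : ℤ) ≠ 0 := zpow_ne_zero _ hq0

theorem yArg_dualRoot_special : yArg q (dualRoot q (q ^ (-2 : ℤ))) = q := by
  have hs := special_ne_zero hq0
  rw [← xArg_dualRoot hq0 (dualRoot_ne_zero hq0 hs), dualRoot_dualRoot hq0 hs, xArg_special hq0]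

end Special

end

end FermionEmission

open FermionEmission in
theorem mainTheorem4 (q ι : ℂ) (hq0 : q ≠ 0) (hq1 : ‖q‖ < 1) (hι : ι ^ 2 = -1) :
    -- for each `z = s² ≠ 0`:
    (∀ s : ℂ, s ≠ 0 →
      -- the exponentials make sense, and their matrix elements are those of the full sums
      (∀ N, IsNilpotent (expY q ι s N)) ∧
      (∀ N, IsNilpotent (expY' q ι s N)) ∧
      (∀ out inc, ∀ᶠ N in Filter.atTop, cutNSR q ι s N out inc = OmegaNSR q ι s out inc) ∧
      (∀ out inc, ∀ᶠ N in Filter.atTop, cutRNS q ι s N out inc = OmegaRNS q ι s out inc) ∧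
      -- they are exactly the normalized solutions of the exchange relations
      (∀ Om : FockR →ₗ[ℂ] FockNS →ₗ[ℂ] ℂ,
        (ExchangeNSR q ι s Om ∧ Om vac vac = 1) ↔ Om = OmegaNSR q ι s) ∧
      (∀ Om : FockNS →ₗ[ℂ] FockR →ₗ[ℂ] ℂ,
        (ExchangeRNS q ι s Om ∧ Om vac vac = 1) ↔ Om = OmegaRNS q ι s) ∧
      -- one-point functions
      (∀ u : ℂ, u ≠ 0 → ‖u ^ 2‖ < ‖q ^ 3 * s ^ 2‖ →
        HasSum (fun n : ℤ => OmegaNSR q ι s vac (phiNS q n vac) * u ^ (-(2 * n + 1)))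
          ((rootFactor q ι s u)⁻¹ *
            (qPoch q (u ^ 2 / (q * s ^ 2)) / qPoch q (u ^ 2 / (q ^ 3 * s ^ 2)))) ∧
        HasSum (fun n : ℤ => OmegaRNS q ι s vac (phiR q n vac) * u ^ (-(2 * n)))
          (qPoch q (u ^ 2 / (q * s ^ 2)) / qPoch q (u ^ 2 / (q ^ 3 * s ^ 2))))) ∧
    -- two-point functions at `z = q⁻⁴`, `z^{1/2} = q⁻²`
    (∀ n m : ℕ, (n, m) ≠ (0, 0) →
      OmegaRNS q ι (q ^ (-2 : ℤ)) vac (phiR q (-n) (phiR q (-m) vac)) =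
        coeffX q (2 * m) (2 * n) * gam q n * gam q m * q ^ (n + m)) ∧
    (∀ n k : ℕ,
      OmegaRNS q ι (q ^ (-2 : ℤ)) (phiNS q (-k - 1) vac) (phiR q (-n) vac) =
        -ι * coeffX q (-(2 * k) - 1) (2 * n) * gam q n * gam q k * q ^ (n + k)) ∧
    (∀ k l : ℕ,
      OmegaRNS q ι (q ^ (-2 : ℤ)) (phiNS q (-l - 1) (phiNS q (-k - 1) vac)) vac =
        -coeffX q (2 * l + 1) (2 * k + 1) * gam q l * gam q k * q ^ (l + k)) ∧
    (∀ n m : ℕ, (n, m) ≠ (0, 0) →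
      OmegaNSR q ι (q ^ (-2 : ℤ)) (phiR q (-m) (phiR q (-n) vac)) vac =
        coeffX q (2 * n) (2 * m) * gam q n * gam q m * q ^ (n + m)) ∧
    (∀ n k : ℕ,
      OmegaNSR q ι (q ^ (-2 : ℤ)) (phiR q (-n) vac) (phiNS q (-k - 1) vac) =
        ι * coeffX q (-(2 * k) - 1) (2 * n) * gam q n * gam q k * q ^ (n + k)) ∧
    (∀ k l : ℕ,
      OmegaNSR q ι (q ^ (-2 : ℤ)) vac (phiNS q (-k - 1) (phiNS q (-l - 1) vac)) =
        coeffX q (2 * l + 1) (2 * k + 1) * gam q l * gam q k * q ^ (l + k)) := by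
  have hs0 := special_ne_zero hq0
  have hd0 := dualRoot_ne_zero hq0 hs0
  have hx := xArg_special hq0
  have hy := yArg_special hq0
  have hκ := rootConst_special (ι := ι) hq0
  have hdx := (xArg_dualRoot hq0 hs0).trans hy
  have hdy := yArg_dualRoot_special hq0
  -- The duality fixes z = q⁻⁴ but reverses its square root. So only κ changes, and with it the sign
  -- of the mixed two-point function.
  have hdκ : rootConst q ι (dualRoot q (q ^ (-2 : ℤ))) = -ι := by
    rw [rootConst_dualRoot hq0 hι hs0, hκ]
    exact inv_eq_of_mul_eq_one_right (by linear_combination -hι)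
  refine ⟨fun s hs => ⟨isNilpotent_expY q ι s, isNilpotent_expY' hq0 hq1 ι s, ?_,
    cutForm_eventually_eq hq0 hq1 hι hs, exchangeNSR_iff hq0 hq1 hι hs,
    exchangeRNS_iff hq0 hq1 hι hs, fun u hu h =>
    ⟨hasSum_OmegaNSR_one_point hq0 hq1 hι hs hu h, hasSum_OmegaRNS_one_point hq0 hq1 hι hs hu h⟩⟩,
    ?_, ?_, ?_, ?_, ?_, ?_⟩
  · intro out inc
    filter_upwards [cutForm_eventually_eq hq0 hq1 hι (dualRoot_ne_zero hq0 hs) inc out] with N hN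
    rw [cutNSR_eq hq0 hq1 ι hs, OmegaNSR_eq hq0 hq1 ι hs]
    exact hN
  · intro n m h
    rw [OmegaRNS_two_point_R hq0 hq1 hι hs0 h, hy]
  · intro n k
    rw [OmegaRNS_two_point_mixed hq0 hq1 hι hs0, hx, hy, hκ]
    ring
  · intro k l
    rw [OmegaRNS_two_point_NS hq0 hq1 hι hs0, hx, pow_succ]
    field_simp
  · intro n m h
    rw [OmegaNSR_eq hq0 hq1 ι hs0, OmegaRNS_two_point_R hq0 hq1 hι hd0 (by
      rintro h'
      rw [Prod.mk.injEq] at h'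
      exact h (by rw [h'.1, h'.2])), hdy]
    ring
  · intro n k
    rw [OmegaNSR_eq hq0 hq1 ι hs0, OmegaRNS_two_point_mixed hq0 hq1 hι hd0, hdx, hdy, hdκ]
    ring
  · intro k l
    -- Transposition presents the two modes in the opposite order, and antisymmetry of X cancels the
    -- minus sign of the Neveu-Schwarz two-point function.
    have hX : coeffX q (2 * k + 1) (2 * l + 1) = -coeffX q (2 * l + 1) (2 * k + 1) := by
      rw [coeffX_antisymm]
    rw [OmegaNSR_eq hq0 hq1 ι hs0, OmegaRNS_two_point_NS hq0 hq1 hι hd0, hdx, hX, pow_succ,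
      add_comm l k]
    field_simp
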